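/- An \emph{unbiased bicategory} $\mathcal B$ consists of a class of objects; a category $\mathcal B(A,B)$ for all objects $A,B$ (its objects are the 1-cells and its morphisms the 2-cells); for every $n\ge 0$ and all objects $A_0,\dots,A_n$ a composition functor $\mathcal B(A_{n-1},A_n)\times\cdots\times\mathcal B(A_0,A_1)\to\mathcal B(A_0,A_n)$, written $(f_n,\dots,f_1)\mapsto(f_n\circ\cdots\circ f_1)$ on 1-cells; for every double sequence of composable 1-cells, an invertible 2-cell $$\gamma:((f_n^{k_n}\circ\cdots\circ f_n^1)\circ\cdots\circ(f_1^{k_1}\circ\cdots\circ f_1^1))\to(f_n^{k_n}\circ\cdots\circ f_1^1),$$ natural in the $f_i^j$; and for every 1-cell $f$ an invertible 2-cell $\iota_f:f\to(f)$, natural in $f$. These satisfy: for every triple sequence, the two composites of instances of $\gamma$ that remove the two inner layers of brackets (innermost layer first, or middle layer first) agree; and for every sequence $f_1,\dots,f_n$, the composites $(f_n\circ\cdots\circ f_1)\to((f_n)\circ\cdots\circ(f_1))\to(f_n\circ\cdots\circ f_1)$ and $(f_n\circ\cdots\circ f_1)\to((f_n\circ\cdots\circ f_1))\to(f_n\circ\cdots\circ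 f_1)$ of $\iota$'s followed by $\gamma$ are identities. An \emph{unbiased lax functor} $(F,\phi):\mathcal B\to\mathcal B'$ consists of a function $F$ on objects, functors $F:\mathcal B(A,B)\to\mathcal B'(FA,FB)$, and 2-cells $\phi_{f_1,\dots,f_n}:(Ff_n\circ\cdots\circ Ff_1)\to F(f_n\circ\cdots\circ f_1)$ for all composable sequences with $n\ge 0$, natural in the $f_i$, such that for every double sequence $F\gamma\circ\phi\circ(\phi*\cdots*\phi)=\phi\circ\gamma'$, and for every 1-cell $f$, $\phi_f\circ\iota'_{Ff}=F\iota_f$. It is \emph{weak} (\emph{strict}) if every $\phi_{f_1,\dots,f_n}$ is invertible (an identity). The composite of $(F,\phi)$ and $(F',\phi')$ has coherence 2-cells $F'\phi_{f_1,\dots,f_n}\circ\phi'_{Ff_1,\dots,Ff_n}$. This gives categories $\mathbf{UBicat}_{\rm str}\subseteq\mathbf{UBicat}_{\rm wk}\subseteq\mathbf{UBicat}_{\rm lax}$ with the same objects. Let $\mathbf{Bicat}_{\rm str}\subseteq\mathbf{Bicat}_{\rm wk}\subseteq\mathbf{Bicat}_{\rm lax}$ be the categories of classical bicategories with strict, weak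 (all coherence 2-cells invertible) and lax functors. For an unbiased bicategory $\mathcal B$ let $V(\mathcal B)$ have the objects, 1-cells and 2-cells of $\mathcal B$, the binary composition of $\mathcal B$, the nullary composites $1_A=()$ as identities, the associativity isomorphism $$((h\circ g)\circ f)\xrightarrow{(1*\iota_f)}((h\circ g)\circ(f))\xrightarrow{\gamma}(h\circ g\circ f)\xrightarrow{\gamma^{-1}}((h)\circ(g\circ f))\xrightarrow{(\iota_h^{-1}*1)}(h\circ(g\circ f)),$$ the unit isomorphism $(()\circ f)\xrightarrow{(1*\iota_f)}(()\circ(f))\xrightarrow{\gamma}(f)\xrightarrow{\iota_f^{-1}}f$, and dually on the other side. For an unbiased lax functor $(F,\phi)$ let $V(F,\phi)$ be $F$ with the coherence 2-cells $\phi_{f,g}$ and $\phi_{()}$ only. \textbf{Theorem.} \begin{enumerate} \item $V(\mathcal B)$ is a bicategory, $V(F,\phi)$ is a lax functor, and $V$ is a functor $\mathbf{UBicat}_{\rm lax}\to\mathbf{Bicat}_{\rm lax}$; it restricts to functors $V_{\rm wk}:\mathbf{UBicat}_{\rm wk}\to\mathbf{Bicat}_{\rm wk}$ and $V_{\rm str}:\mathbf{UBicat}_{\rm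 str}\to\mathbf{Bicat}_{\rm str}$. \item $V$ is full, faithful and surjective on objects. \item $V_{\rm wk}$ is full, faithful and surjective on objects. \item Hence $V$ and $V_{\rm wk}$ are equivalences of categories, $\mathbf{UBicat}_{\rm lax}\simeq\mathbf{Bicat}_{\rm lax}$ and $\mathbf{UBicat}_{\rm wk}\simeq\mathbf{Bicat}_{\rm wk}$. \item $V_{\rm str}$ is faithful and surjective on objects, but not full. \item There is a functor $L:\mathbf{Bicat}_{\rm lax}\to\mathbf{UBicat}_{\rm lax}$ with $VL=1$ and $LV\cong 1$ which associates to the left: $L(\mathcal C)$ has the objects, 1-cells and 2-cells of $\mathcal C$, the composites $()=1_A$, $(f_1)=f_1$ and $(f_n\circ\cdots\circ f_1)=(\cdots((f_n\circ f_{n-1})\circ f_{n-2})\circ\cdots)\circ f_1$ for $n\ge 2$ (and likewise for 2-cells), $\iota$ the identity, and $\gamma$ the canonical isomorphism built from the associativity and unit isomorphisms of $\mathcal C$. Moreover $L$ restricts to a functor $L_{\rm wk}:\mathbf{Bicat}_{\rm wk}\to\mathbf{UBicat}_{\rm wk}$ with $V_{\rm wk}L_{\rm wk}=1$ and $L_{\rm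 wk}V_{\rm wk}\cong 1$. \end{enumerate} -/

import Mathlib

open CategoryTheory

set_option linter.checkUnivs false

universe w v u w' v' u' w'' v'' u'' w''' v'''

/-- Composable sequences of `n ≥ 0` arrows `f₁ : A₀ → A₁, …, fₙ : Aₙ₋₁ → Aₙ` in the family `X`,
listed from the first arrow `f₁` to the last arrow `fₙ`. -/
inductive CSeq {O : Type u} (X : O → O → Type v) : O → O → Type (max u v)
  | nil (a : O) : CSeq X a a
  | cons {a b c : O} (f : X a b) (s : CSeq X b c) : CSeq X a c

namespace CSeq

/-- The one-term sequence. -/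
@[reducible] def single {O : Type u} {X : O → O → Type v} {a b : O} (f : X a b) : CSeq X a b :=
  cons f (nil b)

/-- The two-term sequence: first `f`, then `g`. -/
@[reducible] def pair {O : Type u} {X : O → O → Type v} {a b c : O} (f : X a b)
    (g : X b c) : CSeq X a c :=
  cons f (single g)

/-- Concatenation. -/
@[reducible] def append {O : Type u} {X : O → O → Type v} {a b c : O} :
    CSeq X a b → CSeq X b c → CSeq X a c
  | nil _, t => t
  | cons f s, t => cons f (append s t)

/-- Concatenation of a double sequence. -/
@[reducible] def flatten {O : Type u} {X : O → O → Type v} {a b : O} :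
    CSeq (CSeq X) a b → CSeq X a b
  | nil a => nil a
  | cons s D => append s (flatten D)

/-- Termwise application of a map of graphs. -/
@[reducible] def map {O : Type u} {O' : Type u'} {X : O → O → Type v} {Y : O' → O' → Type v'}
    (F₀ : O → O') (F : ∀ a b : O, X a b → Y (F₀ a) (F₀ b)) {a b : O} :
    CSeq X a b → CSeq Y (F₀ a) (F₀ b)
  | nil a => nil (F₀ a)
  | cons f s => cons (F _ _ f) (map F₀ F s)

theorem append_nil {O : Type u} {X : O → O → Type v} {a b : O} (s : CSeq X a b) :
    append s (nil b) = s := by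
  induction s with
  | nil a => rfl
  | cons f s ih => exact congrArg (cons f) ih

theorem append_assoc {O : Type u} {X : O → O → Type v} {a b c d : O} (s : CSeq X a b)
    (t : CSeq X b c) (r : CSeq X c d) : append (append s t) r = append s (append t r) := by
  induction s with
  | nil a => rfl
  | cons f s ih => exact congrArg (cons f) (ih t)

theorem flatten_append {O : Type u} {X : O → O → Type v} {a b c : O} (D : CSeq (CSeq X) a b)
    (E : CSeq (CSeq X) b c) : flatten (append D E) = append (flatten D) (flatten E) := by
  induction D with
  | nil a => rfl
  | cons s D ih => exact (congrArg (append s) (ih E)).trans (append_assoc _ _ _).symm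

theorem flatten_single {O : Type u} {X : O → O → Type v} {a b : O} (s : CSeq X a b) :
    flatten (single s) = s :=
  append_nil s

theorem flatten_map_single {O : Type u} {X : O → O → Type v} {a b : O} (s : CSeq X a b) :
    flatten (map (fun x => x) (fun _ _ f => single f) s) = s := by
  induction s with
  | nil a => rfl
  | cons f s ih => exact congrArg (cons f) ih

theorem flatten_map_flatten {O : Type u} {X : O → O → Type v} {a b : O}
    (T : CSeq (CSeq (CSeq X)) a b) :
    flatten (map (fun x => x) (fun _ _ D => flatten D) T) = flatten (flatten T) := by
  induction T with
  | nil a => rfl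
  | cons D T ih => exact (congrArg (append (flatten D)) ih).trans (flatten_append _ _).symm

section

variable {O : Type u} {O' : Type u'} {O'' : Type u''} {X : O → O → Type v}
  {Y : O' → O' → Type v'} {Z : O'' → O'' → Type v''}

theorem map_append (F₀ : O → O') (F : ∀ a b : O, X a b → Y (F₀ a) (F₀ b)) {a b c : O}
    (s : CSeq X a b) (t : CSeq X b c) :
    map F₀ F (append s t) = append (map F₀ F s) (map F₀ F t) := by
  induction s with
  | nil a => rfl
  | cons f s ih => exact congrArg (cons (F _ _ f)) (ih t)

theorem flatten_map_map (F₀ : O → O') (F : ∀ a b : O, X a b → Y (F₀ a) (F₀ b)) {a b : O}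
    (D : CSeq (CSeq X) a b) :
    flatten (map F₀ (fun _ _ s => map F₀ F s) D) = map F₀ F (flatten D) := by
  induction D with
  | nil a => rfl
  | cons s D ih => exact (congrArg (append (map F₀ F s)) ih).trans (map_append F₀ F _ _).symm

theorem map_map (F₀ : O → O') (F : ∀ a b : O, X a b → Y (F₀ a) (F₀ b))
    (G₀ : O' → O'') (G : ∀ a b : O', Y a b → Z (G₀ a) (G₀ b)) {a b : O} (s : CSeq X a b) :
    map (fun x => G₀ (F₀ x)) (fun _ _ f => G _ _ (F _ _ f)) s = map G₀ G (map F₀ F s) := by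
  induction s with
  | nil a => rfl
  | cons f s ih => exact congrArg (cons _) ih

theorem map_id {a b : O} (s : CSeq X a b) : map (fun x => x) (fun _ _ f => f) s = s := by
  induction s with
  | nil a => rfl
  | cons f s ih => exact congrArg (cons _) ih

end

/-- A 2-cell between composable sequences through the same objects `A₀, …, Aₙ`: a sequence of
2-cells `αᵢ : fᵢ ⟶ gᵢ`. There is none between sequences through different objects. -/
inductive Hom₂ {O : Type u} {X : O → O → Type v} [∀ a b, Category.{w} (X a b)] :
    ∀ {a b : O}, CSeq X a b → CSeq X a b → Type (max u v w)
  | nil (a : O) : Hom₂ (CSeq.nil a) (CSeq.nil a)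
  | cons {a b c : O} {f g : X a b} {s t : CSeq X b c} (α : f ⟶ g) (σ : Hom₂ s t) :
      Hom₂ (CSeq.cons f s) (CSeq.cons g t)

namespace Hom₂

variable {O : Type u} {X : O → O → Type v} [∀ a b, Category.{w} (X a b)]

protected def id {a b : O} : ∀ s : CSeq X a b, Hom₂ s s
  | CSeq.nil a => nil a
  | CSeq.cons f s => cons (𝟙 f) (Hom₂.id s)

protected def comp {a b : O} {s t r : CSeq X a b} : Hom₂ s t → Hom₂ t r → Hom₂ s r
  | nil a, nil _ => nil a
  | cons α σ, cons β τ => cons (α ≫ β) (Hom₂.comp σ τ)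

end Hom₂

/-- The category of composable sequences from `a` to `b`: the coproduct over all
`a = A₀, A₁, …, Aₙ = b` of the product categories `X A₀ A₁ × ⋯ × X Aₙ₋₁ Aₙ`. -/
instance category {O : Type u} {X : O → O → Type v} [∀ a b, Category.{w} (X a b)] (a b : O) :
    Category.{max u v w} (CSeq X a b) where
  Hom s t := Hom₂ s t
  id s := Hom₂.id s
  comp σ τ := Hom₂.comp σ τ
  id_comp σ := by
    induction σ with
    | nil a => rfl
    | cons α σ ih => exact congrArg₂ Hom₂.cons (Category.id_comp α) ih
  comp_id σ := by
    induction σ with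
    | nil a => rfl
    | cons α σ ih => exact congrArg₂ Hom₂.cons (Category.comp_id α) ih
  assoc {s₁ s₂ s₃ s₄} σ τ ρ := by
    induction σ with
    | nil a => cases τ; cases ρ; rfl
    | cons α σ ih =>
      cases τ with
      | cons β τ =>
        cases ρ with
        | cons δ ρ => exact congrArg₂ Hom₂.cons (Category.assoc α β δ) (ih τ ρ)

section

variable {O : Type u} {X : O → O → Type v} [∀ a b, Category.{w} (X a b)]

/-- The sequence of 2-cells `α, σ₁, …, σₙ`. -/
def consHom {a b c : O} {f g : X a b} {s t : CSeq X b c} (α : f ⟶ g) (σ : s ⟶ t) :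
    cons f s ⟶ cons g t :=
  Hom₂.cons α σ

/-- The sequence consisting of one 2-cell. -/
abbrev singleHom {a b : O} {f g : X a b} (α : f ⟶ g) : single f ⟶ single g :=
  consHom α (𝟙 _)

/-- The sequence consisting of two 2-cells. -/
abbrev pairHom {a b c : O} {f f' : X a b} {g g' : X b c} (α : f ⟶ f') (β : g ⟶ g') :
    pair f g ⟶ pair f' g' :=
  consHom α (singleHom β)

theorem id_cons {a b c : O} (f : X a b) (s : CSeq X b c) : 𝟙 (cons f s) = consHom (𝟙 f) (𝟙 s) :=
  rfl

theorem consHom_comp {a b c : O} {f g h : X a b} {s t r : CSeq X b c} (α : f ⟶ g) (β : g ⟶ h)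
    (σ : s ⟶ t) (τ : t ⟶ r) : consHom α σ ≫ consHom β τ = consHom (α ≫ β) (σ ≫ τ) :=
  rfl

/-- The one-term sequences, as a functor. -/
abbrev singleFunctor (X : O → O → Type v) [∀ a b, Category.{w} (X a b)] (a b : O) :
    X a b ⥤ CSeq X a b where
  obj f := single f
  map α := singleHom α

def appendHom {a b c : O} : ∀ {s s' : CSeq X a b} {t t' : CSeq X b c},
    Hom₂ s s' → (t ⟶ t') → (append s t ⟶ append s' t')
  | _, _, _, _, Hom₂.nil _, τ => τ
  | _, _, _, _, Hom₂.cons α σ, τ => consHom α (appendHom σ τ)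

theorem appendHom_id {a b c : O} (s : CSeq X a b) (t : CSeq X b c) :
    appendHom (Hom₂.id s) (𝟙 t) = 𝟙 (append s t) := by
  induction s with
  | nil a => rfl
  | cons f s ih => exact congrArg (consHom (𝟙 f)) (ih t)

theorem appendHom_comp {a b c : O} {s s' s'' : CSeq X a b} {t t' t'' : CSeq X b c}
    (σ : Hom₂ s s') (σ' : Hom₂ s' s'') (τ : t ⟶ t') (τ' : t' ⟶ t'') :
    appendHom (Hom₂.comp σ σ') (τ ≫ τ') = appendHom σ τ ≫ appendHom σ' τ' := by
  induction σ with
  | nil a => cases σ'; rfl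
  | cons α σ ih => cases σ' with | cons β σ' => exact congrArg (consHom (α ≫ β)) (ih σ' τ τ')

def flattenHom {a b : O} : ∀ {D E : CSeq (CSeq X) a b}, Hom₂ D E → (flatten D ⟶ flatten E)
  | _, _, Hom₂.nil a => 𝟙 (nil a)
  | _, _, Hom₂.cons α σ => appendHom α (flattenHom σ)

theorem flattenHom_comp {a b : O} {D E F : CSeq (CSeq X) a b} (σ : Hom₂ D E) (τ : Hom₂ E F) :
    flattenHom (Hom₂.comp σ τ) = flattenHom σ ≫ flattenHom τ := by
  induction σ with
  | nil a => cases τ; rfl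
  | cons α σ ih =>
    cases τ with
    | cons β τ => exact (congrArg (appendHom (α ≫ β)) (ih τ)).trans (appendHom_comp _ _ _ _)

/-- Concatenation of double sequences, as a functor. -/
abbrev flattenFunctor (X : O → O → Type v) [∀ a b, Category.{w} (X a b)] (a b : O) :
    CSeq (CSeq X) a b ⥤ CSeq X a b where
  obj D := flatten D
  map σ := flattenHom σ
  map_id D := by
    induction D with
    | nil a => rfl
    | cons s D ih => exact (congrArg (appendHom (𝟙 s)) ih).trans (appendHom_id _ _)
  map_comp σ τ := flattenHom_comp σ τ

variable {O' : Type u'} {Y : O' → O' → Type v'} [∀ a b, Category.{w'} (Y a b)]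

def mapHom (F₀ : O → O') (F : ∀ a b : O, X a b ⥤ Y (F₀ a) (F₀ b)) {a b : O} :
    ∀ {s t : CSeq X a b}, Hom₂ s t →
      (map F₀ (fun a b => (F a b).obj) s ⟶ map F₀ (fun a b => (F a b).obj) t)
  | _, _, Hom₂.nil a => 𝟙 (nil (F₀ a))
  | _, _, Hom₂.cons α σ => consHom ((F _ _).map α) (mapHom F₀ F σ)

theorem mapHom_comp (F₀ : O → O') (F : ∀ a b : O, X a b ⥤ Y (F₀ a) (F₀ b)) {a b : O}
    {s t r : CSeq X a b} (σ : Hom₂ s t) (τ : Hom₂ t r) :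
    mapHom F₀ F (Hom₂.comp σ τ) = mapHom F₀ F σ ≫ mapHom F₀ F τ := by
  induction σ with
  | nil a => cases τ; rfl
  | cons α σ ih =>
    cases τ with
    | cons β τ => exact congrArg₂ Hom₂.cons ((F _ _).map_comp α β) (ih τ)

/-- Termwise application of a map of `Cat`-graphs, as a functor. -/
abbrev mapFunctor (F₀ : O → O') (F : ∀ a b : O, X a b ⥤ Y (F₀ a) (F₀ b)) (a b : O) :
    CSeq X a b ⥤ CSeq Y (F₀ a) (F₀ b) where
  obj s := map F₀ (fun a b => (F a b).obj) s
  map σ := mapHom F₀ F σ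
  map_id s := by
    induction s with
    | nil a => rfl
    | cons f s ih => exact congrArg₂ Hom₂.cons ((F _ _).map_id f) ih
  map_comp σ τ := mapHom_comp F₀ F σ τ

variable {P : O → O → Type v''} [∀ a b, Category.{w''} (P a b)]
variable {O'' : Type u''} {Z : O'' → O'' → Type*} [∀ a b, Category (Z a b)]

/-- Termwise application of a family of 2-cells `α f : G (F f) ⟶ K (H f)` to a sequence. -/
def mapCell {F₀ : O → O'} {F : ∀ a b : O, X a b ⥤ Y (F₀ a) (F₀ b)}
    {G₀ : O' → O''} {G : ∀ a b : O', Y a b ⥤ Z (G₀ a) (G₀ b)}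
    {H : ∀ a b : O, X a b ⥤ P a b}
    {K : ∀ a b : O, P a b ⥤ Z (G₀ (F₀ a)) (G₀ (F₀ b))}
    (α : ∀ (a b : O) (f : X a b), (G _ _).obj ((F a b).obj f) ⟶ (K a b).obj ((H a b).obj f))
    {a b : O} : ∀ s : CSeq X a b,
      ((mapFunctor G₀ G (F₀ a) (F₀ b)).obj ((mapFunctor F₀ F a b).obj s) ⟶
      (mapFunctor (fun x => G₀ (F₀ x)) K a b).obj ((mapFunctor (fun x => x) H a b).obj s))
  | nil a => 𝟙 (nil (G₀ (F₀ a)))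
  | cons f s => consHom (α _ _ f) (mapCell α s)

/-- Termwise application of a family of 2-cells `α f : f ⟶ K (H f)` to a sequence. -/
def unitCell {H : ∀ a b : O, X a b ⥤ P a b} {K : ∀ a b : O, P a b ⥤ X a b}
    (α : ∀ (a b : O) (f : X a b), f ⟶ (K a b).obj ((H a b).obj f)) {a b : O} :
    ∀ s : CSeq X a b,
      (s ⟶ (mapFunctor (fun x => x) K a b).obj ((mapFunctor (fun x => x) H a b).obj s))
  | nil a => 𝟙 (nil a)
  | cons f s => consHom (α _ _ f) (unitCell α s)

end

end CSeq

section

variable {O : Type u}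

/-- The coherence structure of an unbiased bicategory on a family `X` of hom-categories with
`n`-ary composition functors `comp`, where `comp a b` restricts, on the sequences through
`a = A₀, …, Aₙ = b`, to a functor `X A₀ A₁ × ⋯ × X Aₙ₋₁ Aₙ ⥤ X A₀ Aₙ`. -/
structure UnbiasedCoherence (X : O → O → Type v) [∀ a b, Category.{w} (X a b)]
    (comp : ∀ a b : O, CSeq X a b ⥤ X a b) where
  /-- Removal of inner brackets, natural in the double sequence of 1-cells. -/
  γ (a b : O) : CSeq.mapFunctor (fun x => x) comp a b ⋙ comp a b ≅
    CSeq.flattenFunctor X a b ⋙ comp a b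
  /-- `f ≅ (f)`, natural in `f`. -/
  ι (a b : O) : 𝟭 (X a b) ≅ CSeq.singleFunctor X a b ⋙ comp a b
  /-- Associativity, for each triple sequence of 1-cells. The `eqToHom`s identify equal
  sequences. -/
  assoc {a b : O} (T : CSeq (CSeq (CSeq X)) a b) :
    (comp a b).map (CSeq.mapCell (fun a b D => (γ a b).hom.app D) T) ≫
        (γ a b).hom.app ((CSeq.mapFunctor (fun x => x) (CSeq.flattenFunctor X) a b).obj T) ≫
          (comp a b).map (eqToHom (CSeq.flatten_map_flatten T)) =
      (γ a b).hom.app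
          ((CSeq.mapFunctor (fun x => x) (CSeq.mapFunctor (fun x => x) comp) a b).obj T) ≫
        (comp a b).map (eqToHom (CSeq.flatten_map_map (fun x => x) _ T)) ≫
          (γ a b).hom.app (CSeq.flatten T)
  /-- First identity axiom. -/
  map_ι_γ {a b : O} (s : CSeq X a b) :
    (comp a b).map (CSeq.unitCell (fun a b f => (ι a b).hom.app f) s) ≫
      (γ a b).hom.app ((CSeq.mapFunctor (fun x => x) (CSeq.singleFunctor X) a b).obj s) ≫
        (comp a b).map (eqToHom (CSeq.flatten_map_single s)) = 𝟙 _
  /-- Second identity axiom. -/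
  ι_γ {a b : O} (s : CSeq X a b) :
    (ι a b).hom.app ((comp a b).obj s) ≫ (γ a b).hom.app (CSeq.single s) ≫
      (comp a b).map (eqToHom (CSeq.flatten_single s)) = 𝟙 _

end

/-- An unbiased bicategory. -/
structure UBicat : Type (max (u + 1) (v + 1) (w + 1)) where
  /-- The 0-cells. -/
  Obj : Type u
  /-- The 1-cells. -/
  Hom : Obj → Obj → Type v
  /-- The hom-categories, whose morphisms are the 2-cells. -/
  homCat (a b : Obj) : Category.{w} (Hom a b)
  /-- The composition functors, of all arities. -/
  comp (a b : Obj) : CSeq Hom a b ⥤ Hom a b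
  /-- The coherence isomorphisms, with their axioms. -/
  coh : UnbiasedCoherence Hom comp

attribute [instance] UBicat.homCat

namespace UBicat

/-- The composite of a sequence of 1-cells. -/
abbrev cmp (B : UBicat.{w, v, u}) {a b : B.Obj} (s : CSeq B.Hom a b) : B.Hom a b :=
  (B.comp a b).obj s

/-- The composite of a sequence of 2-cells. -/
abbrev cmp₂ (B : UBicat.{w, v, u}) {a b : B.Obj} {s t : CSeq B.Hom a b} (σ : s ⟶ t) :
    B.cmp s ⟶ B.cmp t :=
  (B.comp a b).map σ

/-- The isomorphism `γ` at a double sequence. -/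
abbrev γ (B : UBicat.{w, v, u}) {a b : B.Obj} (D : CSeq (CSeq B.Hom) a b) :
    B.cmp ((CSeq.mapFunctor (fun x => x) B.comp a b).obj D) ≅ B.cmp (CSeq.flatten D) :=
  (B.coh.γ a b).app D

/-- The isomorphism `ι` at a 1-cell. -/
abbrev ι (B : UBicat.{w, v, u}) {a b : B.Obj} (f : B.Hom a b) : f ≅ B.cmp (CSeq.single f) :=
  (B.coh.ι a b).app f

/-- For a family `φ` of 2-cells `(Ffₙ ∘ ⋯ ∘ Ff₁) ⟶ F(fₙ ∘ ⋯ ∘ f₁)`, the sequence of 2-cells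
`φ s₁, …, φ sₙ` attached to a double sequence `s₁, …, sₙ`. -/
abbrev φCell {B : UBicat.{w, v, u}} {C : UBicat.{w', v', u'}} {F₀ : B.Obj → C.Obj}
    {F₁ : ∀ a b : B.Obj, B.Hom a b ⥤ C.Hom (F₀ a) (F₀ b)}
    (φ : ∀ a b : B.Obj, CSeq.mapFunctor F₀ F₁ a b ⋙ C.comp (F₀ a) (F₀ b) ⟶ B.comp a b ⋙ F₁ a b)
    {a b : B.Obj} (D : CSeq (CSeq B.Hom) a b) :
    (CSeq.mapFunctor (fun x => x) C.comp (F₀ a) (F₀ b)).obj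
        ((CSeq.mapFunctor F₀ (CSeq.mapFunctor F₀ F₁) a b).obj D) ⟶
      (CSeq.mapFunctor F₀ F₁ a b).obj ((CSeq.mapFunctor (fun x => x) B.comp a b).obj D) :=
  CSeq.mapCell (F := CSeq.mapFunctor F₀ F₁) (G := C.comp) (H := B.comp) (K := F₁)
    (fun a b s => (φ a b).app s) D

end UBicat

/-- An unbiased lax functor. -/
structure ULaxFunctor (B : UBicat.{w, v, u}) (C : UBicat.{w', v', u'}) where
  /-- The function on objects. -/
  obj : B.Obj → C.Obj
  /-- The functors on hom-categories. -/
  fun₁ (a b : B.Obj) : B.Hom a b ⥤ C.Hom (obj a) (obj b)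
  /-- The coherence 2-cells `(Ffₙ ∘ ⋯ ∘ Ff₁) ⟶ F(fₙ ∘ ⋯ ∘ f₁)`, natural in the sequence. -/
  φ (a b : B.Obj) : CSeq.mapFunctor obj fun₁ a b ⋙ C.comp (obj a) (obj b) ⟶
    B.comp a b ⋙ fun₁ a b
  /-- Compatibility with `γ`. -/
  map_γ {a b : B.Obj} (D : CSeq (CSeq B.Hom) a b) :
    C.cmp₂ (UBicat.φCell φ D) ≫
        (φ a b).app ((CSeq.mapFunctor (fun x => x) B.comp a b).obj D) ≫
          (fun₁ a b).map (B.γ D).hom =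
      (C.γ ((CSeq.mapFunctor obj (CSeq.mapFunctor obj fun₁) a b).obj D)).hom ≫
        C.cmp₂ (eqToHom (CSeq.flatten_map_map obj _ D)) ≫ (φ a b).app (CSeq.flatten D)
  /-- Compatibility with `ι`. -/
  map_ι {a b : B.Obj} (f : B.Hom a b) :
    (C.ι ((fun₁ a b).obj f)).hom ≫ (φ a b).app (CSeq.single f) = (fun₁ a b).map (B.ι f).hom

namespace CSeq

section

variable {O : Type u} {X : O → O → Type v} [∀ a b, Category.{w} (X a b)]

theorem eqToHom_cons {a b c : O} (f : X a b) {s t : CSeq X b c} (h : s = t)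
    (h' : cons f s = cons f t) : eqToHom h' = consHom (𝟙 f) (eqToHom h) := by
  subst h
  rfl

theorem eqToHom_cons_cons {a b c : O} {f g : X a b} {s t : CSeq X b c} (e : f = g) (h : s = t)
    (h' : cons f s = cons g t) : eqToHom h' = consHom (eqToHom e) (eqToHom h) := by
  subst e h
  rfl

theorem consHom_congr {a b c : O} {f g : X a b} {s t : CSeq X b c} {α α' : f ⟶ g} {σ σ' : s ⟶ t}
    (h : α = α') (h' : σ = σ') : consHom α σ = consHom α' σ' := by
  rw [h, h']

theorem mapFunctor_id_obj {a b : O} (s : CSeq X a b) :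
    (mapFunctor (fun x => x) (fun a b => 𝟭 (X a b)) a b).obj s = s :=
  map_id s

theorem mapFunctor_id_map {a b : O} {s t : CSeq X a b} (σ : s ⟶ t) :
    (mapFunctor (fun x => x) (fun a b => 𝟭 (X a b)) a b).map σ ≫ eqToHom (mapFunctor_id_obj t) =
      eqToHom (mapFunctor_id_obj s) ≫ σ := by
  change Hom₂ s t at σ
  induction σ with
  | nil a => rfl
  | @cons a b c f g s t α σ ih =>
    rw [eqToHom_cons_cons rfl (mapFunctor_id_obj t) (mapFunctor_id_obj (cons g t)),
      eqToHom_cons_cons rfl (mapFunctor_id_obj s) (mapFunctor_id_obj (cons f s))]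
    refine (consHom_comp _ _ _ _).trans (Eq.trans ?_ (consHom_comp _ _ _ _).symm)
    exact consHom_congr (by simp) ih

variable {O' : Type u'} {Y : O' → O' → Type v'} [∀ a b, Category.{w'} (Y a b)]
  {O'' : Type u''} {Z : O'' → O'' → Type v''} [∀ a b, Category.{w''} (Z a b)]

theorem mapFunctor_comp_obj (F₀ : O → O') (F : ∀ a b : O, X a b ⥤ Y (F₀ a) (F₀ b))
    (G₀ : O' → O'') (G : ∀ a b : O', Y a b ⥤ Z (G₀ a) (G₀ b)) {a b : O} (s : CSeq X a b) :
    (mapFunctor (fun x => G₀ (F₀ x)) (fun a b => F a b ⋙ G (F₀ a) (F₀ b)) a b).obj s =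
      (mapFunctor G₀ G (F₀ a) (F₀ b)).obj ((mapFunctor F₀ F a b).obj s) :=
  map_map F₀ (fun a b => (F a b).obj) G₀ (fun a b => (G a b).obj) s

theorem mapFunctor_comp_map (F₀ : O → O') (F : ∀ a b : O, X a b ⥤ Y (F₀ a) (F₀ b))
    (G₀ : O' → O'') (G : ∀ a b : O', Y a b ⥤ Z (G₀ a) (G₀ b)) {a b : O} {s t : CSeq X a b}
    (σ : s ⟶ t) :
    (mapFunctor (fun x => G₀ (F₀ x)) (fun a b => F a b ⋙ G (F₀ a) (F₀ b)) a b).map σ ≫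
        eqToHom (mapFunctor_comp_obj F₀ F G₀ G t) =
      eqToHom (mapFunctor_comp_obj F₀ F G₀ G s) ≫
        (mapFunctor G₀ G (F₀ a) (F₀ b)).map ((mapFunctor F₀ F a b).map σ) := by
  change Hom₂ s t at σ
  induction σ with
  | nil a => rfl
  | @cons a b c f g s t α σ ih =>
    rw [eqToHom_cons_cons rfl (mapFunctor_comp_obj F₀ F G₀ G t)
        (mapFunctor_comp_obj F₀ F G₀ G (cons g t)),
      eqToHom_cons_cons rfl (mapFunctor_comp_obj F₀ F G₀ G s)
        (mapFunctor_comp_obj F₀ F G₀ G (cons f s))]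
    refine (consHom_comp _ _ _ _).trans (Eq.trans ?_ (consHom_comp _ _ _ _).symm)
    exact consHom_congr (by simp) ih

theorem mapFunctor_mapFunctor_id_obj {a b : O} (D : CSeq (CSeq X) a b) :
    (mapFunctor (fun x => x) (mapFunctor (fun x => x) (fun a b => 𝟭 (X a b))) a b).obj D = D := by
  induction D with
  | nil a => rfl
  | cons s D ih => exact congrArg₂ cons (mapFunctor_id_obj s) ih

theorem mapFunctor_mapFunctor_comp_obj (F₀ : O → O') (F : ∀ a b : O, X a b ⥤ Y (F₀ a) (F₀ b))
    (G₀ : O' → O'') (G : ∀ a b : O', Y a b ⥤ Z (G₀ a) (G₀ b)) {a b : O}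
    (D : CSeq (CSeq X) a b) :
    (mapFunctor (fun x => G₀ (F₀ x)) (mapFunctor (fun x => G₀ (F₀ x))
      (fun a b => F a b ⋙ G (F₀ a) (F₀ b))) a b).obj D =
      (mapFunctor G₀ (mapFunctor G₀ G) (F₀ a) (F₀ b)).obj
        ((mapFunctor F₀ (mapFunctor F₀ F) a b).obj D) := by
  induction D with
  | nil a => rfl
  | cons s D ih => exact congrArg₂ cons (mapFunctor_comp_obj F₀ F G₀ G s) ih

theorem mapCell_eq_eqToHom {P : O → O → Type v'''} [∀ a b, Category.{w'''} (P a b)] {F₀ : O → O'}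
    {F : ∀ a b : O, X a b ⥤ Y (F₀ a) (F₀ b)}
    {G₀ : O' → O''} {G : ∀ a b : O', Y a b ⥤ Z (G₀ a) (G₀ b)} {H : ∀ a b : O, X a b ⥤ P a b}
    {K : ∀ a b : O, P a b ⥤ Z (G₀ (F₀ a)) (G₀ (F₀ b))}
    {α : ∀ (a b : O) (f : X a b), (G _ _).obj ((F a b).obj f) ⟶ (K a b).obj ((H a b).obj f)}
    (h : ∀ (a b : O) (f : X a b), (G _ _).obj ((F a b).obj f) = (K a b).obj ((H a b).obj f))
    (hα : ∀ (a b : O) (f : X a b), α a b f = eqToHom (h a b f)) {a b : O} (s : CSeq X a b)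
    (hs : (mapFunctor G₀ G (F₀ a) (F₀ b)).obj ((mapFunctor F₀ F a b).obj s) =
      (mapFunctor (fun x => G₀ (F₀ x)) K a b).obj ((mapFunctor (fun x => x) H a b).obj s)) :
    mapCell α s = eqToHom hs := by
  have hs' : ∀ (a b : O) (s : CSeq X a b),
    (mapFunctor G₀ G (F₀ a) (F₀ b)).obj ((mapFunctor F₀ F a b).obj s) =
      (mapFunctor (fun x => G₀ (F₀ x)) K a b).obj ((mapFunctor (fun x => x) H a b).obj s) := by
    intro a b s
    induction s with
    | nil a => rfl
    | cons f s ih => exact congrArg₂ cons (h _ _ f) ih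
  induction s with
  | nil a => rfl
  | cons f s ih =>
    exact (consHom_congr (hα _ _ f) (ih (hs' _ _ s))).trans
      (eqToHom_cons_cons (h _ _ f) (hs' _ _ s) _).symm

end

end CSeq

namespace UBicat

theorem γ_eq (B : UBicat.{w, v, u}) {a b : B.Obj} {D E : CSeq (CSeq B.Hom) a b} (h : D = E)
    (h₁ : (CSeq.mapFunctor (fun x => x) B.comp a b).obj D =
      (CSeq.mapFunctor (fun x => x) B.comp a b).obj E) (h₂ : CSeq.flatten D = CSeq.flatten E) :
    (B.γ D).hom ≫ B.cmp₂ (eqToHom h₂) = B.cmp₂ (eqToHom h₁) ≫ (B.γ E).hom := by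
  subst h
  exact ((congrArg (fun x => (B.γ D).hom ≫ x) ((B.comp a b).map_id _)).trans
    (Category.comp_id _)).trans ((congrArg (fun x => x ≫ (B.γ D).hom)
      ((B.comp a b).map_id _)).trans (Category.id_comp _)).symm

end UBicat

namespace ULaxFunctor

theorem φ_eq {B : UBicat.{w, v, u}} {C : UBicat.{w', v', u'}} (F : ULaxFunctor B C)
    {a b : B.Obj} {s t : CSeq B.Hom a b} (h : s = t)
    (h₁ : (CSeq.mapFunctor F.obj F.fun₁ a b).obj s = (CSeq.mapFunctor F.obj F.fun₁ a b).obj t) :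
    (F.φ a b).app s ≫ (F.fun₁ a b).map (B.cmp₂ (eqToHom h)) =
      C.cmp₂ (eqToHom h₁) ≫ (F.φ a b).app t := by
  subst h
  simp

/-- The coherence 2-cells of the identity: `(fₙ ∘ ⋯ ∘ f₁) = (fₙ ∘ ⋯ ∘ f₁)`. -/
def idφ (B : UBicat.{w, v, u}) (a b : B.Obj) :
    CSeq.mapFunctor (fun x => x) (fun a b => 𝟭 (B.Hom a b)) a b ⋙ B.comp a b ⟶
      B.comp a b ⋙ 𝟭 (B.Hom a b) where
  app s := B.cmp₂ (eqToHom (CSeq.mapFunctor_id_obj s))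
  naturality s t σ := by
    have := congrArg (fun x => B.cmp₂ x) (CSeq.mapFunctor_id_map σ)
    simpa using this

/-- The identity unbiased lax functor. -/
protected abbrev id (B : UBicat.{w, v, u}) : ULaxFunctor B B where
  obj x := x
  fun₁ a b := 𝟭 (B.Hom a b)
  φ a b := idφ B a b
  map_γ {a b} D := by
    have h := CSeq.mapFunctor_mapFunctor_id_obj D
    have h₁ : (CSeq.mapFunctor (fun x => x) B.comp a b).obj ((CSeq.mapFunctor (fun x => x)
        (CSeq.mapFunctor (fun x => x) (fun a b => 𝟭 (B.Hom a b))) a b).obj D) =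
          (CSeq.mapFunctor (fun x => x) B.comp a b).obj D :=
      congrArg (CSeq.mapFunctor (fun x => x) B.comp a b).obj h
    have h₀ : UBicat.φCell (idφ B) D = eqToHom (h₁.trans (CSeq.mapFunctor_id_obj _).symm) :=
      CSeq.mapCell_eq_eqToHom (F := CSeq.mapFunctor (fun x => x) (fun a b => 𝟭 (B.Hom a b)))
        (G := B.comp) (H := B.comp) (K := fun a b => 𝟭 (B.Hom a b))
        (α := fun a b s => (idφ B a b).app s)
        (fun a b s => congrArg (B.comp a b).obj (CSeq.mapFunctor_id_obj s))
        (fun a b s => eqToHom_map _ _) D _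
    rw [h₀]
    have h₂ := B.γ_eq h h₁ (congrArg CSeq.flatten h)
    dsimp only [idφ]
    rw [← Functor.map_comp_assoc, ← Functor.map_comp, eqToHom_trans, eqToHom_trans]
    exact h₂.symm
  map_ι f := by
    exact (congrArg (fun x => (B.ι f).hom ≫ x) ((B.comp _ _).map_id _)).trans (Category.comp_id _)

section

variable {B : UBicat.{w, v, u}} {C : UBicat.{w', v', u'}} {D : UBicat.{w'', v'', u''}}

/-- The coherence 2-cells of a composite:
`(GFfₙ ∘ ⋯ ∘ GFf₁) ⟶ G(Ffₙ ∘ ⋯ ∘ Ff₁) ⟶ GF(fₙ ∘ ⋯ ∘ f₁)`. -/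
def compφ (F : ULaxFunctor B C) (G : ULaxFunctor C D) (a b : B.Obj) :
    CSeq.mapFunctor (fun x => G.obj (F.obj x))
        (fun a b => F.fun₁ a b ⋙ G.fun₁ (F.obj a) (F.obj b)) a b ⋙
          D.comp (G.obj (F.obj a)) (G.obj (F.obj b)) ⟶
      B.comp a b ⋙ F.fun₁ a b ⋙ G.fun₁ (F.obj a) (F.obj b) where
  app s := D.cmp₂ (eqToHom (CSeq.mapFunctor_comp_obj F.obj F.fun₁ G.obj G.fun₁ s)) ≫
    (G.φ _ _).app ((CSeq.mapFunctor F.obj F.fun₁ a b).obj s) ≫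
      (G.fun₁ _ _).map ((F.φ a b).app s)
  naturality s t σ := by
    have h := congrArg (fun x => D.cmp₂ x)
      (CSeq.mapFunctor_comp_map F.obj F.fun₁ G.obj G.fun₁ σ)
    have h₁ := (G.φ _ _).naturality ((CSeq.mapFunctor F.obj F.fun₁ a b).map σ)
    have h₂ := congrArg (fun x => (G.fun₁ _ _).map x) ((F.φ a b).naturality σ)
    simp only [Functor.map_comp, Functor.comp_map, Functor.comp_obj] at h h₁ h₂ ⊢
    rw [reassoc_of% h, reassoc_of% h₁, h₂]
    simp only [Category.assoc]

theorem compφ_app (F : ULaxFunctor B C) (G : ULaxFunctor C D) {a b : B.Obj} (s : CSeq B.Hom a b) :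
    (compφ F G a b).app s =
      D.cmp₂ (eqToHom (CSeq.mapFunctor_comp_obj F.obj F.fun₁ G.obj G.fun₁ s)) ≫
        (G.φ _ _).app ((CSeq.mapFunctor F.obj F.fun₁ a b).obj s) ≫
          (G.fun₁ _ _).map ((F.φ a b).app s) :=
  rfl

theorem mapCell_compφ (F : ULaxFunctor B C) (G : ULaxFunctor C D) {a b : B.Obj}
    (E : CSeq (CSeq B.Hom) a b)
    (h : (CSeq.mapFunctor (fun x => x) D.comp _ _).obj
      ((CSeq.mapFunctor (fun x => G.obj (F.obj x)) (CSeq.mapFunctor (fun x => G.obj (F.obj x))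
        (fun a b => F.fun₁ a b ⋙ G.fun₁ (F.obj a) (F.obj b))) a b).obj E) =
      (CSeq.mapFunctor (fun x => x) D.comp _ _).obj
        ((CSeq.mapFunctor G.obj (CSeq.mapFunctor G.obj G.fun₁) _ _).obj
        ((CSeq.mapFunctor F.obj (CSeq.mapFunctor F.obj F.fun₁) a b).obj E))) :
    UBicat.φCell (compφ F G) E ≫
        eqToHom (CSeq.mapFunctor_comp_obj F.obj F.fun₁ G.obj G.fun₁ _) =
      eqToHom h ≫ UBicat.φCell G.φ
        ((CSeq.mapFunctor F.obj (CSeq.mapFunctor F.obj F.fun₁) a b).obj E) ≫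
          (CSeq.mapFunctor G.obj G.fun₁ _ _).map
            (UBicat.φCell F.φ E) := by
  induction E with
  | nil a => rfl
  | @cons a b c s E ih =>
    have h' := congrArg (CSeq.mapFunctor (fun x => x) D.comp _ _).obj
      (CSeq.mapFunctor_mapFunctor_comp_obj F.obj F.fun₁ G.obj G.fun₁ E)
    have e := CSeq.mapFunctor_comp_obj F.obj F.fun₁ G.obj G.fun₁
      ((CSeq.mapFunctor (fun x => x) B.comp b c).obj E)
    have e₀ := CSeq.mapFunctor_comp_obj F.obj F.fun₁ G.obj G.fun₁ s
    rw [CSeq.eqToHom_cons_cons rfl e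
        (CSeq.mapFunctor_comp_obj F.obj F.fun₁ G.obj G.fun₁
          ((CSeq.mapFunctor (fun x => x) B.comp a c).obj (CSeq.cons s E))),
      CSeq.eqToHom_cons_cons (congrArg (D.comp _ _).obj e₀) h' h]
    refine (CSeq.consHom_comp _ _ _ _).trans (Eq.trans ?_ (CSeq.consHom_comp _ _ _ _).symm)
    refine CSeq.consHom_congr ?_ (ih h')
    refine (Category.comp_id _).trans ?_
    exact congrArg (fun x => x ≫ _) (eqToHom_map _ _)

/-- Composition of unbiased lax functors. -/
protected abbrev comp (F : ULaxFunctor B C) (G : ULaxFunctor C D) : ULaxFunctor B D where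
  obj x := G.obj (F.obj x)
  fun₁ a b := F.fun₁ a b ⋙ G.fun₁ (F.obj a) (F.obj b)
  φ a b := compφ F G a b
  map_γ {a b} E := by
    let E' := (CSeq.mapFunctor F.obj (CSeq.mapFunctor F.obj F.fun₁) a b).obj E
    have h : (CSeq.mapFunctor (fun x => G.obj (F.obj x)) (CSeq.mapFunctor (fun x => G.obj (F.obj x))
        (fun a b => F.fun₁ a b ⋙ G.fun₁ _ _)) a b).obj E =
        (CSeq.mapFunctor G.obj (CSeq.mapFunctor G.obj G.fun₁) _ _).obj E' :=
      CSeq.mapFunctor_mapFunctor_comp_obj F.obj F.fun₁ G.obj G.fun₁ E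
    have h₁ := congrArg (CSeq.mapFunctor (fun x => x) D.comp _ _).obj h
    have h₂ := congrArg CSeq.flatten h
    have h₃ := CSeq.flatten_map_map F.obj (fun a b => (F.fun₁ a b).obj) E
    have e₀ := congrArg (fun x => D.cmp₂ x) (mapCell_compφ F G E h₁)
    have e₁ := congrArg (fun x => (G.fun₁ _ _).map x) (F.map_γ E)
    have e₂ := G.map_γ E'
    have e₃ := (G.φ _ _).naturality (UBicat.φCell F.φ E)
    have e₄ := D.γ_eq h h₁ h₂
    have e₅ := G.φ_eq h₃ (congrArg (CSeq.mapFunctor G.obj G.fun₁ _ _).obj h₃)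
    simp only [Functor.map_comp] at e₀ e₁
    rw [compφ_app, compφ_app]
    simp only [Functor.comp_map, Functor.comp_obj, Category.assoc] at e₀ e₁ e₂ e₃ e₄ e₅ ⊢
    rw [reassoc_of% e₀, reassoc_of% e₃, e₁, reassoc_of% e₂,
      reassoc_of% e₅, ← reassoc_of% e₄]
    simp only [← Functor.map_comp_assoc, eqToHom_trans]
  map_ι f := by
    have h₁ := G.map_ι ((F.fun₁ _ _).obj f)
    have h₂ := congrArg (fun x => (G.fun₁ _ _).map x) (F.map_ι f)
    simp only [Functor.map_comp] at h₂
    refine Eq.trans ?_ h₂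
    refine Eq.trans ?_ (congrArg (fun x => x ≫ (G.fun₁ _ _).map ((F.φ _ _).app (CSeq.single f))) h₁)
    refine Eq.trans ?_ (Category.assoc _ _ _).symm
    refine congrArg (fun x => _ ≫ x) ?_
    exact (congrArg (fun x => x ≫ _) ((D.comp _ _).map_id _)).trans (Category.id_comp _)

end

/-- Unbiased lax functors which agree on 0-, 1- and 2-cells and have the same coherence 2-cells
are equal. -/
theorem mk_congr {B : UBicat.{w, v, u}} {C : UBicat.{w', v', u'}} {F₀ : B.Obj → C.Obj}
    {F₁ : ∀ a b, B.Hom a b ⥤ C.Hom (F₀ a) (F₀ b)}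
    {φ ψ : ∀ a b, CSeq.mapFunctor F₀ F₁ a b ⋙ C.comp (F₀ a) (F₀ b) ⟶ B.comp a b ⋙ F₁ a b}
    (h : ∀ a b s, (φ a b).app s = (ψ a b).app s) {p₁ p₂ q₁ q₂} :
    (ULaxFunctor.mk F₀ F₁ φ p₁ p₂ : ULaxFunctor B C) = ULaxFunctor.mk F₀ F₁ ψ q₁ q₂ := by
  have : φ = ψ := by
    funext a b
    exact NatTrans.ext (funext (h a b))
  subst this
  rfl

end ULaxFunctor

/-- The category of unbiased bicategories and unbiased lax functors. -/
instance UBicat.category : Category UBicat.{w, v, u} where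
  Hom B C := ULaxFunctor B C
  id B := ULaxFunctor.id B
  comp F G := F.comp G
  id_comp {B C} F := ULaxFunctor.mk_congr (fun a b s => by
    have := F.φ_eq (CSeq.mapFunctor_id_obj s)
      (congrArg (CSeq.mapFunctor F.obj F.fun₁ a b).obj (CSeq.mapFunctor_id_obj s))
    refine (congrArg (fun x => _ ≫ x) this).trans ?_
    refine (((C.comp _ _).map_comp_assoc _ _ _).symm).trans ?_
    rw [eqToHom_trans]
    exact (congrArg (fun x => x ≫ _) ((C.comp _ _).map_id _)).trans (Category.id_comp _))
  comp_id {B C} F := ULaxFunctor.mk_congr (fun a b s => by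
    refine (((C.comp _ _).map_comp_assoc _ _ _).symm).trans ?_
    rw [eqToHom_trans]
    exact (congrArg (fun x => x ≫ _) ((C.comp _ _).map_id _)).trans (Category.id_comp _))
  assoc {A B C D} F G H := ULaxFunctor.mk_congr (fun a b s => by
    have h₁ := CSeq.mapFunctor_comp_obj F.obj F.fun₁ G.obj G.fun₁ s
    have := H.φ_eq h₁ (congrArg (CSeq.mapFunctor H.obj H.fun₁ _ _).obj h₁)
    dsimp only [ULaxFunctor.comp, ULaxFunctor.compφ]
    simp only [Functor.map_comp, Functor.comp_map, Category.assoc]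
    rw [reassoc_of% this, ← Functor.map_comp_assoc, ← Functor.map_comp_assoc, eqToHom_trans, eqToHom_trans])

namespace CSeq

variable {O : Type u} {X : O → O → Type v} [∀ a b, Category.{w} (X a b)]

/-- A pair of invertible 2-cells. -/
@[reducible] def pairIso {a b c : O} {f f' : X a b} {g g' : X b c} (α : f ≅ f') (β : g ≅ g') :
    pair f g ≅ pair f' g' where
  hom := pairHom α.hom β.hom
  inv := pairHom α.inv β.inv
  hom_inv_id := by
    rw [consHom_comp, consHom_comp, α.hom_inv_id, β.hom_inv_id]
    rfl
  inv_hom_id := by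
    rw [consHom_comp, consHom_comp, α.inv_hom_id, β.inv_hom_id]
    rfl

end CSeq

namespace UBicat

open CSeq

section

variable (B : UBicat.{w, v, u})

/-- `((f, g), h) ≅ (f, g, h)`: `ι` on `h` followed by `γ`. -/
def flatL {a b c d : B.Obj} (f : B.Hom a b) (g : B.Hom b c) (h : B.Hom c d) :
    B.cmp (pair (B.cmp (pair f g)) h) ≅ B.cmp (cons f (pair g h)) :=
  (B.comp a d).mapIso (pairIso (Iso.refl _) (B.ι h)) ≪≫ B.γ (pair (pair f g) (single h))

/-- `(f, (g, h)) ≅ (f, g, h)`: `ι` on `f` followed by `γ`. -/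
def flatR {a b c d : B.Obj} (f : B.Hom a b) (g : B.Hom b c) (h : B.Hom c d) :
    B.cmp (pair f (B.cmp (pair g h))) ≅ B.cmp (cons f (pair g h)) :=
  (B.comp a d).mapIso (pairIso (B.ι f) (Iso.refl _)) ≪≫ B.γ (pair (single f) (pair g h))

/-- `((), f) ≅ (f)`: `ι` on `f` followed by `γ`. -/
def flatUnitL {a b : B.Obj} (f : B.Hom a b) :
    B.cmp (pair (B.cmp (nil a)) f) ≅ B.cmp (single f) :=
  (B.comp a b).mapIso (pairIso (Iso.refl _) (B.ι f)) ≪≫ B.γ (pair (nil a) (single f))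

/-- `(f, ()) ≅ (f)`: `ι` on `f` followed by `γ`. -/
def flatUnitR {a b : B.Obj} (f : B.Hom a b) :
    B.cmp (pair f (B.cmp (nil b))) ≅ B.cmp (single f) :=
  (B.comp a b).mapIso (pairIso (B.ι f) (Iso.refl _)) ≪≫ B.γ (pair (single f) (nil b))

theorem assoc_nat {a b : B.Obj} (T : CSeq (CSeq (CSeq B.Hom)) a b) {x : CSeq (CSeq B.Hom) a b}
    (r : x ⟶ (mapFunctor (fun x => x) (mapFunctor (fun x => x) B.comp) a b).obj T) :
    B.cmp₂ ((mapFunctor (fun x => x) B.comp a b).map r ≫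
        mapCell (F := mapFunctor (fun x => x) B.comp) (G := B.comp) (H := flattenFunctor B.Hom)
          (K := B.comp) (fun _ _ D => (B.γ D).hom) T) ≫
        (B.γ ((mapFunctor (fun x => x) (flattenFunctor B.Hom) a b).obj T)).hom ≫
          B.cmp₂ (eqToHom (flatten_map_flatten T)) =
      (B.γ x).hom ≫ B.cmp₂ ((flattenFunctor B.Hom a b).map r) ≫
        B.cmp₂ (eqToHom (flatten_map_map (fun x => x) _ T)) ≫ (B.γ (flatten T)).hom := by
  have h := B.coh.assoc T
  have n := (B.coh.γ a b).hom.naturality r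
  refine (congrArg (fun y => y ≫ _) ((B.comp a b).map_comp _ _)).trans ?_
  refine (Category.assoc _ _ _).trans ?_
  refine (congrArg (fun y => B.cmp₂ _ ≫ y) h).trans ?_
  refine (Category.assoc _ _ _).symm.trans ?_
  refine (congrArg (fun y => y ≫ _) n).trans ?_
  exact Category.assoc _ _ _

theorem ι_single {a b : B.Obj} (f : B.Hom a b) :
    B.cmp₂ (singleHom (B.ι f).hom) ≫ (B.γ (single (single f))).hom = 𝟙 _ := by
  have := B.coh.map_ι_γ (single f)
  refine Eq.trans ?_ this
  refine congrArg (fun y => B.cmp₂ _ ≫ y) ?_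
  exact ((congrArg (fun y => (B.γ (single (single f))).hom ≫ y) ((B.comp a b).map_id _)).trans
    (Category.comp_id _)).symm

theorem ι_pair {a b c : B.Obj} (f : B.Hom a b) (g : B.Hom b c) :
    B.cmp₂ (pairHom (B.ι f).hom (B.ι g).hom) ≫ (B.γ (pair (single f) (single g))).hom = 𝟙 _ := by
  have := B.coh.map_ι_γ (pair f g)
  refine Eq.trans ?_ this
  refine congrArg (fun y => B.cmp₂ _ ≫ y) ?_
  exact ((congrArg (fun y => (B.γ (pair (single f) (single g))).hom ≫ y)
    ((B.comp a c).map_id _)).trans (Category.comp_id _)).symm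

theorem comp_cmp₂_id {a b : B.Obj} {x : B.Hom a b} {s : CSeq B.Hom a b} (k : x ⟶ B.cmp s) :
    k ≫ B.cmp₂ (𝟙 s) = k :=
  (congrArg (fun y => k ≫ y) ((B.comp a b).map_id s)).trans (Category.comp_id k)

theorem assoc_nat' {a b : B.Obj} (T : CSeq (CSeq (CSeq B.Hom)) a b) {x : CSeq (CSeq B.Hom) a b}
    (r : x ⟶ (mapFunctor (fun x => x) (mapFunctor (fun x => x) B.comp) a b).obj T)
    {M : (mapFunctor (fun x => x) B.comp a b).obj x ⟶ (mapFunctor (fun x => x) B.comp a b).obj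
      ((mapFunctor (fun x => x) (flattenFunctor B.Hom) a b).obj T)}
    (hM : (mapFunctor (fun x => x) B.comp a b).map r ≫
        mapCell (F := mapFunctor (fun x => x) B.comp) (G := B.comp) (H := flattenFunctor B.Hom)
          (K := B.comp) (fun _ _ D => (B.γ D).hom) T = M)
    {N : B.cmp ((mapFunctor (fun x => x) B.comp a b).obj
      ((mapFunctor (fun x => x) (flattenFunctor B.Hom) a b).obj T)) ⟶ B.cmp (flatten (flatten T))}
    (hN : (B.γ ((mapFunctor (fun x => x) (flattenFunctor B.Hom) a b).obj T)).hom ≫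
          B.cmp₂ (eqToHom (flatten_map_flatten T)) = N)
    {K : B.cmp (flatten x) ⟶ B.cmp ((mapFunctor (fun x => x) B.comp a b).obj (flatten T))}
    (hK : B.cmp₂ ((flattenFunctor B.Hom a b).map r) ≫
      B.cmp₂ (eqToHom (flatten_map_map (fun x => x) _ T)) = K) :
    B.cmp₂ M ≫ N = (B.γ x).hom ≫ K ≫ (B.γ (flatten T)).hom := by
  subst hM hN hK
  rw [Category.assoc]
  exact B.assoc_nat T r

/-- `((f, g, h), i) ⟶ (f, g, h, i)`. -/
def q₁ {a b c d e : B.Obj} (f : B.Hom a b) (g : B.Hom b c) (h : B.Hom c d) (i : B.Hom d e) :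
    B.cmp (pair (B.cmp (cons f (pair g h))) i) ⟶ B.cmp (cons f (cons g (pair h i))) :=
  B.cmp₂ (pairHom (𝟙 _) (B.ι i).hom) ≫ (B.γ (pair (cons f (pair g h)) (single i))).hom

/-- `(f, (g, h, i)) ⟶ (f, g, h, i)`. -/
def q₂ {a b c d e : B.Obj} (f : B.Hom a b) (g : B.Hom b c) (h : B.Hom c d) (i : B.Hom d e) :
    B.cmp (pair f (B.cmp (cons g (pair h i)))) ≅ B.cmp (cons f (cons g (pair h i))) :=
  (B.comp a e).mapIso (pairIso (B.ι f) (Iso.refl _)) ≪≫ B.γ (pair (single f) (cons g (pair h i)))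

/-- `((f, g), h, i) ⟶ (f, g, h, i)`. -/
def q₃ {a b c d e : B.Obj} (f : B.Hom a b) (g : B.Hom b c) (h : B.Hom c d) (i : B.Hom d e) :
    B.cmp (cons (B.cmp (pair f g)) (pair h i)) ⟶ B.cmp (cons f (cons g (pair h i))) :=
  B.cmp₂ (consHom (𝟙 _) (pairHom (B.ι h).hom (B.ι i).hom)) ≫
    (B.γ (cons (pair f g) (pair (single h) (single i)))).hom

/-- `(f, (g, h), i) ⟶ (f, g, h, i)`. -/
def q₄ {a b c d e : B.Obj} (f : B.Hom a b) (g : B.Hom b c) (h : B.Hom c d) (i : B.Hom d e) :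
    B.cmp (cons f (pair (B.cmp (pair g h)) i)) ⟶ B.cmp (cons f (cons g (pair h i))) :=
  B.cmp₂ (consHom (B.ι f).hom (pairHom (𝟙 _) (B.ι i).hom)) ≫
    (B.γ (cons (single f) (pair (pair g h) (single i)))).hom

/-- `(f, g, (h, i)) ⟶ (f, g, h, i)`. -/
def q₅ {a b c d e : B.Obj} (f : B.Hom a b) (g : B.Hom b c) (h : B.Hom c d) (i : B.Hom d e) :
    B.cmp (cons f (pair g (B.cmp (pair h i)))) ⟶ B.cmp (cons f (cons g (pair h i))) :=
  B.cmp₂ (consHom (B.ι f).hom (pairHom (B.ι g).hom (𝟙 _))) ≫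
    (B.γ (cons (single f) (pair (single g) (pair h i)))).hom

theorem sq₁ {a b c d e : B.Obj} (f : B.Hom a b) (g : B.Hom b c) (h : B.Hom c d) (i : B.Hom d e) :
    B.cmp₂ (pairHom (B.flatL f g h).hom (𝟙 i)) ≫ B.q₁ f g h i =
      (B.flatL (B.cmp (pair f g)) h i).hom ≫ B.q₃ f g h i := by
  have key := B.assoc_nat' (pair (pair (pair f g) (single h)) (single (single i)))
    (x := pair (pair (B.cmp (pair f g)) h) (single i))
    (pairHom (pairHom (𝟙 _) (B.ι h).hom) (singleHom (B.ι i).hom))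
    (M := pairHom (B.flatL f g h).hom (𝟙 _))
    (consHom_congr rfl (consHom_congr (B.ι_single i) rfl))
    (N := (B.γ (pair (cons f (pair g h)) (single i))).hom) (B.comp_cmp₂_id _)
    (K := B.cmp₂ (consHom (𝟙 _) (pairHom (B.ι h).hom (B.ι i).hom))) (B.comp_cmp₂_id _)
  simp only [flatL, q₁, q₃, Iso.trans_hom, Functor.mapIso_hom, Iso.refl_hom, Category.assoc] at key ⊢
  rw [← key]
  simp only [← Functor.map_comp_assoc, consHom_comp, Category.id_comp, Category.comp_id]

theorem sq₂ {a b c d e : B.Obj} (f : B.Hom a b) (g : B.Hom b c) (h : B.Hom c d) (i : B.Hom d e) :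
    B.cmp₂ (pairHom (B.flatR f g h).hom (𝟙 i)) ≫ B.q₁ f g h i =
      (B.flatL f (B.cmp (pair g h)) i).hom ≫ B.q₄ f g h i := by
  have key := B.assoc_nat' (pair (pair (single f) (pair g h)) (single (single i)))
    (x := pair (pair f (B.cmp (pair g h))) (single i))
    (pairHom (pairHom (B.ι f).hom (𝟙 _)) (singleHom (B.ι i).hom))
    (M := pairHom (B.flatR f g h).hom (𝟙 _))
    (consHom_congr rfl (consHom_congr (B.ι_single i) rfl))
    (N := (B.γ (pair (cons f (pair g h)) (single i))).hom) (B.comp_cmp₂_id _)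
    (K := B.cmp₂ (consHom (B.ι f).hom (pairHom (𝟙 _) (B.ι i).hom))) (B.comp_cmp₂_id _)
  simp only [flatL, flatR, q₁, q₄, Iso.trans_hom, Functor.mapIso_hom, Iso.refl_hom, Category.assoc] at key ⊢
  rw [← key]
  simp only [← Functor.map_comp_assoc, consHom_comp, Category.id_comp, Category.comp_id]

theorem sq₃ {a b c d e : B.Obj} (f : B.Hom a b) (g : B.Hom b c) (h : B.Hom c d) (i : B.Hom d e) :
    B.cmp₂ (pairHom (𝟙 f) (B.flatL g h i).hom) ≫ (B.q₂ f g h i).hom =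
      (B.flatR f (B.cmp (pair g h)) i).hom ≫ B.q₄ f g h i := by
  have key := B.assoc_nat' (pair (single (single f)) (pair (pair g h) (single i)))
    (x := pair (single f) (pair (B.cmp (pair g h)) i))
    (pairHom (singleHom (B.ι f).hom) (pairHom (𝟙 _) (B.ι i).hom))
    (M := pairHom (𝟙 _) (B.flatL g h i).hom)
    (consHom_congr (B.ι_single f) rfl)
    (N := (B.γ (pair (single f) (cons g (pair h i)))).hom) (B.comp_cmp₂_id _)
    (K := B.cmp₂ (consHom (B.ι f).hom (pairHom (𝟙 _) (B.ι i).hom))) (B.comp_cmp₂_id _)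
  simp only [flatL, flatR, q₂, q₄, Iso.trans_hom, Functor.mapIso_hom, Iso.refl_hom, Category.assoc] at key ⊢
  rw [← key]
  simp only [← Functor.map_comp_assoc, consHom_comp, Category.id_comp, Category.comp_id]

theorem sq₄ {a b c d e : B.Obj} (f : B.Hom a b) (g : B.Hom b c) (h : B.Hom c d) (i : B.Hom d e) :
    B.cmp₂ (pairHom (𝟙 f) (B.flatR g h i).hom) ≫ (B.q₂ f g h i).hom =
      (B.flatR f g (B.cmp (pair h i))).hom ≫ B.q₅ f g h i := by
  have key := B.assoc_nat' (pair (single (single f)) (pair (single g) (pair h i)))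
    (x := pair (single f) (pair g (B.cmp (pair h i))))
    (pairHom (singleHom (B.ι f).hom) (pairHom (B.ι g).hom (𝟙 _)))
    (M := pairHom (𝟙 _) (B.flatR g h i).hom)
    (consHom_congr (B.ι_single f) rfl)
    (N := (B.γ (pair (single f) (cons g (pair h i)))).hom) (B.comp_cmp₂_id _)
    (K := B.cmp₂ (consHom (B.ι f).hom (pairHom (B.ι g).hom (𝟙 _)))) (B.comp_cmp₂_id _)
  simp only [flatR, q₂, q₅, Iso.trans_hom, Functor.mapIso_hom, Iso.refl_hom, Category.assoc] at key ⊢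
  rw [← key]
  simp only [← Functor.map_comp_assoc, consHom_comp, Category.id_comp, Category.comp_id]

theorem ι_γ_pair {a b c : B.Obj} (f : B.Hom a b) (g : B.Hom b c) :
    (B.ι (B.cmp (pair f g))).hom ≫ (B.γ (single (pair f g))).hom = 𝟙 _ :=
  (congrArg (fun y => (B.ι (B.cmp (pair f g))).hom ≫ y)
    (B.comp_cmp₂_id (B.γ (single (pair f g))).hom)).symm.trans (B.coh.ι_γ (pair f g))

theorem sq₅_aux₁ {a b c d e : B.Obj} (f : B.Hom a b) (g : B.Hom b c) (h : B.Hom c d)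
    (i : B.Hom d e) :
    (B.γ (pair (pair f g) (pair h i))).hom =
      (B.flatR (B.cmp (pair f g)) h i).hom ≫ B.q₃ f g h i := by
  have key := B.assoc_nat' (pair (single (pair f g)) (pair (single h) (single i)))
    (x := pair (single (B.cmp (pair f g))) (pair h i))
    (pairHom (singleHom (𝟙 _)) (pairHom (B.ι h).hom (B.ι i).hom))
    (M := pairHom (B.γ (single (pair f g))).hom (𝟙 _))
    (consHom_congr ((congrArg (fun y => y ≫ (B.γ (single (pair f g))).hom)
      ((B.comp _ _).map_id _)).trans (Category.id_comp _)) (consHom_congr (B.ι_pair h i) rfl))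
    (N := (B.γ (pair (pair f g) (pair h i))).hom) (B.comp_cmp₂_id _)
    (K := B.cmp₂ (consHom (𝟙 _) (pairHom (B.ι h).hom (B.ι i).hom))) (B.comp_cmp₂_id _)
  simp only [flatR, q₃, Iso.trans_hom, Functor.mapIso_hom, Iso.refl_hom, Category.assoc]
  rw [← key]
  simp only [← Functor.map_comp_assoc, consHom_comp, Category.comp_id]
  rw [B.ι_γ_pair f g]
  exact ((congrArg (fun y => y ≫ _) ((B.comp _ _).map_id _)).trans (Category.id_comp _)).symm

theorem sq₅_aux₂ {a b c d e : B.Obj} (f : B.Hom a b) (g : B.Hom b c) (h : B.Hom c d)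
    (i : B.Hom d e) :
    (B.γ (pair (pair f g) (pair h i))).hom =
      (B.flatL f g (B.cmp (pair h i))).hom ≫ B.q₅ f g h i := by
  have key := B.assoc_nat' (pair (pair (single f) (single g)) (single (pair h i)))
    (x := pair (pair f g) (single (B.cmp (pair h i))))
    (pairHom (pairHom (B.ι f).hom (B.ι g).hom) (singleHom (𝟙 _)))
    (M := pairHom (𝟙 _) (B.γ (single (pair h i))).hom)
    (consHom_congr (B.ι_pair f g) (consHom_congr ((congrArg (fun y => y ≫
      (B.γ (single (pair h i))).hom) ((B.comp _ _).map_id _)).trans (Category.id_comp _)) rfl))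
    (N := (B.γ (pair (pair f g) (pair h i))).hom) (B.comp_cmp₂_id _)
    (K := B.cmp₂ (consHom (B.ι f).hom (pairHom (B.ι g).hom (𝟙 _)))) (B.comp_cmp₂_id _)
  simp only [flatL, q₅, Iso.trans_hom, Functor.mapIso_hom, Iso.refl_hom, Category.assoc]
  rw [← key]
  simp only [← Functor.map_comp_assoc, consHom_comp, Category.comp_id]
  rw [B.ι_γ_pair h i]
  exact ((congrArg (fun y => y ≫ _) ((B.comp _ _).map_id _)).trans (Category.id_comp _)).symm

/-- `(f, (), g) ⟶ (f, g)`. -/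
def q₀ {a b c : B.Obj} (f : B.Hom a b) (g : B.Hom b c) :
    B.cmp (cons f (pair (B.cmp (nil b)) g)) ⟶ B.cmp (pair f g) :=
  B.cmp₂ (consHom (B.ι f).hom (pairHom (𝟙 _) (B.ι g).hom)) ≫
    (B.γ (cons (single f) (pair (nil b) (single g)))).hom

theorem flatR_q₀ {a b c : B.Obj} (f : B.Hom a b) (g : B.Hom b c) :
    B.cmp₂ (pairHom (𝟙 f) ((B.flatUnitL g).hom ≫ (B.ι g).inv)) =
      (B.flatR f (B.cmp (nil b)) g).hom ≫ B.q₀ f g := by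
  have key := B.assoc_nat' (pair (single (single f)) (pair (nil b) (single g)))
    (x := pair (single f) (pair (B.cmp (nil b)) g))
    (pairHom (singleHom (B.ι f).hom) (pairHom (𝟙 _) (B.ι g).hom))
    (M := pairHom (𝟙 _) (B.flatUnitL g).hom)
    (consHom_congr (B.ι_single f) rfl)
    (N := (B.γ (pair (single f) (single g))).hom) (B.comp_cmp₂_id _)
    (K := B.cmp₂ (consHom (B.ι f).hom (pairHom (𝟙 _) (B.ι g).hom))) (B.comp_cmp₂_id _)
  have e : B.cmp₂ (pairHom (𝟙 f) ((B.flatUnitL g).hom ≫ (B.ι g).inv)) ≫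
      B.cmp₂ (pairHom (B.ι f).hom (B.ι g).hom) ≫ (B.γ (pair (single f) (single g))).hom =
        (B.flatR f (B.cmp (nil b)) g).hom ≫ B.q₀ f g := by
    simp only [flatR, q₀, Iso.trans_hom, Functor.mapIso_hom, Iso.refl_hom, Category.assoc] at key ⊢
    rw [← key]
    simp only [← Functor.map_comp_assoc, consHom_comp, Category.id_comp, Category.comp_id,
      Category.assoc, Iso.inv_hom_id]
  rwa [B.ι_pair f g, Category.comp_id] at e

theorem flatL_q₀ {a b c : B.Obj} (f : B.Hom a b) (g : B.Hom b c) :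
    B.cmp₂ (pairHom ((B.flatUnitR f).hom ≫ (B.ι f).inv) (𝟙 g)) =
      (B.flatL f (B.cmp (nil b)) g).hom ≫ B.q₀ f g := by
  have key := B.assoc_nat' (pair (pair (single f) (nil b)) (single (single g)))
    (x := pair (pair f (B.cmp (nil b))) (single g))
    (pairHom (pairHom (B.ι f).hom (𝟙 _)) (singleHom (B.ι g).hom))
    (M := pairHom (B.flatUnitR f).hom (𝟙 _))
    (consHom_congr rfl (consHom_congr (B.ι_single g) rfl))
    (N := (B.γ (pair (single f) (single g))).hom) (B.comp_cmp₂_id _)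
    (K := B.cmp₂ (consHom (B.ι f).hom (pairHom (𝟙 _) (B.ι g).hom))) (B.comp_cmp₂_id _)
  have e : B.cmp₂ (pairHom ((B.flatUnitR f).hom ≫ (B.ι f).inv) (𝟙 g)) ≫
      B.cmp₂ (pairHom (B.ι f).hom (B.ι g).hom) ≫ (B.γ (pair (single f) (single g))).hom =
        (B.flatL f (B.cmp (nil b)) g).hom ≫ B.q₀ f g := by
    simp only [flatL, q₀, Iso.trans_hom, Functor.mapIso_hom, Iso.refl_hom, Category.assoc] at key ⊢
    rw [← key]
    simp only [← Functor.map_comp_assoc, consHom_comp, Category.id_comp, Category.comp_id,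
      Category.assoc, Iso.inv_hom_id]
  rwa [B.ι_pair f g, Category.comp_id] at e

theorem ι_nat {a b : B.Obj} {f g : B.Hom a b} (α : f ⟶ g) :
    α ≫ (B.ι g).hom = (B.ι f).hom ≫ B.cmp₂ (singleHom α) :=
  (B.coh.ι a b).hom.naturality α

theorem flatL_nat {a b c d : B.Obj} {f f' : B.Hom a b} {g g' : B.Hom b c} {h h' : B.Hom c d}
    (α : f ⟶ f') (β : g ⟶ g') (δ : h ⟶ h') :
    B.cmp₂ (pairHom (B.cmp₂ (pairHom α β)) δ) ≫ (B.flatL f' g' h').hom =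
      (B.flatL f g h).hom ≫ B.cmp₂ (consHom α (pairHom β δ)) := by
  have n : B.cmp₂ (pairHom (B.cmp₂ (pairHom α β)) (B.cmp₂ (singleHom δ))) ≫
      (B.γ (pair (pair f' g') (single h'))).hom =
      (B.γ (pair (pair f g) (single h))).hom ≫ B.cmp₂ (consHom α (pairHom β δ)) :=
    (B.coh.γ a d).hom.naturality
      (pairHom (pairHom α β) (singleHom δ) : pair (pair f g) (single h) ⟶ _)
  simp only [flatL, Iso.trans_hom, Functor.mapIso_hom, Iso.refl_hom, Category.assoc]
  rw [← n]
  simp only [← Functor.map_comp_assoc, consHom_comp, Category.id_comp, Category.comp_id, ι_nat]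

theorem flatR_nat {a b c d : B.Obj} {f f' : B.Hom a b} {g g' : B.Hom b c} {h h' : B.Hom c d}
    (α : f ⟶ f') (β : g ⟶ g') (δ : h ⟶ h') :
    B.cmp₂ (pairHom α (B.cmp₂ (pairHom β δ))) ≫ (B.flatR f' g' h').hom =
      (B.flatR f g h).hom ≫ B.cmp₂ (consHom α (pairHom β δ)) := by
  have n : B.cmp₂ (pairHom (B.cmp₂ (singleHom α)) (B.cmp₂ (pairHom β δ))) ≫
      (B.γ (pair (single f') (pair g' h'))).hom =
      (B.γ (pair (single f) (pair g h))).hom ≫ B.cmp₂ (consHom α (pairHom β δ)) :=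
    (B.coh.γ a d).hom.naturality
      (pairHom (singleHom α) (pairHom β δ) : pair (single f) (pair g h) ⟶ _)
  simp only [flatR, Iso.trans_hom, Functor.mapIso_hom, Iso.refl_hom, Category.assoc]
  rw [← n]
  simp only [← Functor.map_comp_assoc, consHom_comp, Category.id_comp, Category.comp_id, ι_nat]

theorem flatUnitL_nat {a b : B.Obj} {f f' : B.Hom a b} (α : f ⟶ f') :
    B.cmp₂ (pairHom (𝟙 (B.cmp (nil a))) α) ≫ (B.flatUnitL f').hom =
      (B.flatUnitL f).hom ≫ B.cmp₂ (singleHom α) := by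
  have n : B.cmp₂ (pairHom (𝟙 (B.cmp (nil a))) (B.cmp₂ (singleHom α))) ≫
      (B.γ (pair (nil a) (single f'))).hom =
      (B.γ (pair (nil a) (single f))).hom ≫ B.cmp₂ (singleHom α) := by
    rw [← (B.comp a a).map_id (nil a)]
    exact (B.coh.γ a b).hom.naturality
      (pairHom (𝟙 (nil a)) (singleHom α) : pair (nil a) (single f) ⟶ _)
  simp only [flatUnitL, Iso.trans_hom, Functor.mapIso_hom, Iso.refl_hom, Category.assoc]
  rw [← n]
  simp only [← Functor.map_comp_assoc, consHom_comp, Category.comp_id, ι_nat]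

theorem flatUnitR_nat {a b : B.Obj} {f f' : B.Hom a b} (α : f ⟶ f') :
    B.cmp₂ (pairHom α (𝟙 (B.cmp (nil b)))) ≫ (B.flatUnitR f').hom =
      (B.flatUnitR f).hom ≫ B.cmp₂ (singleHom α) := by
  have n : B.cmp₂ (pairHom (B.cmp₂ (singleHom α)) (𝟙 (B.cmp (nil b)))) ≫
      (B.γ (pair (single f') (nil b))).hom =
      (B.γ (pair (single f) (nil b))).hom ≫ B.cmp₂ (singleHom α) := by
    rw [← (B.comp b b).map_id (nil b)]
    exact (B.coh.γ a b).hom.naturality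
      (pairHom (singleHom α) (𝟙 (nil b)) : pair (single f) (nil b) ⟶ _)
  simp only [flatUnitR, Iso.trans_hom, Functor.mapIso_hom, Iso.refl_hom, Category.assoc]
  rw [← n]
  simp only [← Functor.map_comp_assoc, consHom_comp, Category.comp_id, ι_nat]

/-- The associativity isomorphism `((f, g), h) ≅ (f, g, h) ≅ (f, (g, h))`. -/
def assocIso {a b c d : B.Obj} (f : B.Hom a b) (g : B.Hom b c) (h : B.Hom c d) :
    B.cmp (pair (B.cmp (pair f g)) h) ≅ B.cmp (pair f (B.cmp (pair g h))) :=
  B.flatL f g h ≪≫ (B.flatR f g h).symm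

/-- The unit isomorphism `((), f) ≅ (f) ≅ f`. -/
def unitLIso {a b : B.Obj} (f : B.Hom a b) : B.cmp (pair (B.cmp (nil a)) f) ≅ f :=
  B.flatUnitL f ≪≫ (B.ι f).symm

/-- The unit isomorphism `(f, ()) ≅ (f) ≅ f`. -/
def unitRIso {a b : B.Obj} (f : B.Hom a b) : B.cmp (pair f (B.cmp (nil b))) ≅ f :=
  B.flatUnitR f ≪≫ (B.ι f).symm

theorem assocIso_nat {a b c d : B.Obj} {f f' : B.Hom a b} {g g' : B.Hom b c} {h h' : B.Hom c d}
    (α : f ⟶ f') (β : g ⟶ g') (δ : h ⟶ h') :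
    B.cmp₂ (pairHom (B.cmp₂ (pairHom α β)) δ) ≫ (B.assocIso f' g' h').hom =
      (B.assocIso f g h).hom ≫ B.cmp₂ (pairHom α (B.cmp₂ (pairHom β δ))) := by
  simp only [assocIso, Iso.trans_hom, Iso.symm_hom, Category.assoc]
  rw [reassoc_of% (B.flatL_nat α β δ)]
  refine congrArg (fun y => (B.flatL f g h).hom ≫ y) ?_
  rw [Iso.eq_inv_comp, ← Category.assoc, Iso.comp_inv_eq, flatR_nat]

theorem unitLIso_nat {a b : B.Obj} {f f' : B.Hom a b} (α : f ⟶ f') :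
    B.cmp₂ (pairHom (𝟙 (B.cmp (nil a))) α) ≫ (B.unitLIso f').hom = (B.unitLIso f).hom ≫ α := by
  simp only [unitLIso, Iso.trans_hom, Iso.symm_hom, Category.assoc]
  rw [reassoc_of% (B.flatUnitL_nat α)]
  refine congrArg (fun y => (B.flatUnitL f).hom ≫ y) ?_
  rw [Iso.eq_inv_comp, ← Category.assoc, Iso.comp_inv_eq, ι_nat]

theorem unitRIso_nat {a b : B.Obj} {f f' : B.Hom a b} (α : f ⟶ f') :
    B.cmp₂ (pairHom α (𝟙 (B.cmp (nil b)))) ≫ (B.unitRIso f').hom = (B.unitRIso f).hom ≫ α := by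
  simp only [unitRIso, Iso.trans_hom, Iso.symm_hom, Category.assoc]
  rw [reassoc_of% (B.flatUnitR_nat α)]
  refine congrArg (fun y => (B.flatUnitR f).hom ≫ y) ?_
  rw [Iso.eq_inv_comp, ← Category.assoc, Iso.comp_inv_eq, ι_nat]

theorem cmp₂_pair_id {a b c : B.Obj} (f : B.Hom a b) (g : B.Hom b c) :
    B.cmp₂ (pairHom (𝟙 f) (𝟙 g)) = 𝟙 (B.cmp (pair f g)) :=
  (B.comp a c).map_id (pair f g)

theorem cmp₂_pair_comp {a b c : B.Obj} {f f' f'' : B.Hom a b} {g g' g'' : B.Hom b c}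
    (α : f ⟶ f') (α' : f' ⟶ f'') (β : g ⟶ g') (β' : g' ⟶ g'') :
    B.cmp₂ (pairHom α β) ≫ B.cmp₂ (pairHom α' β') = B.cmp₂ (pairHom (α ≫ α') (β ≫ β')) :=
  ((B.comp a c).map_comp (pairHom α β) (pairHom α' β')).symm

theorem assocIso_pentagon {a b c d e : B.Obj} (f : B.Hom a b) (g : B.Hom b c) (h : B.Hom c d)
    (i : B.Hom d e) :
    B.cmp₂ (pairHom (B.assocIso f g h).hom (𝟙 i)) ≫
        (B.assocIso f (B.cmp (pair g h)) i).hom ≫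
          B.cmp₂ (pairHom (𝟙 f) (B.assocIso g h i).hom) =
      (B.assocIso (B.cmp (pair f g)) h i).hom ≫ (B.assocIso f g (B.cmp (pair h i))).hom := by
  have i₁ : B.cmp₂ (pairHom (B.assocIso f g h).hom (𝟙 i)) ≫
      B.cmp₂ (pairHom (B.flatR f g h).hom (𝟙 i)) = B.cmp₂ (pairHom (B.flatL f g h).hom (𝟙 i)) := by
    rw [cmp₂_pair_comp]
    simp only [assocIso, Iso.trans_hom, Iso.symm_hom, Category.assoc, Iso.inv_hom_id,
      Category.comp_id]
  have i₂ : B.cmp₂ (pairHom (𝟙 f) (B.assocIso g h i).hom) ≫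
      B.cmp₂ (pairHom (𝟙 f) (B.flatR g h i).hom) = B.cmp₂ (pairHom (𝟙 f) (B.flatL g h i).hom) := by
    rw [cmp₂_pair_comp]
    simp only [assocIso, Iso.trans_hom, Iso.symm_hom, Category.assoc, Iso.inv_hom_id,
      Category.comp_id]
  have i₃ : ∀ {a b c d : B.Obj} (f : B.Hom a b) (g : B.Hom b c) (h : B.Hom c d),
      (B.assocIso f g h).hom ≫ (B.flatR f g h).hom = (B.flatL f g h).hom := by
    intro a b c d f g h
    simp only [assocIso, Iso.trans_hom, Iso.symm_hom, Category.assoc, Iso.inv_hom_id,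
      Category.comp_id]
  have mono : Mono (B.cmp₂ (pairHom (𝟙 f) (B.flatR g h i).hom) ≫ (B.q₂ f g h i).hom) := by
    have : IsIso (B.cmp₂ (pairHom (𝟙 f) (B.flatR g h i).hom)) :=
      ((B.comp a e).mapIso (pairIso (Iso.refl f) (B.flatR g h i))).isIso_hom
    infer_instance
  rw [← cancel_mono (B.cmp₂ (pairHom (𝟙 f) (B.flatR g h i).hom) ≫ (B.q₂ f g h i).hom)]
  simp only [Category.assoc]
  rw [reassoc_of% i₂, sq₃, reassoc_of% (i₃ f (B.cmp (pair g h)) i), ← sq₂, reassoc_of% i₁, sq₁,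
    sq₄, reassoc_of% (i₃ f g (B.cmp (pair h i))), ← sq₅_aux₂, sq₅_aux₁,
    reassoc_of% (i₃ (B.cmp (pair f g)) h i)]

theorem assocIso_triangle {a b c : B.Obj} (f : B.Hom a b) (g : B.Hom b c) :
    (B.assocIso f (B.cmp (nil b)) g).hom ≫ B.cmp₂ (pairHom (𝟙 f) (B.unitLIso g).hom) =
      B.cmp₂ (pairHom (B.unitRIso f).hom (𝟙 g)) := by
  simp only [assocIso, unitLIso, unitRIso, Iso.trans_hom, Iso.symm_hom, Category.assoc]
  rw [flatR_q₀, flatL_q₀, Iso.inv_hom_id_assoc]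

/-- The classical bicategory underlying an unbiased bicategory. Mathlib writes composition of
1-cells in diagrammatic order, `f ≫ g = g ∘ f`, so that its associator `(f ≫ g) ≫ h ≅ f ≫ g ≫ h`
is a 2-cell `h ∘ (g ∘ f) ≅ (h ∘ g) ∘ f`. -/
@[reducible] def toBicategory : Bicategory.{w, v} B.Obj where
  Hom a b := B.Hom a b
  id a := B.cmp (nil a)
  comp f g := B.cmp (pair f g)
  homCategory a b := B.homCat a b
  whiskerLeft f _ _ η := B.cmp₂ (pairHom (𝟙 f) η)
  whiskerRight η h := B.cmp₂ (pairHom η (𝟙 h))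
  associator f g h := B.assocIso f g h
  leftUnitor f := B.unitLIso f
  rightUnitor f := B.unitRIso f
  whiskerLeft_id f g := B.cmp₂_pair_id f g
  whiskerLeft_comp f _ _ _ η θ := by
    rw [cmp₂_pair_comp, Category.comp_id]
  id_whiskerLeft η := by
    rw [← Category.assoc, Iso.eq_comp_inv]
    exact B.unitLIso_nat η
  comp_whiskerLeft f g _ _ η := by
    rw [← Category.assoc, Iso.eq_comp_inv, ← cmp₂_pair_id]
    exact B.assocIso_nat (𝟙 f) (𝟙 g) η
  id_whiskerRight f g := B.cmp₂_pair_id f g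
  comp_whiskerRight η θ i := by
    rw [cmp₂_pair_comp, Category.comp_id]
  whiskerRight_id η := by
    rw [← Category.assoc, Iso.eq_comp_inv]
    exact B.unitRIso_nat η
  whiskerRight_comp η g h := by
    rw [Iso.eq_inv_comp, ← cmp₂_pair_id]
    exact (B.assocIso_nat η (𝟙 g) (𝟙 h)).symm
  whisker_assoc f _ _ η h := by
    rw [← Category.assoc, Iso.eq_comp_inv]
    exact B.assocIso_nat (𝟙 f) η (𝟙 h)
  whisker_exchange η θ := by
    rw [cmp₂_pair_comp, cmp₂_pair_comp]
    simp only [Category.id_comp, Category.comp_id]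
  pentagon f g h i := B.assocIso_pentagon f g h i
  triangle f g := B.assocIso_triangle f g

end

end UBicat

namespace ULaxFunctor

open CSeq

section

variable {B : UBicat.{w, v, u}} {C : UBicat.{w', v', u'}} (F : ULaxFunctor B C)

theorem φ_pair_nat {a b c : B.Obj} {f f' : B.Hom a b} {g g' : B.Hom b c} (α : f ⟶ f')
    (β : g ⟶ g') :
    C.cmp₂ (pairHom ((F.fun₁ a b).map α) ((F.fun₁ b c).map β)) ≫ (F.φ a c).app (pair f' g') =
      (F.φ a c).app (pair f g) ≫ (F.fun₁ a c).map (B.cmp₂ (pairHom α β)) :=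
  (F.φ a c).naturality (pairHom α β : pair f g ⟶ pair f' g')

theorem φ_flatL {a b c d : B.Obj} (f : B.Hom a b) (g : B.Hom b c) (h : B.Hom c d) :
    C.cmp₂ (pairHom ((F.φ a c).app (pair f g)) (𝟙 ((F.fun₁ c d).obj h))) ≫
        (F.φ a d).app (pair (B.cmp (pair f g)) h) ≫ (F.fun₁ a d).map (B.flatL f g h).hom =
      (C.flatL ((F.fun₁ a b).obj f) ((F.fun₁ b c).obj g) ((F.fun₁ c d).obj h)).hom ≫
        (F.φ a d).app (cons f (pair g h)) := by
  have m : C.cmp₂ (pairHom ((F.φ a c).app (pair f g)) ((F.φ c d).app (single h))) ≫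
      (F.φ a d).app (pair (B.cmp (pair f g)) (B.cmp (single h))) ≫
        (F.fun₁ a d).map (B.γ (pair (pair f g) (single h))).hom =
      (C.γ (pair (pair ((F.fun₁ a b).obj f) ((F.fun₁ b c).obj g))
        (single ((F.fun₁ c d).obj h)))).hom ≫ (F.φ a d).app (cons f (pair g h)) :=
    (F.map_γ (pair (pair f g) (single h))).trans (congrArg (fun y => _ ≫ y)
      ((congrArg (fun y => y ≫ _) ((C.comp _ _).map_id _)).trans (Category.id_comp _)))
  have n := F.φ_pair_nat (𝟙 (B.cmp (pair f g))) (B.ι h).hom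
  have k := F.map_ι h
  simp only [UBicat.flatL, Iso.trans_hom, Functor.mapIso_hom, Iso.refl_hom, Category.assoc,
    Functor.map_comp]
  rw [← m, ← reassoc_of% n, ← k]
  simp only [← Functor.map_comp_assoc, consHom_comp, Category.id_comp, Category.comp_id,
    CategoryTheory.Functor.map_id, Functor.comp_obj]

theorem φ_flatR {a b c d : B.Obj} (f : B.Hom a b) (g : B.Hom b c) (h : B.Hom c d) :
    C.cmp₂ (pairHom (𝟙 ((F.fun₁ a b).obj f)) ((F.φ b d).app (pair g h))) ≫
        (F.φ a d).app (pair f (B.cmp (pair g h))) ≫ (F.fun₁ a d).map (B.flatR f g h).hom =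
      (C.flatR ((F.fun₁ a b).obj f) ((F.fun₁ b c).obj g) ((F.fun₁ c d).obj h)).hom ≫
        (F.φ a d).app (cons f (pair g h)) := by
  have m : C.cmp₂ (pairHom ((F.φ a b).app (single f)) ((F.φ b d).app (pair g h))) ≫
      (F.φ a d).app (pair (B.cmp (single f)) (B.cmp (pair g h))) ≫
        (F.fun₁ a d).map (B.γ (pair (single f) (pair g h))).hom =
      (C.γ (pair (single ((F.fun₁ a b).obj f)) (pair ((F.fun₁ b c).obj g)
        ((F.fun₁ c d).obj h)))).hom ≫ (F.φ a d).app (cons f (pair g h)) :=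
    (F.map_γ (pair (single f) (pair g h))).trans (congrArg (fun y => _ ≫ y)
      ((congrArg (fun y => y ≫ _) ((C.comp _ _).map_id _)).trans (Category.id_comp _)))
  have n := F.φ_pair_nat (B.ι f).hom (𝟙 (B.cmp (pair g h)))
  have k := F.map_ι f
  simp only [UBicat.flatR, Iso.trans_hom, Functor.mapIso_hom, Iso.refl_hom, Category.assoc,
    Functor.map_comp]
  rw [← m, ← reassoc_of% n, ← k]
  simp only [← Functor.map_comp_assoc, consHom_comp, Category.id_comp, Category.comp_id,
    CategoryTheory.Functor.map_id, Functor.comp_obj]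

theorem φ_unitL {a b : B.Obj} (f : B.Hom a b) :
    C.cmp₂ (pairHom ((F.φ a a).app (nil a)) (𝟙 ((F.fun₁ a b).obj f))) ≫
        (F.φ a b).app (pair (B.cmp (nil a)) f) ≫ (F.fun₁ a b).map (B.unitLIso f).hom =
      (C.unitLIso ((F.fun₁ a b).obj f)).hom := by
  have m : C.cmp₂ (pairHom ((F.φ a a).app (nil a)) ((F.φ a b).app (single f))) ≫
      (F.φ a b).app (pair (B.cmp (nil a)) (B.cmp (single f))) ≫
        (F.fun₁ a b).map (B.γ (pair (nil a) (single f))).hom =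
      (C.γ (pair (nil (F.obj a)) (single ((F.fun₁ a b).obj f)))).hom ≫ (F.φ a b).app (single f) :=
    (F.map_γ (pair (nil a) (single f))).trans (congrArg (fun y => _ ≫ y)
      ((congrArg (fun y => y ≫ _) ((C.comp _ _).map_id _)).trans (Category.id_comp _)))
  have n := F.φ_pair_nat (𝟙 (B.cmp (nil a))) (B.ι f).hom
  have k := F.map_ι f
  rw [← cancel_mono ((F.fun₁ a b).map (B.ι f).hom)]
  simp only [UBicat.unitLIso, UBicat.flatUnitL, Iso.trans_hom, Iso.symm_hom, Functor.mapIso_hom,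
    Iso.refl_hom, Category.assoc, Functor.map_comp]
  rw [← Functor.map_comp, Iso.inv_hom_id, CategoryTheory.Functor.map_id, Category.comp_id, ← k,
    Iso.inv_hom_id_assoc, ← m, ← reassoc_of% n, ← k]
  simp only [← Functor.map_comp_assoc, consHom_comp, Category.id_comp, Category.comp_id,
    CategoryTheory.Functor.map_id, Functor.comp_obj]

theorem φ_unitR {a b : B.Obj} (f : B.Hom a b) :
    C.cmp₂ (pairHom (𝟙 ((F.fun₁ a b).obj f)) ((F.φ b b).app (nil b))) ≫
        (F.φ a b).app (pair f (B.cmp (nil b))) ≫ (F.fun₁ a b).map (B.unitRIso f).hom =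
      (C.unitRIso ((F.fun₁ a b).obj f)).hom := by
  have m : C.cmp₂ (pairHom ((F.φ a b).app (single f)) ((F.φ b b).app (nil b))) ≫
      (F.φ a b).app (pair (B.cmp (single f)) (B.cmp (nil b))) ≫
        (F.fun₁ a b).map (B.γ (pair (single f) (nil b))).hom =
      (C.γ (pair (single ((F.fun₁ a b).obj f)) (nil (F.obj b)))).hom ≫ (F.φ a b).app (single f) :=
    (F.map_γ (pair (single f) (nil b))).trans (congrArg (fun y => _ ≫ y)
      ((congrArg (fun y => y ≫ _) ((C.comp _ _).map_id _)).trans (Category.id_comp _)))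
  have n := F.φ_pair_nat (B.ι f).hom (𝟙 (B.cmp (nil b)))
  have k := F.map_ι f
  rw [← cancel_mono ((F.fun₁ a b).map (B.ι f).hom)]
  simp only [UBicat.unitRIso, UBicat.flatUnitR, Iso.trans_hom, Iso.symm_hom, Functor.mapIso_hom,
    Iso.refl_hom, Category.assoc, Functor.map_comp]
  rw [← Functor.map_comp, Iso.inv_hom_id, CategoryTheory.Functor.map_id, Category.comp_id, ← k,
    Iso.inv_hom_id_assoc, ← m, ← reassoc_of% n, ← k]
  simp only [← Functor.map_comp_assoc, consHom_comp, Category.id_comp, Category.comp_id,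
    CategoryTheory.Functor.map_id, Functor.comp_obj]

theorem φ_unitL_inv {a b : B.Obj} (f : B.Hom a b) :
    (F.fun₁ a b).map (B.unitLIso f).inv = (C.unitLIso ((F.fun₁ a b).obj f)).inv ≫
      C.cmp₂ (pairHom ((F.φ a a).app (nil a)) (𝟙 ((F.fun₁ a b).obj f))) ≫
        (F.φ a b).app (pair (B.cmp (nil a)) f) := by
  rw [Iso.eq_inv_comp, ← F.φ_unitL f, Category.assoc, Category.assoc, ← Functor.map_comp,
    Iso.hom_inv_id, CategoryTheory.Functor.map_id]
  exact congrArg (fun y => C.cmp₂ _ ≫ y) (Category.comp_id _)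

theorem φ_unitR_inv {a b : B.Obj} (f : B.Hom a b) :
    (F.fun₁ a b).map (B.unitRIso f).inv = (C.unitRIso ((F.fun₁ a b).obj f)).inv ≫
      C.cmp₂ (pairHom (𝟙 ((F.fun₁ a b).obj f)) ((F.φ b b).app (nil b))) ≫
        (F.φ a b).app (pair f (B.cmp (nil b))) := by
  rw [Iso.eq_inv_comp, ← F.φ_unitR f, Category.assoc, Category.assoc, ← Functor.map_comp,
    Iso.hom_inv_id, CategoryTheory.Functor.map_id]
  exact congrArg (fun y => C.cmp₂ _ ≫ y) (Category.comp_id _)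

theorem φ_assoc {a b c d : B.Obj} (f : B.Hom a b) (g : B.Hom b c) (h : B.Hom c d) :
    C.cmp₂ (pairHom ((F.φ a c).app (pair f g)) (𝟙 ((F.fun₁ c d).obj h))) ≫
        (F.φ a d).app (pair (B.cmp (pair f g)) h) ≫ (F.fun₁ a d).map (B.assocIso f g h).hom =
      (C.assocIso ((F.fun₁ a b).obj f) ((F.fun₁ b c).obj g) ((F.fun₁ c d).obj h)).hom ≫
        C.cmp₂ (pairHom (𝟙 ((F.fun₁ a b).obj f)) ((F.φ b d).app (pair g h))) ≫
          (F.φ a d).app (pair f (B.cmp (pair g h))) := by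
  have l := F.φ_flatL f g h
  have r := F.φ_flatR f g h
  rw [← cancel_mono ((F.fun₁ a d).map (B.flatR f g h).hom)]
  simp only [UBicat.assocIso, Iso.trans_hom, Iso.symm_hom, Category.assoc, Functor.map_comp]
  rw [← Functor.map_comp, Iso.inv_hom_id, CategoryTheory.Functor.map_id, Category.comp_id, l, r,
    Iso.inv_hom_id_assoc]

/-- The lax functor underlying an unbiased lax functor: keep the binary and the nullary coherence
2-cells only. -/
@[reducible] def toLaxFunctor : @LaxFunctor B.Obj B.toBicategory C.Obj C.toBicategory :=
  letI := B.toBicategory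
  letI := C.toBicategory
  { obj := F.obj
    map := fun {a b} f => (F.fun₁ a b).obj f
    map₂ := fun {a b} _ _ α => (F.fun₁ a b).map α
    map₂_id := fun {a b} f => (F.fun₁ a b).map_id f
    map₂_comp := fun {a b} _ _ _ α β => (F.fun₁ a b).map_comp α β
    mapId := fun a => (F.φ a a).app (nil a)
    mapComp := fun {a _ c} f g => (F.φ a c).app (pair f g)
    mapComp_naturality_left := fun {a b c} f f' η g => by
      have := F.φ_pair_nat η (𝟙 g)
      rw [CategoryTheory.Functor.map_id] at this
      exact this.symm
    mapComp_naturality_right := fun {a b c} f g g' η => by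
      have := F.φ_pair_nat (𝟙 f) η
      rw [CategoryTheory.Functor.map_id] at this
      exact this.symm
    map₂_associator := fun f g h => F.φ_assoc f g h
    map₂_leftUnitor := fun {a b} f => by
      exact F.φ_unitL_inv f
    map₂_rightUnitor := fun {a b} f => by
      exact F.φ_unitR_inv f }

end

end ULaxFunctor

/-- Lax functors which agree on 0-, 1- and 2-cells and have the same coherence 2-cells are
equal. -/
theorem laxFunctor_mk_congr {B : Type u} [Bicategory.{w, v} B] {C : Type u'}
    [Bicategory.{w', v'} C] {F : PrelaxFunctor B C}
    {i i' : ∀ a : B, 𝟙 (F.obj a) ⟶ F.map (𝟙 a)}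
    {m m' : ∀ {a b c : B} (f : a ⟶ b) (g : b ⟶ c), F.map f ≫ F.map g ⟶ F.map (f ≫ g)}
    (hi : ∀ a, i a = i' a) (hm : ∀ {a b c : B} (f : a ⟶ b) (g : b ⟶ c), m f g = m' f g)
    {p₁ p₂ p₃ p₄ p₅ q₁ q₂ q₃ q₄ q₅} :
    LaxFunctor.mk F i m p₁ p₂ p₃ p₄ p₅ = LaxFunctor.mk F i' m' q₁ q₂ q₃ q₄ q₅ := by
  obtain rfl : i = i' := funext hi
  obtain rfl : @m = @m' := by
    funext a b c f g
    exact hm f g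
  rfl

/-- A classical bicategory. -/
structure Bicat : Type (max (u + 1) (v + 1) (w + 1)) where
  /-- The 0-cells. -/
  Obj : Type u
  /-- The bicategory structure. -/
  str : Bicategory.{w, v} Obj

attribute [instance] Bicat.str

/-- The category of bicategories and lax functors. -/
instance Bicat.category : Category Bicat.{w, v, u} where
  Hom B C := LaxFunctor B.Obj C.Obj
  id B := LaxFunctor.id B.Obj
  comp F G := F.comp G
  id_comp F := laxFunctor_mk_congr
    (fun a => (congrArg (fun y => F.mapId a ≫ y) (F.map₂_id _)).trans (Category.comp_id _))
    (fun f g => (congrArg (fun y => F.mapComp f g ≫ y) (F.map₂_id _)).trans (Category.comp_id _))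
  comp_id F := laxFunctor_mk_congr (fun a => Category.id_comp _) (fun f g => Category.id_comp _)
  assoc {A B C D} F G H := by
    have hi : ∀ a : A.Obj, (H.mapId (G.obj (F.obj a)) ≫ H.map₂ (G.mapId (F.obj a))) ≫
        H.map₂ (G.map₂ (F.mapId a)) =
        H.mapId (G.obj (F.obj a)) ≫ H.map₂ (G.mapId (F.obj a) ≫ G.map₂ (F.mapId a)) := by
      intro a
      rw [H.map₂_comp, Category.assoc]
    have hm : ∀ {a b c : A.Obj} (f : a ⟶ b) (g : b ⟶ c),
        (H.mapComp (G.map (F.map f)) (G.map (F.map g)) ≫ H.map₂ (G.mapComp (F.map f) (F.map g))) ≫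
          H.map₂ (G.map₂ (F.mapComp f g)) =
        H.mapComp (G.map (F.map f)) (G.map (F.map g)) ≫
          H.map₂ (G.mapComp (F.map f) (F.map g) ≫ G.map₂ (F.mapComp f g)) := by
      intro a b c f g
      rw [H.map₂_comp, Category.assoc]
    exact laxFunctor_mk_congr (F := ((F.comp G).comp H).toPrelaxFunctor)
      (i := ((F.comp G).comp H).mapId) (i' := (F.comp (G.comp H)).mapId)
      (m := ((F.comp G).comp H).mapComp) (m' := (F.comp (G.comp H)).mapComp)
      (fun a => (hi a).symm) (fun f g => (hm f g).symm)

/-- The forgetful functor `V` from unbiased bicategories and unbiased lax functors to classical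
bicategories and lax functors. -/
def forgetV : UBicat.{w, v, u} ⥤ Bicat.{w, v, u} where
  obj B := ⟨B.Obj, B.toBicategory⟩
  map F := ULaxFunctor.toLaxFunctor F
  map_id B := by
    let := B.toBicategory
    exact laxFunctor_mk_congr (fun a => (B.comp a a).map_id _)
      (fun {a _ c} f g => (B.comp a c).map_id _)
  map_comp {B C D} F G := by
    let := B.toBicategory
    let := C.toBicategory
    let := D.toBicategory
    exact laxFunctor_mk_congr
      (fun a => (congrArg (fun y => y ≫ _) ((D.comp _ _).map_id _)).trans (Category.id_comp _))
      (fun f g => (congrArg (fun y => y ≫ _) ((D.comp _ _).map_id _)).trans (Category.id_comp _))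

/-- Unbiased weak functors: all coherence 2-cells are invertible. -/
def UBicat.isWeak : MorphismProperty UBicat.{w, v, u} := fun _ _ F =>
  ∀ a b s, IsIso ((ULaxFunctor.φ F a b).app s)

/-- Unbiased strict functors: all coherence 2-cells are identities. -/
def UBicat.isStrict : MorphismProperty UBicat.{w, v, u} := fun B C F =>
  ∀ a b s, ∃ h : C.cmp ((CSeq.mapFunctor (ULaxFunctor.obj F) (ULaxFunctor.fun₁ F) a b).obj s) =
    (ULaxFunctor.fun₁ F a b).obj (B.cmp s), (ULaxFunctor.φ F a b).app s = eqToHom h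

/-- Weak functors: all coherence 2-cells are invertible. -/
def Bicat.isWeak : MorphismProperty Bicat.{w, v, u} := fun B _ F =>
  (∀ a : B.Obj, IsIso (LaxFunctor.mapId F a)) ∧
    ∀ (a b c : B.Obj) (f : a ⟶ b) (g : b ⟶ c), IsIso (LaxFunctor.mapComp F f g)

/-- Strict functors: all coherence 2-cells are identities. -/
def Bicat.isStrict : MorphismProperty Bicat.{w, v, u} := fun B _ F =>
  (∀ a : B.Obj, ∃ h, LaxFunctor.mapId F a = eqToHom h) ∧
    ∀ (a b c : B.Obj) (f : a ⟶ b) (g : b ⟶ c), ∃ h, LaxFunctor.mapComp F f g = eqToHom h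

instance UBicat.isWeak_isMultiplicative : (UBicat.isWeak.{w, v, u}).IsMultiplicative where
  id_mem B := fun a b s =>
    inferInstanceAs (IsIso ((B.comp a b).map (eqToHom (CSeq.mapFunctor_id_obj s))))
  comp_mem {B C D} F G hF hG := fun a b s => by
    have := hF a b s
    have := hG _ _ ((CSeq.mapFunctor (ULaxFunctor.obj F) (ULaxFunctor.fun₁ F) a b).obj s)
    exact inferInstanceAs (IsIso (D.cmp₂ (eqToHom (CSeq.mapFunctor_comp_obj _ _ _ _ s)) ≫
      (ULaxFunctor.φ G _ _).app
        ((CSeq.mapFunctor (ULaxFunctor.obj F) (ULaxFunctor.fun₁ F) a b).obj s) ≫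
          (ULaxFunctor.fun₁ G _ _).map ((ULaxFunctor.φ F a b).app s)))

instance UBicat.isStrict_isMultiplicative : (UBicat.isStrict.{w, v, u}).IsMultiplicative where
  id_mem B := fun a b s => ⟨congrArg B.cmp (CSeq.mapFunctor_id_obj s), eqToHom_map _ _⟩
  comp_mem {B C D} F G hF hG := fun a b s => by
    obtain ⟨h, e⟩ := hF a b s
    obtain ⟨h', e'⟩ := hG _ _ ((CSeq.mapFunctor (ULaxFunctor.obj F) (ULaxFunctor.fun₁ F) a b).obj s)
    refine ⟨(congrArg D.cmp (CSeq.mapFunctor_comp_obj (ULaxFunctor.obj F) (ULaxFunctor.fun₁ F)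
      (ULaxFunctor.obj G) (ULaxFunctor.fun₁ G) s)).trans
      (h'.trans (congrArg (ULaxFunctor.fun₁ G _ _).obj h)), ?_⟩
    refine (ULaxFunctor.compφ_app F G s).trans ?_
    have k := eqToHom_map (D.comp _ _) (CSeq.mapFunctor_comp_obj (ULaxFunctor.obj F)
      (ULaxFunctor.fun₁ F) (ULaxFunctor.obj G) (ULaxFunctor.fun₁ G) s)
    rw [e, e', eqToHom_map]
    refine (congrArg (fun y => y ≫ _) k).trans ?_
    rw [eqToHom_trans]
    exact eqToHom_trans _ _

instance Bicat.isWeak_isMultiplicative : (Bicat.isWeak.{w, v, u}).IsMultiplicative where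
  id_mem B := ⟨fun a => inferInstanceAs (IsIso (𝟙 (𝟙 a))),
    fun _ _ _ f g => inferInstanceAs (IsIso (𝟙 (f ≫ g)))⟩
  comp_mem {B C D} (F : LaxFunctor B.Obj C.Obj) (G : LaxFunctor C.Obj D.Obj) hF hG := by
    refine ⟨fun a => ?_, fun a b c f g => ?_⟩
    · have := hF.1 a
      have := hG.1 (F.obj a)
      exact inferInstanceAs (IsIso (G.mapId (F.obj a) ≫ G.map₂ (F.mapId a)))
    · have := hF.2 a b c f g
      have := hG.2 _ _ _ (F.map f) (F.map g)
      exact inferInstanceAs (IsIso (G.mapComp (F.map f) (F.map g) ≫ G.map₂ (F.mapComp f g)))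

instance Bicat.isStrict_isMultiplicative : (Bicat.isStrict.{w, v, u}).IsMultiplicative where
  id_mem B := ⟨fun _ => ⟨rfl, rfl⟩, fun _ _ _ _ _ => ⟨rfl, rfl⟩⟩
  comp_mem {B C D} (F : LaxFunctor B.Obj C.Obj) (G : LaxFunctor C.Obj D.Obj) hF hG := by
    refine ⟨fun a => ?_, fun a b c f g => ?_⟩
    · obtain ⟨h, e⟩ := hF.1 a
      obtain ⟨h', e'⟩ := hG.1 (F.obj a)
      refine ⟨h'.trans (congrArg (fun x => G.map x) h), ?_⟩
      change G.mapId (F.obj a) ≫ G.map₂ (F.mapId a) = _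
      rw [e, e', PrelaxFunctor.map₂_eqToHom]
      exact eqToHom_trans _ _
    · obtain ⟨h, e⟩ := hF.2 a b c f g
      obtain ⟨h', e'⟩ := hG.2 _ _ _ (F.map f) (F.map g)
      refine ⟨h'.trans (congrArg (fun x => G.map x) h), ?_⟩
      change G.mapComp (F.map f) (F.map g) ≫ G.map₂ (F.mapComp f g) = _
      rw [e, e', PrelaxFunctor.map₂_eqToHom]
      exact eqToHom_trans _ _

/-- The category of unbiased bicategories and unbiased weak functors. -/
abbrev UBicatWk := WideSubcategory UBicat.isWeak.{w, v, u}

/-- The category of bicategories and weak functors. -/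
abbrev BicatWk := WideSubcategory Bicat.isWeak.{w, v, u}

/-- The category of unbiased bicategories and unbiased strict functors. -/
abbrev UBicatStr := WideSubcategory UBicat.isStrict.{w, v, u}

/-- The category of bicategories and strict functors. -/
abbrev BicatStr := WideSubcategory Bicat.isStrict.{w, v, u}

/-- The restriction of a functor to wide subcategories. -/
def wideRestrict {C : Type u} [Category.{v} C] {D : Type u'} [Category.{v'} D] (F : C ⥤ D)
    {P : MorphismProperty C} {Q : MorphismProperty D} [P.IsMultiplicative] [Q.IsMultiplicative]
    (h : ∀ {X Y : C} (f : X ⟶ Y), P f → Q (F.map f)) :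
    WideSubcategory P ⥤ WideSubcategory Q where
  obj X := ⟨F.obj X.obj⟩
  map f := ⟨F.map f.hom, h f.hom f.property⟩
  map_id X := by ext; exact F.map_id X.obj
  map_comp f g := by ext; exact F.map_comp f.hom g.hom

/-- The restriction of the forgetful functor to weak functors. -/
def forgetVwk : UBicatWk.{w, v, u} ⥤ BicatWk.{w, v, u} :=
  wideRestrict forgetV fun _ hF => ⟨fun a => hF a a (CSeq.nil a),
    fun a _ c f g => hF a c (CSeq.pair f g)⟩

/-- The restriction of the forgetful functor to strict functors. -/
def forgetVstr : UBicatStr.{w, v, u} ⥤ BicatStr.{w, v, u} :=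
  wideRestrict forgetV fun _ hF => ⟨fun a => hF a a (CSeq.nil a),
    fun a _ c f g => hF a c (CSeq.pair f g)⟩

section

open Bicategory CSeq

variable {C : Type u} [Bicategory.{w, v} C]

/-- The left-associated composite of a sequence of 1-cells: with `fₙ ∘ ⋯ ∘ f₁` written in the
order of composition of maps, `(⋯((fₙ ∘ fₙ₋₁) ∘ fₙ₋₂) ∘ ⋯) ∘ f₁`. The composite of the empty
sequence is an identity and that of a one-term sequence is its term. -/
def leftObj : ∀ {a b : C}, CSeq (fun a b : C => a ⟶ b) a b → (a ⟶ b)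
  | _, _, nil a => 𝟙 a
  | _, _, cons f (nil _) => f
  | _, _, cons f (cons g s) => f ≫ leftObj (cons g s)

/-- The left-associated composite of a sequence of 2-cells. -/
def leftMap : ∀ {a b : C} {s t : CSeq (fun a b : C => a ⟶ b) a b}, Hom₂ s t →
    (leftObj s ⟶ leftObj t)
  | _, _, _, _, Hom₂.nil a => 𝟙 (𝟙 a)
  | _, _, _, _, Hom₂.cons α (Hom₂.nil _) => α
  | _, _, _, _, Hom₂.cons (g := g) (s := cons _ _) α (Hom₂.cons β σ) =>
      α ▷ _ ≫ g ◁ leftMap (Hom₂.cons β σ)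

theorem leftMap_id {a b : C} (s : CSeq (fun a b : C => a ⟶ b) a b) :
    leftMap (Hom₂.id s) = 𝟙 (leftObj s) := by
  induction s with
  | nil a => rfl
  | cons f s ih =>
    cases s with
    | nil _ => rfl
    | cons g s =>
      change 𝟙 f ▷ leftObj (cons g s) ≫ f ◁ leftMap (Hom₂.id (cons g s)) =
        𝟙 (f ≫ leftObj (cons g s))
      rw [ih]
      simp

theorem leftMap_comp {a b : C} {s t r : CSeq (fun a b : C => a ⟶ b) a b} (σ : Hom₂ s t)
    (τ : Hom₂ t r) : leftMap (Hom₂.comp σ τ) = leftMap σ ≫ leftMap τ := by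
  induction σ with
  | nil a => cases τ; exact (Category.id_comp _).symm
  | cons α σ ih =>
    cases τ with
    | cons β τ =>
      cases σ with
      | nil _ => cases τ; rfl
      | cons α' σ =>
        cases τ with
        | cons β' τ =>
          have k := ih (Hom₂.cons β' τ)
          change (α ≫ β) ▷ _ ≫ _ ◁ leftMap (Hom₂.comp (Hom₂.cons α' σ) (Hom₂.cons β' τ)) =
            (α ▷ _ ≫ _ ◁ leftMap (Hom₂.cons α' σ)) ≫ (β ▷ _ ≫ _ ◁ leftMap (Hom₂.cons β' τ))
          rw [k]
          simp only [comp_whiskerRight, whiskerLeft_comp, Category.assoc, whisker_exchange_assoc]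

/-- The left-associated composition functors. -/
def leftComp (a b : C) : CSeq (fun a b : C => a ⟶ b) a b ⥤ (a ⟶ b) where
  obj s := leftObj s
  map σ := leftMap σ
  map_id s := leftMap_id s
  map_comp σ τ := leftMap_comp σ τ

/-- The canonical isomorphism from the composite of two left-associated composites to the
left-associated composite of the concatenated sequence. -/
def leftAppend : ∀ {a b c : C} (s : CSeq (fun a b : C => a ⟶ b) a b)
    (t : CSeq (fun a b : C => a ⟶ b) b c), leftObj s ≫ leftObj t ≅ leftObj (append s t)
  | _, _, _, nil _, t => λ_ (leftObj t)
  | _, _, _, cons f (nil _), nil _ => ρ_ f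
  | _, _, _, cons f (nil _), cons g t => Iso.refl (f ≫ leftObj (cons g t))
  | _, _, _, cons f (cons g s), t =>
      α_ f (leftObj (cons g s)) (leftObj t) ≪≫ whiskerLeftIso f (leftAppend (cons g s) t)

/-- The canonical isomorphism which removes the inner brackets of a left-associated composite of
left-associated composites. -/
def leftγ : ∀ {a b : C} (D : CSeq (CSeq (fun a b : C => a ⟶ b)) a b),
    leftObj (CSeq.map (fun x => x) (fun _ _ s => leftObj s) D) ≅ leftObj (flatten D)
  | _, _, nil a => Iso.refl (𝟙 a)
  | _, _, cons s (nil _) =>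
      eqToIso (show leftObj s = leftObj (flatten (single s)) by rw [flatten_single])
  | _, _, cons s (cons t D) =>
      whiskerLeftIso (leftObj s) (leftγ (cons t D)) ≪≫ leftAppend s (flatten (cons t D))

end

/-- `B` is the unbiased bicategory obtained from the bicategory `C` by associating to the left:
it has the same 0-, 1- and 2-cells, the left-associated composition functors, the canonical
isomorphisms as `γ` and the identities as `ι`. -/
def IsLeftAssociated (C : Bicat.{w, v, u}) (B : UBicat.{w, v, u}) : Prop :=
  ∃ S : UnbiasedCoherence (fun a b : C.Obj => (a ⟶ b)) leftComp,
    (∀ (a b : C.Obj) (D : CSeq (CSeq (fun a b : C.Obj => (a ⟶ b))) a b),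
      (S.γ a b).hom.app D = (leftγ D).hom) ∧
    (∀ (a b : C.Obj) (f : a ⟶ b), (S.ι a b).hom.app f = 𝟙 f) ∧
    B = ⟨C.Obj, fun a b => (a ⟶ b), fun _ _ => inferInstance, leftComp, S⟩

/-! The mechanism is that an unbiased composite can be peeled one arrow at a time. With sequences
listed from their first arrow, `ι` and `γ` give an isomorphism `(f, (s)) ≅ (f, s)`, called
`consIso`, which replaces the composite of a nonempty sequence by a binary composite. Statements
about arbitrary arities then become inductions on sequences.

Faithfulness. Compatibility of an unbiased lax functor with `γ` at the double sequence `((f), s)`,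
together with naturality and compatibility with `ι`, yields `ULaxFunctor.φ_cons`: up to the
isomorphisms `consIso`, the coherence 2-cell at `(f, s)` is the one at `s` followed by a binary one.
So the nullary and binary 2-cells determine all the others, and if they are invertible, so are all
the others. The second fact says that `V` reflects weakness, which makes fullness of `V_wk` a
consequence of fullness of `V`.

Fullness. Given a classical lax functor, the same recursion is taken as the definition of the
missing 2-cells. The main point is `BinaryLaxFunctor.φ_append`, compatibility with concatenation of
two sequences: by induction on the first sequence, the empty case is the left unit axiom and the
inductive step is the associativity axiom. Compatibility with `γ` follows by induction on the double
sequence through `UBicat.γ_cons`, and `BinaryLaxFunctor.φ_pair` shows that the original binary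
2-cells are recovered.

Surjectivity. Left-associated composition carries a coherence structure: the pentagon gives
associativity of concatenation (`leftAppend_assoc`), this gives compatibility of `leftγ` with
concatenation (`leftγ_append`), and this gives the associativity axiom (`leftγ_assoc`). The
underlying bicategory is the original one on the nose (`toBicategory_leftUBicat`).

The rest is formal. A full and faithful functor with a strict section on objects acquires a section
functor which is also a quasi-inverse, and this is `L`. Fullness fails for strict functors because
`V` forgets the choice of ternary composites. -/

section LeftAssociated

/-! ### Coherence of left-associated composition -/

open Bicategory CSeq

variable {C : Type u} [Bicategory.{w, v} C]

/-- The canonical isomorphism `f ≫ leftObj s ≅ leftObj (cons f s)`. -/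
def leftCons {a b c : C} (f : a ⟶ b) (s : CSeq (fun a b : C => a ⟶ b) b c) :
    f ≫ leftObj s ≅ leftObj (cons f s) :=
  leftAppend (single f) s

theorem leftCons_naturality {a b c : C} {f g : a ⟶ b} {s t : CSeq (fun a b : C => a ⟶ b) b c}
    (α : f ⟶ g) (σ : Hom₂ s t) :
    α ▷ leftObj s ≫ g ◁ leftMap σ ≫ (leftCons g t).hom =
      (leftCons f s).hom ≫ leftMap (Hom₂.cons α σ) := by
  cases σ with
  | nil _ =>
    change α ▷ 𝟙 b ≫ g ◁ 𝟙 (𝟙 b) ≫ (ρ_ g).hom = (ρ_ f).hom ≫ α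
    simp
  | cons β σ =>
    change α ▷ _ ≫ g ◁ leftMap (Hom₂.cons β σ) ≫ 𝟙 _ =
      𝟙 _ ≫ α ▷ _ ≫ g ◁ leftMap (Hom₂.cons β σ)
    simp

/-- The laws for concatenation of sequences hold only up to propositional equality, so the
inductions below must move transports past `leftCons`. -/
theorem leftCons_eqToHom {a b c : C} (f : a ⟶ b) {s t : CSeq (fun a b : C => a ⟶ b) b c}
    (h : s = t) :
    (leftCons f s).hom ≫ eqToHom (congrArg (fun s => leftObj (cons f s)) h) =
      f ◁ eqToHom (congrArg leftObj h) ≫ (leftCons f t).hom := by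
  subst h
  simp

/-- The isomorphism `leftObj (nil a) ≅ 𝟙 a`, an identity. -/
def leftNil (a : C) : leftObj (nil a) ≅ 𝟙 a :=
  Iso.refl (𝟙 a)

theorem leftAppend_nil_left {a b : C} (t : CSeq (fun a b : C => a ⟶ b) a b) :
    (leftAppend (nil a) t).hom = (leftNil a).hom ▷ leftObj t ≫ (λ_ (leftObj t)).hom := by
  change (λ_ (leftObj t)).hom = 𝟙 (𝟙 a) ▷ leftObj t ≫ (λ_ (leftObj t)).hom
  simp

theorem leftCons_nil {a b : C} (f : a ⟶ b) :
    (leftCons f (nil b)).hom = f ◁ (leftNil b).hom ≫ (ρ_ f).hom := by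
  change (ρ_ f).hom = f ◁ 𝟙 (𝟙 b) ≫ (ρ_ f).hom
  simp

/-- This single recursion replaces the case distinction in the definition of `leftAppend`. When `s`
is empty it is the triangle identity; otherwise `leftCons f s` is an identity and the equation is
the defining clause. Later inductions cancel `leftCons` on the left and apply it. -/
theorem leftAppend_cons {a b c d : C} (f : a ⟶ b) (s : CSeq (fun a b : C => a ⟶ b) b c)
    (t : CSeq (fun a b : C => a ⟶ b) c d) :
    (leftCons f s).hom ▷ leftObj t ≫ (leftAppend (cons f s) t).hom =
      (α_ f (leftObj s) (leftObj t)).hom ≫ f ◁ (leftAppend s t).hom ≫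
        (leftCons f (append s t)).hom := by
  cases s with
  | nil _ =>
    change (ρ_ f).hom ▷ leftObj t ≫ (leftCons f t).hom =
      (α_ f (𝟙 _) (leftObj t)).hom ≫ f ◁ (λ_ (leftObj t)).hom ≫ (leftCons f t).hom
    simp
  | cons g s =>
    change 𝟙 _ ▷ leftObj t ≫ ((α_ f (leftObj (cons g s)) (leftObj t)).hom ≫
      f ◁ (leftAppend (cons g s) t).hom) =
      (α_ f (leftObj (cons g s)) (leftObj t)).hom ≫ f ◁ (leftAppend (cons g s) t).hom ≫ 𝟙 _
    simp

theorem leftAppend_eqToHom {a b c : C} {s s' : CSeq (fun a b : C => a ⟶ b) a b}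
    {t t' : CSeq (fun a b : C => a ⟶ b) b c} (h : s = s') (k : t = t') :
    (leftAppend s t).hom ≫ eqToHom (congrArg₂ (fun s t => leftObj (append s t)) h k) =
      eqToHom (congrArg leftObj h) ▷ leftObj t ≫ leftObj s' ◁ eqToHom (congrArg leftObj k) ≫
        (leftAppend s' t').hom := by
  subst h k
  simp

/-- The empty case is the coincidence of the two unitors at an identity 1-cell; the inductive step
is the compatibility of the right unitor with the associator. -/
theorem leftAppend_nil_right {a b : C} (s : CSeq (fun a b : C => a ⟶ b) a b) :
    (leftAppend s (nil b)).hom = leftObj s ◁ (leftNil b).hom ≫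
      (ρ_ (leftObj s)).hom ≫ eqToHom (congrArg leftObj (append_nil s).symm) := by
  induction s with
  | nil a =>
    change (λ_ (𝟙 a)).hom = 𝟙 a ◁ 𝟙 (𝟙 a) ≫ (ρ_ (𝟙 a)).hom ≫ 𝟙 _
    simp [unitors_equal]
  | @cons a b c f s ih =>
    rw [← cancel_epi ((leftCons f s).hom ▷ leftObj (nil c)), leftAppend_cons, ih]
    have h := leftCons_eqToHom f (append_nil s).symm
    simp only [whiskerLeft_comp, Category.assoc]
    rw [← h, ← whisker_exchange_assoc]
    simp

theorem leftAppend_naturality {a b c : C} {s s' : CSeq (fun a b : C => a ⟶ b) a b}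
    {t t' : CSeq (fun a b : C => a ⟶ b) b c} (σ : Hom₂ s s') (τ : Hom₂ t t') :
    leftMap σ ▷ leftObj t ≫ leftObj s' ◁ leftMap τ ≫ (leftAppend s' t').hom =
      (leftAppend s t).hom ≫ leftMap (appendHom σ τ) := by
  induction σ with
  | nil a =>
    change 𝟙 (𝟙 a) ▷ leftObj t ≫ 𝟙 a ◁ leftMap τ ≫ (λ_ (leftObj t')).hom =
      (λ_ (leftObj t)).hom ≫ leftMap τ
    simp
  | @cons a b c f g s s' α σ ih =>
    have h₁ := leftCons_naturality α σ
    have h₂ : _ = _ ≫ leftMap (appendHom (Hom₂.cons α σ) τ) :=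
      leftCons_naturality α (appendHom σ τ)
    have h₄ := congrArg (fun x => g ◁ x) (ih τ)
    simp only [whiskerLeft_comp] at h₄
    rw [← cancel_epi ((leftCons f s).hom ▷ leftObj t), reassoc_of% (leftAppend_cons f s t), ← h₂,
      ← comp_whiskerRight_assoc, ← h₁]
    simp only [comp_whiskerRight, Category.assoc]
    rw [← whisker_exchange_assoc, leftAppend_cons, whisker_exchange_assoc, ← reassoc_of% h₄]
    simp

/-- Induction on the first sequence, where each added arrow costs one pentagon. This is the only
place in the construction of `γ` where the pentagon is used explicitly. -/
theorem leftAppend_assoc {a b c d : C} (s : CSeq (fun a b : C => a ⟶ b) a b)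
    (t : CSeq (fun a b : C => a ⟶ b) b c) (r : CSeq (fun a b : C => a ⟶ b) c d) :
    (leftAppend s t).hom ▷ leftObj r ≫ (leftAppend (append s t) r).hom ≫
        eqToHom (congrArg leftObj (append_assoc s t r)) =
      (α_ (leftObj s) (leftObj t) (leftObj r)).hom ≫ leftObj s ◁ (leftAppend t r).hom ≫
        (leftAppend s (append t r)).hom := by
  induction s with
  | nil a =>
    simp only [leftAppend_nil_left]
    rw [whisker_exchange_assoc]
    change _ ≫ _ ≫ 𝟙 _ = _
    simp
  | cons f s ih =>
    have h := congrArg (fun x => f ◁ x) (ih t)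
    simp only [whiskerLeft_comp] at h
    have e := leftCons_eqToHom f (append_assoc s t r)
    rw [← cancel_epi (((leftCons f s).hom ▷ leftObj t) ▷ leftObj r), ← comp_whiskerRight_assoc,
      leftAppend_cons]
    simp only [comp_whiskerRight, Category.assoc]
    rw [reassoc_of% (leftAppend_cons f (append s t) r), e, associator_naturality_left_assoc,
      ← whisker_exchange_assoc, leftAppend_cons, associator_naturality_middle_assoc,
      reassoc_of% h, pentagon_assoc]
    simp

/-- The image of a double sequence under termwise left-associated composition. -/
abbrev leftRow {a b : C} (D : CSeq (CSeq (fun a b : C => a ⟶ b)) a b) :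
    CSeq (fun a b : C => a ⟶ b) a b :=
  CSeq.map (fun x => x) (fun _ _ s => leftObj s) D

/-- A uniform recursion for `leftγ`. For a one-block double sequence the definition is a bare
transport, and the agreement with the general formula is `leftAppend_nil_right`. -/
theorem leftγ_cons {a b c : C} (s : CSeq (fun a b : C => a ⟶ b) a b)
    (D : CSeq (CSeq (fun a b : C => a ⟶ b)) b c) :
    (leftCons (leftObj s) (leftRow D)).hom ≫ (leftγ (cons s D)).hom =
      leftObj s ◁ (leftγ D).hom ≫ (leftAppend s (flatten D)).hom := by
  cases D with
  | nil _ =>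
    have h := leftAppend_nil_right s
    change _ = leftObj s ◁ 𝟙 (𝟙 b) ≫ (leftAppend s (nil b)).hom
    rw [h]
    refine (congrArg (fun x => x ≫ _) (leftCons_nil (leftObj s))).trans ?_
    change _ = leftObj s ◁ 𝟙 (leftObj (nil b)) ≫ _
    rw [whiskerLeft_id, Category.id_comp]
    exact Category.assoc _ _ _
  | cons t D =>
    change 𝟙 _ ≫ leftObj s ◁ (leftγ (cons t D)).hom ≫
      (leftAppend s (flatten (cons t D))).hom = _
    exact Category.id_comp _

/-- Termwise left-associated composition of a double sequence of 2-cells. -/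
def leftRowMap {a b : C} {D E : CSeq (CSeq (fun a b : C => a ⟶ b)) a b} (σ : Hom₂ D E) :
    Hom₂ (leftRow D) (leftRow E) :=
  mapHom (fun x => x) leftComp σ

theorem leftγ_naturality {a b : C} {D E : CSeq (CSeq (fun a b : C => a ⟶ b)) a b}
    (σ : Hom₂ D E) :
    leftMap (leftRowMap σ) ≫ (leftγ E).hom = (leftγ D).hom ≫ leftMap (flattenHom σ) := by
  induction σ with
  | nil a =>
    change 𝟙 (𝟙 a) ≫ 𝟙 (𝟙 a) = 𝟙 (𝟙 a) ≫ 𝟙 (𝟙 a)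
    rfl
  | @cons a b c s t D E α σ ih =>
    have h₁ : _ = _ ≫ leftMap (leftRowMap (Hom₂.cons α σ)) :=
      leftCons_naturality (leftMap α) (leftRowMap σ)
    have h₂ : _ = _ ≫ leftMap (flattenHom (Hom₂.cons α σ)) :=
      leftAppend_naturality α (flattenHom σ)
    have h₃ := congrArg (fun x => leftObj t ◁ x) ih
    simp only [whiskerLeft_comp] at h₃
    rw [← cancel_epi (leftCons (leftObj s) (leftRow D)).hom, ← reassoc_of% h₁, leftγ_cons,
      reassoc_of% (leftγ_cons s D), ← h₂, reassoc_of% h₃, whisker_exchange_assoc]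

/-- Compatibility of bracket removal with concatenation of double sequences, which is what an
inductive step in the associativity axiom requires. The induction on `D` rebrackets three
concatenated pieces, hence uses `leftAppend_assoc`. -/
theorem leftγ_append {a b c : C} (D : CSeq (CSeq (fun a b : C => a ⟶ b)) a b)
    (E : CSeq (CSeq (fun a b : C => a ⟶ b)) b c) :
    (leftAppend (leftRow D) (leftRow E)).hom ≫
        eqToHom (congrArg leftObj (map_append (fun x => x) _ D E).symm) ≫
          (leftγ (append D E)).hom ≫ eqToHom (congrArg leftObj (flatten_append D E)) =
      (leftγ D).hom ▷ _ ≫ leftObj (flatten D) ◁ (leftγ E).hom ≫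
        (leftAppend (flatten D) (flatten E)).hom := by
  induction D with
  | nil a =>
    change (λ_ (leftObj (leftRow E))).hom ≫ 𝟙 _ ≫ (leftγ E).hom ≫ 𝟙 _ =
      𝟙 (𝟙 a) ▷ _ ≫ 𝟙 a ◁ (leftγ E).hom ≫ (λ_ (leftObj (flatten E))).hom
    simp
  | @cons a b c s D ih =>
    have h := congrArg (fun x => leftObj s ◁ x) (ih E)
    simp only [whiskerLeft_comp] at h
    have h₁ := leftAppend_cons (leftObj s) (leftRow D) (leftRow E)
    have h₂ := leftCons_eqToHom (leftObj s)
      (map_append (fun x => x) (fun _ _ s => leftObj s) D E).symm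
    have h₃ := leftγ_cons s (append D E)
    have h₄ := leftAppend_assoc s (flatten D) (flatten E)
    have h₅ := leftAppend_eqToHom (rfl : s = s) (flatten_append D E)
    have h₆ := congrArg (fun x => x ▷ leftObj (leftRow E)) (leftγ_cons s D)
    simp only [comp_whiskerRight] at h₆
    simp only [eqToHom_refl, id_whiskerRight, Category.id_comp] at h₅
    rw [← cancel_epi ((leftCons (leftObj s) (leftRow D)).hom ▷ leftObj (leftRow E)),
      reassoc_of% h₁, reassoc_of% h₂, reassoc_of% h₃,
      ← cancel_mono (eqToHom (congrArg leftObj (append_assoc s (flatten D) (flatten E))))]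
    simp only [Category.assoc, eqToHom_trans]
    rw [h₅, reassoc_of% h, reassoc_of% h₆, ← whisker_exchange_assoc, h₄]
    simp

/-- The sequence of 2-cells which removes the innermost brackets in each term of a sequence of
double sequences. -/
def leftγCell {a b : C} (T : CSeq (CSeq (CSeq (fun a b : C => a ⟶ b))) a b) :
    Hom₂ (leftRow (CSeq.map (fun x => x) (fun _ _ D => leftRow D) T))
      (leftRow (CSeq.map (fun x => x) (fun _ _ D => flatten D) T)) :=
  mapCell (F := mapFunctor (fun x => x) leftComp) (G := leftComp)
    (H := flattenFunctor (fun a b : C => a ⟶ b)) (K := leftComp) (fun _ _ D => (leftγ D).hom) T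

/-- After one block `D` is split off, both sides concern the concatenation of `D` with `flatten T`,
so `leftγ_append` reduces the claim to the induction hypothesis. -/
theorem leftγ_assoc {a b : C} (T : CSeq (CSeq (CSeq (fun a b : C => a ⟶ b))) a b) :
    leftMap (leftγCell T) ≫ (leftγ (CSeq.map (fun x => x) (fun _ _ D => flatten D) T)).hom ≫
        eqToHom (congrArg leftObj (flatten_map_flatten T)) =
      (leftγ (CSeq.map (fun x => x) (fun _ _ D => leftRow D) T)).hom ≫
        eqToHom (congrArg leftObj (flatten_map_map (fun x => x) _ T)) ≫
          (leftγ (flatten T)).hom := by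
  induction T with
  | nil a =>
    change 𝟙 (𝟙 a) ≫ 𝟙 (𝟙 a) ≫ 𝟙 (𝟙 a) = 𝟙 (𝟙 a) ≫ 𝟙 (𝟙 a) ≫ 𝟙 (𝟙 a)
    rfl
  | @cons a b c D T ih =>
    have h := congrArg (fun x => leftObj (flatten D) ◁ x) ih
    simp only [whiskerLeft_comp] at h
    have h₁ : _ = _ ≫ leftMap (leftγCell (cons D T)) :=
      leftCons_naturality (leftγ D).hom (leftγCell T)
    have h₂ := leftγ_cons (flatten D) (CSeq.map (fun x => x) (fun _ _ D => flatten D) T)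
    have h₃ := leftγ_cons (leftRow D) (CSeq.map (fun x => x) (fun _ _ D => leftRow D) T)
    have h₄ := leftAppend_eqToHom (rfl : flatten D = flatten D) (flatten_map_flatten T)
    have h₅ := leftAppend_eqToHom (rfl : leftRow D = leftRow D)
      (flatten_map_map (fun x => x) (fun _ _ s => leftObj s) T)
    have h₆ := leftγ_append D (flatten T)
    simp only [eqToHom_refl, id_whiskerRight, Category.id_comp] at h₄ h₅
    rw [← cancel_epi (leftCons (leftObj (leftRow D))
      (leftRow (CSeq.map (fun x => x) (fun _ _ D => leftRow D) T))).hom, ← reassoc_of% h₁,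
      reassoc_of% h₂, reassoc_of% h₃,
      ← cancel_mono (eqToHom (congrArg leftObj (flatten_append D (flatten T))))]
    simp only [Category.assoc, eqToHom_trans]
    -- The transport is factored into a change of the second block only, followed by the law for
    -- rows of a concatenation, so that `h₅` and `h₆` apply separately.
    rw [h₄, reassoc_of% h, ← eqToHom_trans (congrArg (fun t => leftObj (append (leftRow D) t))
        (flatten_map_map (fun x => x) (fun _ _ s => leftObj s) T))
      (congrArg leftObj (map_append (fun x => x) (fun _ _ s => leftObj s) D (flatten T)).symm),
      Category.assoc, reassoc_of% h₅, h₆, whisker_exchange_assoc, whisker_exchange_assoc]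

theorem leftRow_map_single {a b : C} (s : CSeq (fun a b : C => a ⟶ b) a b) :
    leftRow (CSeq.map (fun x => x) (fun _ _ f => single f) s) = s := by
  induction s with
  | nil a => rfl
  | cons f s ih => exact congrArg (cons f) ih

/-- `leftAppend (single f)` is `leftCons f` by definition, so the recursion for `leftγ` at one-term
blocks only ever produces `leftCons`, which cancels, and transports. -/
theorem leftγ_map_single {a b : C} (s : CSeq (fun a b : C => a ⟶ b) a b)
    (h : leftObj (leftRow (CSeq.map (fun x => x) (fun _ _ f => single f) s)) = leftObj s) :
    (leftγ (CSeq.map (fun x => x) (fun _ _ f => single f) s)).hom ≫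
      eqToHom (congrArg leftObj (flatten_map_single s)) = eqToHom h := by
  induction s with
  | nil a => exact Category.id_comp _
  | cons f s ih =>
    have h₁ := leftγ_cons (single f) (CSeq.map (fun x => x) (fun _ _ f => single f) s)
    have h₂ := leftCons_eqToHom f (flatten_map_single s)
    have h₃ := leftCons_eqToHom f (leftRow_map_single s)
    have h₄ := congrArg (fun x => f ◁ x) (ih (congrArg leftObj (leftRow_map_single s)))
    simp only [whiskerLeft_comp] at h₄
    refine (cancel_epi (leftCons f
      (leftRow (CSeq.map (fun x => x) (fun _ _ f => single f) s))).hom).mp ?_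
    refine (Category.assoc _ _ _).symm.trans ((congrArg (fun x => x ≫ _) h₁).trans ?_)
    refine (Category.assoc _ _ _).trans ((congrArg (fun x => _ ≫ x) h₂).trans ?_)
    refine (Category.assoc _ _ _).symm.trans ((congrArg (fun x => x ≫ _) h₄).trans ?_)
    exact h₃.symm

/-- The coherence structure on left-associated composition. -/
def leftCoherence (C : Type u) [Bicategory.{w, v} C] :
    UnbiasedCoherence (fun a b : C => (a ⟶ b)) leftComp where
  γ a b := NatIso.ofComponents (fun D => leftγ D) (fun σ => leftγ_naturality σ)
  ι a b := NatIso.ofComponents (fun f => Iso.refl f)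
    (fun σ => (Category.comp_id σ).trans (Category.id_comp σ).symm)
  assoc {a b} T := by
    refine Eq.trans ?_ ((leftγ_assoc T).trans ?_)
    · rw [eqToHom_map]
      rfl
    · rw [eqToHom_map]
      rfl
  map_ι_γ {a b} s := by
    rw [eqToHom_map]
    -- Composing one-term sequences termwise gives back `s`, but only propositionally; hence the
    -- sequence of identities is a transport.
    have cell : ∀ {a b : C} (s : CSeq (fun a b : C => a ⟶ b) a b),
        unitCell (H := singleFunctor (fun a b : C => a ⟶ b)) (K := leftComp)
          (fun _ _ f => 𝟙 f) s = eqToHom (leftRow_map_single s).symm := by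
      intro a b s
      induction s with
      | nil a => rfl
      | cons f s ih =>
        exact (congrArg (consHom (𝟙 f)) ih).trans
          (eqToHom_cons f (leftRow_map_single s).symm _).symm
    have k := leftγ_map_single s (congrArg leftObj (leftRow_map_single s))
    refine (congrArg₂ (fun x y => (leftComp a b).map x ≫ y) (cell s) k).trans ?_
    refine (congrArg (fun x => x ≫ _)
      (eqToHom_map (leftComp a b) (leftRow_map_single s).symm)).trans ?_
    exact eqToHom_trans (congrArg leftObj (leftRow_map_single s).symm)
      (congrArg leftObj (leftRow_map_single s))
  ι_γ s := by
    rw [eqToHom_map]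
    refine (Category.id_comp _).trans ?_
    exact eqToHom_trans (congrArg leftObj (flatten_single s).symm)
      (congrArg leftObj (flatten_single s))

end LeftAssociated

/-! ### Strict recovery of a bicategory from its left-associated composition -/

/-- Bicategory structures with the same 1-cells, 2-cells, identities and composition of 1-cells
are equal if they have the same whiskerings, associators and unitors. -/
theorem bicategory_mk_congr {O : Type u} {cs : CategoryStruct.{v} O}
    {hc : ∀ a b : O, Category.{w} (a ⟶ b)}
    {wl wl' : ∀ {a b c : O} (f : a ⟶ b) {g h : b ⟶ c}, (g ⟶ h) → (f ≫ g ⟶ f ≫ h)}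
    {wr wr' : ∀ {a b c : O} {f g : a ⟶ b} (_ : f ⟶ g) (h : b ⟶ c), f ≫ h ⟶ g ≫ h}
    {as as' : ∀ {a b c d : O} (f : a ⟶ b) (g : b ⟶ c) (h : c ⟶ d), (f ≫ g) ≫ h ≅ f ≫ g ≫ h}
    {lu lu' : ∀ {a b : O} (f : a ⟶ b), 𝟙 a ≫ f ≅ f}
    {ru ru' : ∀ {a b : O} (f : a ⟶ b), f ≫ 𝟙 b ≅ f}
    (hwl : ∀ {a b c : O} (f : a ⟶ b) {g h : b ⟶ c} (η : g ⟶ h), wl f η = wl' f η)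
    (hwr : ∀ {a b c : O} {f g : a ⟶ b} (η : f ⟶ g) (h : b ⟶ c), wr η h = wr' η h)
    (has : ∀ {a b c d : O} (f : a ⟶ b) (g : b ⟶ c) (h : c ⟶ d), (as f g h).hom = (as' f g h).hom)
    (hlu : ∀ {a b : O} (f : a ⟶ b), (lu f).hom = (lu' f).hom)
    (hru : ∀ {a b : O} (f : a ⟶ b), (ru f).hom = (ru' f).hom)
    {p₁ p₂ p₃ p₄ p₅ p₆ p₇ p₈ p₉ p₁₀ p₁₁ p₁₂ q₁ q₂ q₃ q₄ q₅ q₆ q₇ q₈ q₉ q₁₀ q₁₁ q₁₂} :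
    @Bicategory.mk O cs hc @wl @wr @as @lu @ru p₁ p₂ p₃ p₄ p₅ p₆ p₇ p₈ p₉ p₁₀ p₁₁ p₁₂ =
      @Bicategory.mk O cs hc @wl' @wr' @as' @lu' @ru' q₁ q₂ q₃ q₄ q₅ q₆ q₇ q₈ q₉ q₁₀ q₁₁ q₁₂ := by
  obtain rfl : @wl = @wl' := by
    funext a b c f g h η
    exact hwl f η
  obtain rfl : @wr = @wr' := by
    funext a b c f g η h
    exact hwr η h
  obtain rfl : @as = @as' := by
    funext a b c d f g h
    exact Iso.ext (has f g h)
  obtain rfl : @lu = @lu' := by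
    funext a b f
    exact Iso.ext (hlu f)
  obtain rfl : @ru = @ru' := by
    funext a b f
    exact Iso.ext (hru f)
  rfl

/-- The unbiased bicategory obtained from a bicategory by associating to the left. -/
abbrev leftUBicat (C : Bicat.{w, v, u}) : UBicat.{w, v, u} :=
  ⟨C.Obj, fun a b => (a ⟶ b), fun _ _ => inferInstance, leftComp, leftCoherence C.Obj⟩

theorem isLeftAssociated_leftUBicat (C : Bicat.{w, v, u}) : IsLeftAssociated C (leftUBicat C) :=
  ⟨leftCoherence C.Obj, fun _ _ _ => rfl, fun _ _ _ => rfl, rfl⟩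

section

open Bicategory CSeq

/-- Here `f ≫ g ≫ h` is already the left-associated ternary composite, so rebracketing from `(f ≫ g)
≫ h` is one associator; for the same reason `flatR` below is an identity. -/
theorem leftUBicat_flatL (C : Bicat.{w, v, u}) {a b c d : C.Obj} (f : a ⟶ b) (g : b ⟶ c)
    (h : c ⟶ d) : ((leftUBicat C).flatL f g h).hom = (α_ f g h).hom := by
  change (𝟙 (f ≫ g) ▷ h ≫ (f ≫ g) ◁ 𝟙 h) ≫
    ((f ≫ g) ◁ 𝟙 h ≫ ((α_ f g h).hom ≫ f ◁ 𝟙 (g ≫ h))) = (α_ f g h).hom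
  simp

theorem leftUBicat_flatR (C : Bicat.{w, v, u}) {a b c d : C.Obj} (f : a ⟶ b) (g : b ⟶ c)
    (h : c ⟶ d) : (leftUBicat C).flatR f g h = Iso.refl (f ≫ g ≫ h) := by
  apply Iso.ext
  change (𝟙 f ▷ (g ≫ h) ≫ f ◁ 𝟙 (g ≫ h)) ≫ (f ◁ 𝟙 (g ≫ h) ≫ 𝟙 (f ≫ g ≫ h)) = 𝟙 (f ≫ g ≫ h)
  simp

theorem leftUBicat_flatUnitL (C : Bicat.{w, v, u}) {a b : C.Obj} (f : a ⟶ b) :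
    ((leftUBicat C).flatUnitL f).hom = (λ_ f).hom := by
  change (𝟙 (𝟙 a) ▷ f ≫ 𝟙 a ◁ 𝟙 f) ≫ (𝟙 a ◁ 𝟙 f ≫ (λ_ f).hom) = (λ_ f).hom
  simp

theorem leftUBicat_flatUnitR (C : Bicat.{w, v, u}) {a b : C.Obj} (f : a ⟶ b) :
    ((leftUBicat C).flatUnitR f).hom = (ρ_ f).hom := by
  change (𝟙 f ▷ 𝟙 b ≫ f ◁ 𝟙 (𝟙 b)) ≫ (f ◁ 𝟙 (𝟙 b) ≫ (ρ_ f).hom) = (ρ_ f).hom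
  simp

/-- The 1-cells, their identities and their binary composites agree by definition, so only
whiskerings and coherence 2-cells need comparison. The associator becomes `flatL` followed by an
identity, and the unitors are those of `C` because `ι` is an identity. -/
theorem toBicategory_leftUBicat (C : Bicat.{w, v, u}) : (leftUBicat C).toBicategory = C.str := by
  refine bicategory_mk_congr ?_ ?_ ?_ ?_ ?_
  · intro (a : C.Obj) (b : C.Obj) (c : C.Obj) (f : a ⟶ b) (g : b ⟶ c) (h : b ⟶ c) (η : g ⟶ h)
    change 𝟙 f ▷ g ≫ f ◁ η = f ◁ η
    simp
  · intro (a : C.Obj) (b : C.Obj) (c : C.Obj) (f : a ⟶ b) (g : a ⟶ b) (η : f ⟶ g) (h : b ⟶ c)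
    change η ▷ h ≫ g ◁ 𝟙 h = η ▷ h
    simp
  · intro (a : C.Obj) (b : C.Obj) (c : C.Obj) (d : C.Obj) (f : a ⟶ b) (g : b ⟶ c) (h : c ⟶ d)
    change ((leftUBicat C).flatL f g h).hom ≫ ((leftUBicat C).flatR f g h).inv = (α_ f g h).hom
    rw [leftUBicat_flatL, leftUBicat_flatR]
    exact Category.comp_id _
  · intro (a : C.Obj) (b : C.Obj) (f : a ⟶ b)
    exact (congrArg (fun x => x ≫ 𝟙 f) (leftUBicat_flatUnitL C f)).trans (Category.comp_id _)
  · intro (a : C.Obj) (b : C.Obj) (f : a ⟶ b)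
    exact (congrArg (fun x => x ≫ 𝟙 f) (leftUBicat_flatUnitR C f)).trans (Category.comp_id _)

theorem forgetV_obj_leftUBicat (C : Bicat.{w, v, u}) : forgetV.obj (leftUBicat C) = C := by
  have h := toBicategory_leftUBicat C
  change (⟨C.Obj, (leftUBicat C).toBicategory⟩ : Bicat.{w, v, u}) = ⟨C.Obj, C.str⟩
  exact congrArg (Bicat.mk C.Obj) h

end

/-! ### Concatenation in an unbiased bicategory -/

namespace UBicat

open CSeq

variable (B : UBicat.{w, v, u})

/-- Termwise composition of a double sequence. -/
abbrev row {a b : B.Obj} (D : CSeq (CSeq B.Hom) a b) : CSeq B.Hom a b :=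
  (mapFunctor (fun x => x) B.comp a b).obj D

theorem row_append {a b c : B.Obj} (D : CSeq (CSeq B.Hom) a b) (E : CSeq (CSeq B.Hom) b c) :
    B.row (append D E) = append (B.row D) (B.row E) :=
  map_append (fun x => x) _ D E

theorem cmp₂_eqToHom {a b : B.Obj} {s t : CSeq B.Hom a b} (h : s = t) :
    B.cmp₂ (eqToHom h) = eqToHom (congrArg B.cmp h) :=
  eqToHom_map _ _

/-- The isomorphism `((s), (t)) ≅ (s, t)` for the concatenation of two sequences. -/
def appendIso {a b c : B.Obj} (s : CSeq B.Hom a b) (t : CSeq B.Hom b c) :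
    B.cmp (pair (B.cmp s) (B.cmp t)) ≅ B.cmp (append s t) :=
  B.γ (pair s t) ≪≫ eqToIso (congrArg (fun t => B.cmp (append s t)) (append_nil t))

theorem γ_eqToHom {a b : B.Obj} {D E : CSeq (CSeq B.Hom) a b} (h : D = E) :
    (B.γ D).hom ≫ eqToHom (congrArg (fun D => B.cmp (flatten D)) h) =
      eqToHom (congrArg (fun D => B.cmp (B.row D)) h) ≫ (B.γ E).hom := by
  subst h
  simp

theorem appendIso_eqToHom {a b c : B.Obj} {s s' : CSeq B.Hom a b} {t t' : CSeq B.Hom b c}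
    (h : s = s') (k : t = t') :
    (B.appendIso s t).hom ≫ eqToHom (congrArg₂ (fun s t => B.cmp (append s t)) h k) =
      B.cmp₂ (pairHom (eqToHom (congrArg B.cmp h)) (eqToHom (congrArg B.cmp k))) ≫
        (B.appendIso s' t').hom := by
  subst h k
  exact (Category.comp_id _).trans ((congrArg (fun x => x ≫ _) (B.cmp₂_pair_id _ _)).trans
    (Category.id_comp _)).symm

/-- The first identity axiom at the empty sequence, where every other factor is an identity. -/
theorem γ_nil (a : B.Obj) : (B.γ (nil a)).hom = 𝟙 (B.cmp (nil a)) := by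
  have h := B.coh.map_ι_γ (nil a)
  refine Eq.trans ?_ h
  refine Eq.trans ?_ (congrArg (fun x => x ≫ _) ((B.comp a a).map_id (nil a))).symm
  refine Eq.trans ?_ (Category.id_comp _).symm
  exact (Category.comp_id _).symm

theorem ι_γ_single {a b : B.Obj} (s : CSeq B.Hom a b) :
    (B.ι (B.cmp s)).hom ≫ (B.γ (single s)).hom =
      eqToHom (congrArg B.cmp (flatten_single s).symm) := by
  have h := B.coh.ι_γ s
  rw [eqToHom_map, ← Category.assoc] at h
  rw [← cancel_mono (eqToHom (congrArg B.cmp (flatten_single s)))]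
  refine h.trans ?_
  simp

theorem appendIso_naturality {a b c : B.Obj} {s s' : CSeq B.Hom a b} {t t' : CSeq B.Hom b c}
    (σ : s ⟶ s') (τ : t ⟶ t') :
    B.cmp₂ (pairHom (B.cmp₂ σ) (B.cmp₂ τ)) ≫ (B.appendIso s' t').hom =
      (B.appendIso s t).hom ≫ B.cmp₂ (appendHom σ τ) := by
  have h := (B.coh.γ a c).hom.naturality (pairHom σ τ : pair s t ⟶ pair s' t')
  -- Flattening `(s, t)` leaves a spurious empty sequence at the end. Its removal is natural, up to
  -- transport, in the sequence of 2-cells.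
  have k : appendHom σ (appendHom τ (𝟙 (nil c))) ≫ eqToHom (congrArg (append s') (append_nil t')) =
      eqToHom (congrArg (append s) (append_nil t)) ≫ appendHom σ τ := by
    have k₁ : ∀ {a b : B.Obj} {t t' : CSeq B.Hom a b} (τ : Hom₂ t t'),
        appendHom τ (𝟙 (nil b)) ≫ eqToHom (append_nil t') = eqToHom (append_nil t) ≫ τ := by
      intro a b t t' τ
      induction τ with
      | nil a => rfl
      | @cons a b c f g s t α σ ih =>
        rw [eqToHom_cons f (append_nil s), eqToHom_cons g (append_nil t)]
        refine (consHom_comp _ _ _ _).trans (Eq.trans ?_ (consHom_comp _ _ _ _).symm)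
        exact consHom_congr (by simp) ih
    have k₂ : ∀ {a b c : B.Obj} {s s' : CSeq B.Hom a b} (σ : Hom₂ s s')
        {t₀ t₁ t₂ t₃ : CSeq B.Hom b c}
        (h : t₀ = t₁) (h' : t₂ = t₃) (τ : t₀ ⟶ t₂) (τ' : t₁ ⟶ t₃),
        τ ≫ eqToHom h' = eqToHom h ≫ τ' → appendHom σ τ ≫ eqToHom (congrArg (append s') h') =
          eqToHom (congrArg (append s) h) ≫ appendHom σ τ' := by
      intro a b c s s' σ t₀ t₁ t₂ t₃ h h' τ τ' e
      subst h h'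
      simp at e
      simp [e]
    exact k₂ σ _ _ _ _ (k₁ τ)
  have k' := congrArg (fun x => B.cmp₂ x) k
  simp only [Functor.map_comp, eqToHom_map] at k'
  simp only [appendIso, Iso.trans_hom, eqToIso.hom, Category.assoc]
  refine Eq.trans ?_ (congrArg (fun x => _ ≫ x) k')
  refine (Category.assoc _ _ _).symm.trans ((congrArg (fun x => x ≫ _) h).trans ?_)
  exact Category.assoc _ _ _

/-- This is the associativity axiom at the triple sequence with the two terms `D` and `E`. What
remains is to remove the empty sequence that flattening leaves after `E`. -/
theorem γ_append {a b c : B.Obj} (D : CSeq (CSeq B.Hom) a b) (E : CSeq (CSeq B.Hom) b c) :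
    B.cmp₂ (pairHom (B.γ D).hom (B.γ E).hom) ≫ (B.appendIso (flatten D) (flatten E)).hom =
      (B.appendIso (B.row D) (B.row E)).hom ≫ eqToHom (congrArg B.cmp (B.row_append D E).symm) ≫
        (B.γ (append D E)).hom ≫ eqToHom (congrArg B.cmp (flatten_append D E)) := by
  have h := B.coh.assoc (pair D E)
  rw [eqToHom_map, eqToHom_map] at h
  have h' : B.cmp₂ (pairHom (B.γ D).hom (B.γ E).hom) ≫ (B.γ (pair (flatten D) (flatten E))).hom ≫
      eqToHom (congrArg B.cmp (flatten_map_flatten (pair D E))) =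
      (B.γ (pair (B.row D) (B.row E))).hom ≫
        eqToHom (congrArg B.cmp (flatten_map_map (fun x => x) _ (pair D E))) ≫
          (B.γ (append D (append E (nil c)))).hom := h
  have k := B.γ_eqToHom (congrArg (append D) (append_nil E))
  rw [← cancel_mono (eqToHom (congrArg (fun E => B.cmp (flatten (append D E)))
    (append_nil E)))] at h'
  simp only [Category.assoc] at h'
  rw [k] at h'
  simp only [appendIso, Iso.trans_hom, eqToIso.hom, Category.assoc]
  rw [← cancel_mono (eqToHom (congrArg B.cmp (flatten_append D E).symm))]
  simp only [Category.assoc, eqToHom_trans, eqToHom_trans_assoc] at h' ⊢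
  simpa using h'

theorem flatL_eq {a b c d : B.Obj} (f : B.Hom a b) (g : B.Hom b c) (h : B.Hom c d) :
    (B.flatL f g h).hom =
      B.cmp₂ (pairHom (𝟙 _) (B.ι h).hom) ≫ (B.appendIso (pair f g) (single h)).hom :=
  congrArg (fun x => _ ≫ x) (Category.comp_id _).symm

theorem flatR_eq {a b c d : B.Obj} (f : B.Hom a b) (g : B.Hom b c) (h : B.Hom c d) :
    (B.flatR f g h).hom =
      B.cmp₂ (pairHom (B.ι f).hom (𝟙 _)) ≫ (B.appendIso (single f) (pair g h)).hom :=
  congrArg (fun x => _ ≫ x) (Category.comp_id _).symm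

theorem flatUnitL_eq {a b : B.Obj} (f : B.Hom a b) :
    (B.flatUnitL f).hom =
      B.cmp₂ (pairHom (𝟙 _) (B.ι f).hom) ≫ (B.appendIso (nil a) (single f)).hom :=
  congrArg (fun x => _ ≫ x) (Category.comp_id _).symm

theorem flatUnitR_eq {a b : B.Obj} (f : B.Hom a b) :
    (B.flatUnitR f).hom =
      B.cmp₂ (pairHom (B.ι f).hom (𝟙 _)) ≫ (B.appendIso (single f) (nil b)).hom :=
  congrArg (fun x => _ ≫ x) (Category.comp_id _).symm

/-- The removal of the brackets around the last block of a double sequence. -/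
theorem γ_append_single {a b c : B.Obj} (D : CSeq (CSeq B.Hom) a b) (r : CSeq B.Hom b c) :
    B.cmp₂ (pairHom (B.γ D).hom (𝟙 (B.cmp r))) ≫ (B.appendIso (flatten D) r).hom =
      B.cmp₂ (pairHom (𝟙 _) (B.ι (B.cmp r)).hom) ≫
        (B.appendIso (B.row D) (single (B.cmp r))).hom ≫
          eqToHom (congrArg B.cmp (B.row_append D (single r)).symm) ≫
            (B.γ (append D (single r))).hom ≫ eqToHom (congrArg B.cmp
              ((flatten_append D (single r)).trans (congrArg (append (flatten D))
                (flatten_single r)))) := by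
  have h := B.γ_append D (single r)
  have k := B.appendIso_eqToHom (rfl : flatten D = flatten D) (flatten_single r).symm
  rw [← cancel_mono (eqToHom (congrArg (fun t => B.cmp (append (flatten D) t))
    (flatten_single r).symm))]
  simp only [Category.assoc, eqToHom_trans]
  rw [k, ← Category.assoc, cmp₂_pair_comp]
  -- `r` enters as a double sequence with one block. Precomposition with `ι` turns its `γ` into a
  -- transport, by the second identity axiom.
  have h' := congrArg (fun x => B.cmp₂ (pairHom (𝟙 _) (B.ι (B.cmp r)).hom) ≫ x) h
  rw [← Category.assoc, cmp₂_pair_comp, ι_γ_single] at h'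
  simp only [Category.id_comp, eqToHom_refl, Category.comp_id] at h' ⊢
  exact h'

/-- The removal of the brackets around the first block of a double sequence. -/
theorem γ_single_append {a b c : B.Obj} (s : CSeq B.Hom a b) (E : CSeq (CSeq B.Hom) b c) :
    B.cmp₂ (pairHom (𝟙 (B.cmp s)) (B.γ E).hom) ≫ (B.appendIso s (flatten E)).hom =
      B.cmp₂ (pairHom (B.ι (B.cmp s)).hom (𝟙 _)) ≫
        (B.appendIso (single (B.cmp s)) (B.row E)).hom ≫ (B.γ (cons s E)).hom := by
  have h := B.γ_append (single s) E
  have k := B.appendIso_eqToHom (flatten_single s).symm (rfl : flatten E = flatten E)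
  rw [← cancel_mono (eqToHom (congrArg (fun t => B.cmp (append t (flatten E)))
    (flatten_single s).symm))]
  simp only [Category.assoc]
  rw [k, ← Category.assoc, cmp₂_pair_comp]
  have h' := congrArg (fun x => B.cmp₂ (pairHom (B.ι (B.cmp s)).hom (𝟙 _)) ≫ x) h
  rw [← Category.assoc, cmp₂_pair_comp, ι_γ_single] at h'
  simp only [Category.id_comp, eqToHom_refl, Category.comp_id] at h' ⊢
  exact h'

/-- Both bracketings factor through `γ` at the three-block sequence `(s, t, r)`, one preceded by
`flatL` and the other by `flatR`. The associator is by definition the comparison of these two. -/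
theorem appendIso_assoc {a b c d : B.Obj} (s : CSeq B.Hom a b) (t : CSeq B.Hom b c)
    (r : CSeq B.Hom c d) :
    B.cmp₂ (pairHom (B.appendIso s t).hom (𝟙 (B.cmp r))) ≫ (B.appendIso (append s t) r).hom ≫
        eqToHom (congrArg B.cmp (append_assoc s t r)) =
      (B.assocIso (B.cmp s) (B.cmp t) (B.cmp r)).hom ≫
        B.cmp₂ (pairHom (𝟙 (B.cmp s)) (B.appendIso t r).hom) ≫
          (B.appendIso s (append t r)).hom := by
  have hl : B.cmp₂ (pairHom (B.γ (pair s t)).hom (𝟙 (B.cmp r))) ≫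
      (B.appendIso (append s (append t (nil c))) r).hom =
      (B.flatL (B.cmp s) (B.cmp t) (B.cmp r)).hom ≫ (B.γ (cons s (pair t r))).hom ≫
        eqToHom (congrArg B.cmp ((flatten_append (pair s t) (single r)).trans
          (congrArg (append (flatten (pair s t))) (flatten_single r)))) := by
    rw [flatL_eq, Category.assoc]
    refine (B.γ_append_single (pair s t) r).trans ?_
    refine congrArg (fun x => _ ≫ _ ≫ x) ?_
    exact Category.id_comp _
  have hr : B.cmp₂ (pairHom (𝟙 (B.cmp s)) (B.γ (pair t r)).hom) ≫
      (B.appendIso s (append t (append r (nil d)))).hom =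
      (B.flatR (B.cmp s) (B.cmp t) (B.cmp r)).hom ≫ (B.γ (cons s (pair t r))).hom := by
    rw [flatR_eq, Category.assoc]
    exact B.γ_single_append s (pair t r)
  have kl := B.appendIso_eqToHom (congrArg (append s) (append_nil t)) (rfl : r = r)
  have kr := B.appendIso_eqToHom (rfl : s = s) (congrArg (append t) (append_nil r))
  have el : B.cmp₂ (pairHom (B.appendIso s t).hom (𝟙 (B.cmp r))) =
      B.cmp₂ (pairHom (B.γ (pair s t)).hom (𝟙 (B.cmp r))) ≫
        B.cmp₂ (pairHom (eqToHom (congrArg (fun t => B.cmp (append s t)) (append_nil t)))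
          (𝟙 (B.cmp r))) := by
    rw [cmp₂_pair_comp, Category.comp_id]
    rfl
  have er : B.cmp₂ (pairHom (𝟙 (B.cmp s)) (B.appendIso t r).hom) =
      B.cmp₂ (pairHom (𝟙 (B.cmp s)) (B.γ (pair t r)).hom) ≫
        B.cmp₂ (pairHom (𝟙 (B.cmp s))
          (eqToHom (congrArg (fun r => B.cmp (append t r)) (append_nil r)))) := by
    rw [cmp₂_pair_comp, Category.comp_id]
    rfl
  simp only [eqToHom_refl] at kl kr
  rw [el, er]
  simp only [Category.assoc]
  rw [← reassoc_of% kl, ← kr, reassoc_of% hl, reassoc_of% hr]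
  simp [assocIso]

/-- The block `()` contributes nothing since `γ_nil` is an identity, and `γ` at a one-block sequence
is the inverse of `ι` up to transport; together these are the definition of the left unitor. -/
theorem appendIso_nil_left {a b : B.Obj} (t : CSeq B.Hom a b) :
    (B.appendIso (nil a) t).hom = (B.unitLIso (B.cmp t)).hom := by
  have h : B.cmp₂ (pairHom (B.γ (nil a)).hom (𝟙 (B.cmp t))) ≫ (B.appendIso (nil a) t).hom =
      (B.flatUnitL (B.cmp t)).hom ≫ (B.γ (single t)).hom ≫
        eqToHom (congrArg B.cmp (flatten_single t)) := by
    rw [flatUnitL_eq, Category.assoc]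
    refine (B.γ_append_single (nil a) t).trans ?_
    refine congrArg (fun x => _ ≫ _ ≫ x) ?_
    exact Category.id_comp _
  rw [γ_nil] at h
  have k : (B.γ (single t)).hom = (B.ι (B.cmp t)).inv ≫
      eqToHom (congrArg B.cmp (flatten_single t).symm) := by
    rw [← ι_γ_single, Iso.inv_hom_id_assoc]
  rw [k] at h
  refine Eq.trans ?_ (h.trans ?_)
  · exact ((congrArg (fun x => x ≫ _) (B.cmp₂_pair_id _ _)).trans (Category.id_comp _)).symm
  · simp [unitLIso]

/-- The isomorphism `(f, (s)) ≅ (f, s)` for the extension of a sequence by one arrow. -/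
def consIso {a b c : B.Obj} (f : B.Hom a b) (s : CSeq B.Hom b c) :
    B.cmp (pair f (B.cmp s)) ≅ B.cmp (cons f s) :=
  (B.comp a c).mapIso (pairIso (B.ι f) (Iso.refl _)) ≪≫ B.appendIso (single f) s

theorem consIso_hom {a b c : B.Obj} (f : B.Hom a b) (s : CSeq B.Hom b c) :
    (B.consIso f s).hom =
      B.cmp₂ (pairHom (B.ι f).hom (𝟙 (B.cmp s))) ≫ (B.appendIso (single f) s).hom :=
  rfl

theorem consIso_eqToHom {a b c : B.Obj} (f : B.Hom a b) {s t : CSeq B.Hom b c} (h : s = t) :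
    (B.consIso f s).hom ≫ eqToHom (congrArg (fun s => B.cmp (cons f s)) h) =
      B.cmp₂ (pairHom (𝟙 f) (eqToHom (congrArg B.cmp h))) ≫ (B.consIso f t).hom := by
  subst h
  exact (Category.comp_id _).trans ((congrArg (fun x => x ≫ _) (B.cmp₂_pair_id _ _)).trans
    (Category.id_comp _)).symm

theorem consIso_naturality {a b c : B.Obj} {f g : B.Hom a b} {s t : CSeq B.Hom b c}
    (α : f ⟶ g) (σ : s ⟶ t) :
    B.cmp₂ (pairHom α (B.cmp₂ σ)) ≫ (B.consIso g t).hom =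
      (B.consIso f s).hom ≫ B.cmp₂ (consHom α σ) := by
  have h : _ = _ ≫ B.cmp₂ (consHom α σ) := B.appendIso_naturality (singleHom α) σ
  rw [consIso_hom, consIso_hom, Category.assoc, ← h, ← Category.assoc, ← Category.assoc,
    cmp₂_pair_comp, cmp₂_pair_comp, ι_nat, Category.id_comp, Category.comp_id]

/-- The recursion that makes `γ` accessible to induction on the number of blocks: it is generated by
`consIso` and `appendIso`. -/
theorem γ_cons {a b c : B.Obj} (s : CSeq B.Hom a b) (D : CSeq (CSeq B.Hom) b c) :
    (B.consIso (B.cmp s) (B.row D)).hom ≫ (B.γ (cons s D)).hom =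
      B.cmp₂ (pairHom (𝟙 (B.cmp s)) (B.γ D).hom) ≫ (B.appendIso s (flatten D)).hom := by
  rw [γ_single_append, consIso_hom, Category.assoc]

/-- The case of a one-term first block in `appendIso_assoc`, with the `ι` at `f` moved through the
associator by naturality. -/
theorem appendIso_cons {a b c d : B.Obj} (f : B.Hom a b) (s : CSeq B.Hom b c)
    (t : CSeq B.Hom c d) :
    B.cmp₂ (pairHom (B.consIso f s).hom (𝟙 (B.cmp t))) ≫ (B.appendIso (cons f s) t).hom =
      (B.assocIso f (B.cmp s) (B.cmp t)).hom ≫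
        B.cmp₂ (pairHom (𝟙 f) (B.appendIso s t).hom) ≫ (B.consIso f (append s t)).hom := by
  have h : B.cmp₂ (pairHom (B.appendIso (single f) s).hom (𝟙 (B.cmp t))) ≫
      (B.appendIso (cons f s) t).hom = _ :=
    (congrArg (fun x => _ ≫ x) (Category.comp_id _)).symm.trans
      (B.appendIso_assoc (single f) s t)
  have n := B.assocIso_nat (B.ι f).hom (𝟙 (B.cmp s)) (𝟙 (B.cmp t))
  have e : B.cmp₂ (pairHom (B.consIso f s).hom (𝟙 (B.cmp t))) =
      B.cmp₂ (pairHom (B.cmp₂ (pairHom (B.ι f).hom (𝟙 (B.cmp s)))) (𝟙 (B.cmp t))) ≫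
        B.cmp₂ (pairHom (B.appendIso (single f) s).hom (𝟙 (B.cmp t))) := by
    rw [cmp₂_pair_comp, Category.comp_id, consIso_hom]
  rw [e, Category.assoc, h, reassoc_of% n, cmp₂_pair_id, consIso_hom, ← Category.assoc (B.cmp₂ _),
    ← Category.assoc (B.cmp₂ _), cmp₂_pair_comp, cmp₂_pair_comp]
  simp only [Category.id_comp, Category.comp_id]

theorem consIso_nil {a b : B.Obj} (f : B.Hom a b) :
    (B.consIso f (nil b)).hom = (B.unitRIso f).hom ≫ (B.ι f).hom := by
  simp only [unitRIso, Iso.trans_hom, Iso.symm_hom, flatUnitR_eq, Category.assoc, consIso_hom,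
    Iso.inv_hom_id]
  exact congrArg (fun x => _ ≫ x) (Category.comp_id _).symm

/-- The first identity axiom at a two-term sequence. It is what makes the recursion return the given
2-cell in the binary case. -/
theorem consIso_single {a b c : B.Obj} (f : B.Hom a b) (g : B.Hom b c) :
    B.cmp₂ (pairHom (𝟙 f) (B.ι g).hom) ≫ (B.consIso f (single g)).hom = 𝟙 _ := by
  rw [consIso_hom, ← Category.assoc, cmp₂_pair_comp, Category.id_comp, Category.comp_id]
  exact (congrArg (fun x => _ ≫ x) (Category.comp_id _)).trans (B.ι_pair f g)

end UBicat

/-! ### Nullary and binary coherence 2-cells determine all -/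

namespace ULaxFunctor

open CSeq

variable {B : UBicat.{w, v, u}} {C : UBicat.{w', v', u'}}

/-- The axiom for `γ` at the double sequence `((f), s)`, in which the coherence 2-cell at the
one-term sequence `(f)` is eliminated by the axiom for `ι` and naturality. -/
theorem φ_cons (F : ULaxFunctor B C) {a b c : B.Obj} (f : B.Hom a b) (s : CSeq B.Hom b c) :
    (C.consIso ((F.fun₁ a b).obj f) ((mapFunctor F.obj F.fun₁ b c).obj s)).hom ≫
        (F.φ a c).app (cons f s) =
      C.cmp₂ (pairHom (𝟙 _) ((F.φ b c).app s)) ≫ (F.φ a c).app (pair f (B.cmp s)) ≫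
        (F.fun₁ a c).map (B.consIso f s).hom := by
  have h₀ : append (single ((F.fun₁ a b).obj f))
      (append ((mapFunctor F.obj F.fun₁ b c).obj s) (nil (F.obj c))) =
      (mapFunctor F.obj F.fun₁ a c).obj (cons f (append s (nil c))) :=
    flatten_map_map F.obj (fun a b => (F.fun₁ a b).obj) (pair (single f) s)
  have m : C.cmp₂ (pairHom ((F.φ a b).app (single f)) ((F.φ b c).app s)) ≫
      (F.φ a c).app (pair (B.cmp (single f)) (B.cmp s)) ≫
        (F.fun₁ a c).map (B.γ (pair (single f) s)).hom =
      (C.γ (pair (single ((F.fun₁ a b).obj f)) ((mapFunctor F.obj F.fun₁ b c).obj s))).hom ≫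
        C.cmp₂ (eqToHom h₀) ≫
          (F.φ a c).app (cons f (append s (nil c))) :=
    F.map_γ (pair (single f) s)
  have e := F.φ_eq (congrArg (cons f) (append_nil s))
    (congrArg (fun s => (mapFunctor F.obj F.fun₁ a c).obj (cons f s)) (append_nil s))
  rw [UBicat.cmp₂_eqToHom, UBicat.cmp₂_eqToHom] at e
  rw [UBicat.cmp₂_eqToHom] at m
  have n := F.φ_pair_nat (B.ι f).hom (𝟙 (B.cmp s))
  have k := F.map_ι f
  have m' := congrArg (fun x => x ≫ (F.fun₁ a c).map
    (eqToHom (congrArg (fun s => B.cmp (cons f s)) (append_nil s)))) m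
  simp only [Category.assoc] at m'
  rw [e] at m'
  simp only [UBicat.consIso_hom, Functor.map_comp]
  have i : (F.φ b c).app s ≫ 𝟙 ((F.fun₁ b c).obj (B.cmp s)) = (F.φ b c).app s :=
    Category.comp_id _
  rw [← reassoc_of% n, ← Category.assoc (C.cmp₂ _), UBicat.cmp₂_pair_comp,
    CategoryTheory.Functor.map_id, Category.id_comp, ← k, i, Category.assoc]
  have e' : C.cmp₂ (pairHom ((C.ι ((F.fun₁ a b).obj f)).hom ≫ (F.φ a b).app (single f))
      ((F.φ b c).app s)) = C.cmp₂ (pairHom (C.ι ((F.fun₁ a b).obj f)).hom (𝟙 _)) ≫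
        C.cmp₂ (pairHom ((F.φ a b).app (single f)) ((F.φ b c).app s)) := by
    rw [UBicat.cmp₂_pair_comp, Category.id_comp]
  rw [e', Category.assoc]
  refine congrArg (fun x => _ ≫ x) ?_
  simp only [UBicat.appendIso, Iso.trans_hom, eqToIso.hom, Functor.map_comp, Category.assoc]
  rw [m']
  simp

/-- Equality of lax functors unpacks into separate statements on 1-cells and on 2-cells, the latter
heterogeneous; this reassembles them into an equality of families of functors. -/
theorem functor_family_ext {O : Type u} {X : O → O → Type v}
    [∀ a b, Category.{w} (X a b)] {Y : O → O → Type v'} [∀ a b, Category.{w'} (Y a b)]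
    {F G : ∀ a b, X a b ⥤ Y a b}
    (h : (fun a b f => (F a b).obj f) = (fun a b f => (G a b).obj f))
    (h' : HEq (fun a b f g (α : f ⟶ g) => (F a b).map α)
      (fun a b f g (α : f ⟶ g) => (G a b).map α)) : F = G := by
  have key : ∀ {o o' : ∀ a b, X a b → Y a b} {m : ∀ a b f g, (f ⟶ g) → (o a b f ⟶ o a b g)}
      {m' : ∀ a b f g, (f ⟶ g) → (o' a b f ⟶ o' a b g)}
      {p₁ : ∀ a b f, m a b f f (𝟙 f) = 𝟙 (o a b f)}
      {p₂ : ∀ a b {f g h : X a b} (α : f ⟶ g) (β : g ⟶ h),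
        m a b f h (α ≫ β) = m a b f g α ≫ m a b g h β}
      {q₁ : ∀ a b f, m' a b f f (𝟙 f) = 𝟙 (o' a b f)}
      {q₂ : ∀ a b {f g h : X a b} (α : f ⟶ g) (β : g ⟶ h),
        m' a b f h (α ≫ β) = m' a b f g α ≫ m' a b g h β}, o = o' → HEq m m' →
      (fun a b => CategoryTheory.Functor.mk (o a b) (fun {f g} => m a b f g) (p₁ a b) (p₂ a b)) =
        (fun a b => CategoryTheory.Functor.mk (o' a b) (fun {f g} => m' a b f g) (q₁ a b)
          (q₂ a b)) := by
    intro o o' m m' p₁ p₂ q₁ q₂ h h'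
    subst h
    obtain rfl := eq_of_heq h'
    rfl
  exact key (p₁ := fun a b => (F a b).map_id) (p₂ := fun a b => (F a b).map_comp)
    (q₁ := fun a b => (G a b).map_id) (q₂ := fun a b => (G a b).map_comp) h h'

/-- Unbiased lax functors with the same underlying lax functor are equal. -/
theorem toLaxFunctor_injective : Function.Injective (toLaxFunctor (B := B) (C := C)) := by
  intro F G h
  obtain ⟨F₀, F₁, φ, p₁, p₂⟩ := F
  obtain ⟨G₀, G₁, ψ, q₁, q₂⟩ := G
  injection h with h₁ h₂ h₃
  injection h₁ with h₁
  injection h₁ with h₁ h₆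
  injection h₁ with h₁ h₇
  dsimp only at h₁
  subst h₁
  obtain rfl : F₁ = G₁ := functor_family_ext (eq_of_heq h₇) h₆
  refine mk_congr (fun a b s => ?_)
  -- The 2-cells `φ` and `ψ` satisfy the same recursion `φ_cons`, with the same binary 2-cells, and
  -- start from the same nullary ones.
  induction s with
  | nil a => exact congrFun (eq_of_heq h₂) a
  | @cons a b c f s ih =>
    have k := φ_cons ⟨F₀, F₁, φ, p₁, p₂⟩ f s
    have k' := φ_cons ⟨F₀, F₁, ψ, q₁, q₂⟩ f s
    have e : (φ a c).app (pair f (B.cmp s)) = (ψ a c).app (pair f (B.cmp s)) :=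
      congrFun (congrFun (congrFun (congrFun (congrFun (eq_of_heq h₃) a) b) c) f) (B.cmp s)
    dsimp only at k k'
    rw [ih, e, ← k', Iso.cancel_iso_hom_left] at k
    exact k

/-- An unbiased lax functor whose binary and nullary coherence 2-cells are invertible is weak. -/
theorem isIso_φ (F : ULaxFunctor B C) (h₀ : ∀ a, IsIso ((F.φ a a).app (nil a)))
    (h₂ : ∀ (a b c : B.Obj) (f : B.Hom a b) (g : B.Hom b c), IsIso ((F.φ a c).app (pair f g)))
    {a b : B.Obj} (s : CSeq B.Hom a b) : IsIso ((F.φ a b).app s) := by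
  induction s with
  | nil a => exact h₀ a
  | @cons a b c f s ih =>
    have i₁ : IsIso (C.cmp₂ (pairHom (𝟙 ((F.fun₁ a b).obj f)) ((F.φ b c).app s))) :=
      ((C.comp _ _).mapIso (pairIso (Iso.refl _) (asIso ((F.φ b c).app s)))).isIso_hom
    have i₂ := h₂ a b c f (B.cmp s)
    -- Solving the recursion for the 2-cell at `(f, s)` displays it as a composite of invertible
    -- 2-cells.
    have h := F.φ_cons f s
    rw [← Iso.eq_inv_comp] at h
    rw [h]
    infer_instance

end ULaxFunctor

/-! ### Extension of a lax functor to all arities -/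

/-- The data of a lax functor between the bicategories underlying two unbiased bicategories,
expressed by their unbiased composition. -/
structure BinaryLaxFunctor (B : UBicat.{w, v, u}) (C : UBicat.{w', v', u'}) where
  /-- The function on objects. -/
  obj : B.Obj → C.Obj
  /-- The functors on hom-categories. -/
  fun₁ (a b : B.Obj) : B.Hom a b ⥤ C.Hom (obj a) (obj b)
  /-- The nullary coherence 2-cells. -/
  unit (a : B.Obj) : C.cmp (CSeq.nil (obj a)) ⟶ (fun₁ a a).obj (B.cmp (CSeq.nil a))
  /-- The binary coherence 2-cells. -/
  mul {a b c : B.Obj} (f : B.Hom a b) (g : B.Hom b c) :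
    C.cmp (CSeq.pair ((fun₁ a b).obj f) ((fun₁ b c).obj g)) ⟶
      (fun₁ a c).obj (B.cmp (CSeq.pair f g))
  mul_naturality {a b c : B.Obj} {f f' : B.Hom a b} {g g' : B.Hom b c} (α : f ⟶ f')
    (β : g ⟶ g') :
    C.cmp₂ (CSeq.pairHom ((fun₁ a b).map α) ((fun₁ b c).map β)) ≫ mul f' g' =
      mul f g ≫ (fun₁ a c).map (B.cmp₂ (CSeq.pairHom α β))
  mul_assoc {a b c d : B.Obj} (f : B.Hom a b) (g : B.Hom b c) (h : B.Hom c d) :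
    C.cmp₂ (CSeq.pairHom (mul f g) (𝟙 ((fun₁ c d).obj h))) ≫ mul (B.cmp (CSeq.pair f g)) h ≫
        (fun₁ a d).map (B.assocIso f g h).hom =
      (C.assocIso ((fun₁ a b).obj f) ((fun₁ b c).obj g) ((fun₁ c d).obj h)).hom ≫
        C.cmp₂ (CSeq.pairHom (𝟙 ((fun₁ a b).obj f)) (mul g h)) ≫ mul f (B.cmp (CSeq.pair g h))
  unit_mul {a b : B.Obj} (f : B.Hom a b) :
    C.cmp₂ (CSeq.pairHom (unit a) (𝟙 ((fun₁ a b).obj f))) ≫ mul (B.cmp (CSeq.nil a)) f ≫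
      (fun₁ a b).map (B.unitLIso f).hom = (C.unitLIso ((fun₁ a b).obj f)).hom
  mul_unit {a b : B.Obj} (f : B.Hom a b) :
    C.cmp₂ (CSeq.pairHom (𝟙 ((fun₁ a b).obj f)) (unit b)) ≫ mul f (B.cmp (CSeq.nil b)) ≫
      (fun₁ a b).map (B.unitRIso f).hom = (C.unitRIso ((fun₁ a b).obj f)).hom

namespace BinaryLaxFunctor

open CSeq

variable {B : UBicat.{w, v, u}} {C : UBicat.{w', v', u'}} (F : BinaryLaxFunctor B C)

/-- Termwise application to a sequence. -/
abbrev seq {a b : B.Obj} (s : CSeq B.Hom a b) : CSeq C.Hom (F.obj a) (F.obj b) :=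
  (mapFunctor F.obj F.fun₁ a b).obj s

/-- The coherence 2-cell at a sequence, built from the nullary and binary ones. -/
def φ : ∀ {a b : B.Obj} (s : CSeq B.Hom a b), C.cmp (F.seq s) ⟶ (F.fun₁ a b).obj (B.cmp s)
  | _, _, nil a => F.unit a
  | _, _, cons (a := a) (b := b) (c := c) f s =>
      (C.consIso ((F.fun₁ a b).obj f) (F.seq s)).inv ≫
        C.cmp₂ (pairHom (𝟙 ((F.fun₁ a b).obj f)) (φ s)) ≫ F.mul f (B.cmp s) ≫
          (F.fun₁ a c).map (B.consIso f s).hom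

theorem φ_cons {a b c : B.Obj} (f : B.Hom a b) (s : CSeq B.Hom b c) :
    (C.consIso ((F.fun₁ a b).obj f) (F.seq s)).hom ≫ F.φ (cons f s) =
      C.cmp₂ (pairHom (𝟙 ((F.fun₁ a b).obj f)) (F.φ s)) ≫ F.mul f (B.cmp s) ≫
        (F.fun₁ a c).map (B.consIso f s).hom := by
  rw [← Iso.eq_inv_comp, φ]

theorem φ_naturality {a b : B.Obj} {s t : CSeq B.Hom a b} (σ : Hom₂ s t) :
    C.cmp₂ (mapHom F.obj F.fun₁ σ) ≫ F.φ t = F.φ s ≫ (F.fun₁ a b).map (B.cmp₂ σ) := by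
  induction σ with
  | nil a =>
    have h₁ : C.cmp₂ (mapHom F.obj F.fun₁ (Hom₂.nil a)) = 𝟙 (C.cmp (F.seq (nil a))) :=
      (C.comp _ _).map_id _
    have h₂ : B.cmp₂ (Hom₂.nil a) = 𝟙 (B.cmp (nil a)) := (B.comp _ _).map_id _
    rw [h₁, h₂]
    simp
  | @cons a b c f g s t α σ ih =>
    have h₁ := C.consIso_naturality ((F.fun₁ a b).map α) (mapHom F.obj F.fun₁ σ)
    have h₂ := congrArg (fun x => (F.fun₁ a c).map x) (B.consIso_naturality α σ)
    simp only [Functor.map_comp] at h₂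
    have h₃ := F.mul_naturality α (B.cmp₂ σ)
    rw [← cancel_epi (C.consIso ((F.fun₁ a b).obj f) (F.seq s)).hom, reassoc_of% (F.φ_cons f s)]
    refine (Category.assoc _ _ _).symm.trans ((congrArg (fun x => x ≫ _) h₁.symm).trans ?_)
    rw [Category.assoc, F.φ_cons g t]
    refine Eq.trans ?_ (congrArg (fun x => _ ≫ _ ≫ x) h₂)
    rw [← reassoc_of% h₃, ← Category.assoc (C.cmp₂ _), ← Category.assoc (C.cmp₂ _),
      UBicat.cmp₂_pair_comp, UBicat.cmp₂_pair_comp, ih]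
    simp only [Category.id_comp, Category.comp_id]

/-- The heart of fullness. The recursion defining `φ` only adds one arrow in front, whereas the
axiom for `γ` concatenates whole blocks. Induction on `s` bridges the gap: the left unit axiom
settles the empty case, and the associativity axiom moves one arrow out of the first block. -/
theorem φ_append {a b c : B.Obj} (s : CSeq B.Hom a b) (t : CSeq B.Hom b c) :
    C.cmp₂ (pairHom (F.φ s) (F.φ t)) ≫ F.mul (B.cmp s) (B.cmp t) ≫
        (F.fun₁ a c).map (B.appendIso s t).hom =
      (C.appendIso (F.seq s) (F.seq t)).hom ≫
        eqToHom (congrArg C.cmp (map_append F.obj _ s t).symm) ≫ F.φ (append s t) := by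
  induction s with
  | nil a =>
    have h₁ : C.cmp₂ (pairHom (F.φ (nil a)) (F.φ t)) =
        C.cmp₂ (pairHom (𝟙 _) (F.φ t)) ≫ C.cmp₂ (pairHom (F.unit a) (𝟙 _)) := by
      rw [UBicat.cmp₂_pair_comp, Category.id_comp, Category.comp_id]
      rfl
    rw [UBicat.appendIso_nil_left, UBicat.appendIso_nil_left, h₁, Category.assoc, F.unit_mul,
      UBicat.unitLIso_nat]
    exact congrArg (fun x => _ ≫ x) (Category.id_comp _).symm
  | @cons a b c f s ih =>
    have h₁ := congrArg (fun x => (F.fun₁ _ _).map x) (B.appendIso_cons f s t)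
    have h₂ := C.appendIso_cons ((F.fun₁ a b).obj f) (F.seq s) (F.seq t)
    have h₃ := F.mul_naturality (B.consIso f s).hom (𝟙 (B.cmp t))
    have h₄ := F.mul_assoc f (B.cmp s) (B.cmp t)
    have h₅ := F.mul_naturality (𝟙 f) (B.appendIso s t).hom
    have h₆ := F.φ_cons f (append s t)
    have h₇ := C.consIso_eqToHom ((F.fun₁ a b).obj f)
      (map_append F.obj (fun a b => (F.fun₁ a b).obj) s t).symm
    have h₈ := C.assocIso_nat (𝟙 ((F.fun₁ a b).obj f)) (F.φ s) (F.φ t)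
    simp only [Functor.map_comp] at h₁
    have i₁ : IsIso (C.cmp₂ (pairHom (C.consIso ((F.fun₁ a b).obj f) (F.seq s)).hom
        (𝟙 (C.cmp (F.seq t))))) :=
      ((C.comp _ _).mapIso (pairIso (C.consIso ((F.fun₁ a b).obj f) (F.seq s))
        (Iso.refl _))).isIso_hom
    -- Precomposing with this isomorphism exposes the recursion for `φ` on the left and for
    -- `appendIso` on the right.
    rw [← cancel_epi (C.cmp₂ (pairHom (C.consIso ((F.fun₁ a b).obj f) (F.seq s)).hom
        (𝟙 (C.cmp (F.seq t)))))]
    have l : C.cmp₂ (pairHom (C.consIso ((F.fun₁ a b).obj f) (F.seq s)).hom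
        (𝟙 (C.cmp (F.seq t)))) ≫ C.cmp₂ (pairHom (F.φ (cons f s)) (F.φ t)) =
        C.cmp₂ (pairHom (C.cmp₂ (pairHom (𝟙 ((F.fun₁ a b).obj f)) (F.φ s))) (F.φ t)) ≫
          C.cmp₂ (pairHom (F.mul f (B.cmp s)) (𝟙 _)) ≫
            C.cmp₂ (pairHom ((F.fun₁ _ _).map (B.consIso f s).hom)
              ((F.fun₁ _ _).map (𝟙 (B.cmp t)))) := by
      simp only [UBicat.cmp₂_pair_comp]
      rw [F.φ_cons f s]
      simp
    rw [reassoc_of% l, reassoc_of% h₃, h₁, reassoc_of% h₄, reassoc_of% h₈, ← reassoc_of% h₅]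
    have r : C.cmp₂ (pairHom (𝟙 ((F.fun₁ a b).obj f)) (C.cmp₂ (pairHom (F.φ s) (F.φ t)))) ≫
        C.cmp₂ (pairHom (𝟙 ((F.fun₁ a b).obj f)) (F.mul (B.cmp s) (B.cmp t))) ≫
          C.cmp₂ (pairHom ((F.fun₁ _ _).map (𝟙 f)) ((F.fun₁ _ _).map (B.appendIso s t).hom)) =
        C.cmp₂ (pairHom (𝟙 ((F.fun₁ a b).obj f)) (C.appendIso (F.seq s) (F.seq t)).hom) ≫
          C.cmp₂ (pairHom (𝟙 ((F.fun₁ a b).obj f))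
            (eqToHom (congrArg C.cmp (map_append F.obj _ s t).symm))) ≫
              C.cmp₂ (pairHom (𝟙 ((F.fun₁ a b).obj f)) (F.φ (append s t))) := by
      simp only [UBicat.cmp₂_pair_comp]
      rw [ih t]
      simp
    rw [reassoc_of% r, ← h₆, reassoc_of% h₂, ← reassoc_of% h₇]

/-- The sequence of coherence 2-cells attached to a double sequence. -/
def φCell {a b : B.Obj} : ∀ D : CSeq (CSeq B.Hom) a b,
    C.row ((mapFunctor F.obj (mapFunctor F.obj F.fun₁) a b).obj D) ⟶ F.seq (B.row D) :=
  mapCell (F := mapFunctor F.obj F.fun₁) (G := C.comp) (H := B.comp) (K := F.fun₁)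
    (fun _ _ s => F.φ s)

/-- Induction on the number of blocks: `UBicat.γ_cons` in source and target splits off the first
block, and `φ_append` handles its concatenation with the flattened remainder. -/
theorem φ_γ {a b : B.Obj} (D : CSeq (CSeq B.Hom) a b) :
    C.cmp₂ (F.φCell D) ≫ F.φ (B.row D) ≫ (F.fun₁ a b).map (B.γ D).hom =
      (C.γ ((mapFunctor F.obj (mapFunctor F.obj F.fun₁) a b).obj D)).hom ≫
        eqToHom (congrArg C.cmp (flatten_map_map F.obj (fun a b => (F.fun₁ a b).obj) D)) ≫
          F.φ (flatten D) := by
  induction D with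
  | nil a =>
    have h₁ : C.cmp₂ (F.φCell (nil a)) = 𝟙 (C.cmp (nil (F.obj a))) := (C.comp _ _).map_id _
    have h₂ : (F.fun₁ a a).map (B.γ (nil a)).hom = 𝟙 _ := by
      rw [UBicat.γ_nil]
      exact (F.fun₁ a a).map_id _
    have h₃ := C.γ_nil (F.obj a)
    refine (congrArg₂ (fun x y => x ≫ _ ≫ y) h₁ h₂).trans
      (Eq.trans ?_ (congrArg (fun x => x ≫ _) h₃).symm)
    refine congrArg (fun x => _ ≫ x) ?_
    exact (Category.comp_id _).trans (Category.id_comp _).symm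
  | @cons a b c s D ih =>
    have h₁ : _ = _ ≫ C.cmp₂ (F.φCell (cons s D)) := C.consIso_naturality (F.φ s) (F.φCell D)
    have h₂ := F.φ_cons (B.cmp s) (B.row D)
    have h₃ := congrArg (fun x => (F.fun₁ _ _).map x) (B.γ_cons s D)
    simp only [Functor.map_comp] at h₃
    have h₄ := F.mul_naturality (𝟙 (B.cmp s)) (B.γ D).hom
    have h₅ := F.φ_append s (flatten D)
    have h₆ := C.γ_cons (F.seq s) ((mapFunctor F.obj (mapFunctor F.obj F.fun₁) b c).obj D)
    have h₇ := C.appendIso_eqToHom (rfl : F.seq s = F.seq s)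
      (flatten_map_map F.obj (fun a b => (F.fun₁ a b).obj) D)
    have l : C.cmp₂ (pairHom (F.φ s) (C.cmp₂ (F.φCell D))) ≫
        C.cmp₂ (pairHom (𝟙 _) (F.φ (B.row D))) ≫
          C.cmp₂ (pairHom ((F.fun₁ _ _).map (𝟙 (B.cmp s))) ((F.fun₁ _ _).map (B.γ D).hom)) =
        C.cmp₂ (pairHom (𝟙 _)
          (C.γ ((mapFunctor F.obj (mapFunctor F.obj F.fun₁) b c).obj D)).hom) ≫
          C.cmp₂ (pairHom (eqToHom rfl) (eqToHom (congrArg C.cmp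
            (flatten_map_map F.obj (fun a b => (F.fun₁ a b).obj) D)))) ≫
              C.cmp₂ (pairHom (F.φ s) (F.φ (flatten D))) := by
      simp only [UBicat.cmp₂_pair_comp]
      rw [ih]
      simp
    refine (cancel_epi (C.consIso (C.cmp (F.seq s))
      (C.row ((mapFunctor F.obj (mapFunctor F.obj F.fun₁) b c).obj D))).hom).mp ?_
    refine (Category.assoc _ _ _).symm.trans ((congrArg (fun x => x ≫ _) h₁.symm).trans ?_)
    refine Eq.trans ?_ ((congrArg (fun x => x ≫ _) h₆).symm.trans (Category.assoc _ _ _))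
    simp only [Category.assoc]
    rw [reassoc_of% h₂, h₃, ← reassoc_of% h₄, reassoc_of% l, h₅, ← reassoc_of% h₇]
    simp

/-- Since `(f)` is `f` prefixed to the empty sequence, this is the right unit axiom, read through
the description of `consIso` at the empty sequence as a unitor followed by `ι`. -/
theorem φ_single {a b : B.Obj} (f : B.Hom a b) :
    (C.ι ((F.fun₁ a b).obj f)).hom ≫ F.φ (single f) = (F.fun₁ a b).map (B.ι f).hom := by
  have h := F.φ_cons f (nil b)
  have k : (F.fun₁ a b).map (B.consIso f (nil b)).hom =
      (F.fun₁ a b).map (B.unitRIso f).hom ≫ (F.fun₁ a b).map (B.ι f).hom := by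
    rw [UBicat.consIso_nil, Functor.map_comp]
  rw [k] at h
  have h' := h.trans ((congrArg (fun x => _ ≫ x) (Category.assoc _ _ _)).symm.trans
    ((Category.assoc _ _ _).symm.trans (congrArg (fun x => x ≫ _) (F.mul_unit f))))
  rw [← cancel_epi (C.unitRIso ((F.fun₁ a b).obj f)).hom]
  refine Eq.trans ?_ h'
  exact (Category.assoc _ _ _).symm.trans
    (congrArg (fun x => x ≫ _) (C.consIso_nil ((F.fun₁ a b).obj f)).symm)

/-- The recursion passes through the one-term composite `(g)`. Precomposing with `ι` at `g` removes
this detour: `φ_single` and naturality of `mul` carry `ι` across, and `consIso_single` cancels it in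
both source and target. -/
theorem φ_pair {a b c : B.Obj} (f : B.Hom a b) (g : B.Hom b c) : F.φ (pair f g) = F.mul f g := by
  have h := F.φ_cons f (single g)
  have k := C.consIso_single ((F.fun₁ a b).obj f) ((F.fun₁ b c).obj g)
  have k' := congrArg (fun x => (F.fun₁ a c).map x) (B.consIso_single f g)
  simp only [Functor.map_comp, CategoryTheory.Functor.map_id] at k'
  have n := F.mul_naturality (𝟙 f) (B.ι g).hom
  have h' := congrArg (fun x => C.cmp₂ (pairHom (𝟙 ((F.fun₁ a b).obj f))
    (C.ι ((F.fun₁ b c).obj g)).hom) ≫ x) h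
  rw [← Category.assoc, ← Category.assoc (C.cmp₂ _), UBicat.cmp₂_pair_comp, F.φ_single] at h'
  refine ((Category.id_comp _).symm.trans (congrArg (fun x => x ≫ _) k.symm)).trans (h'.trans ?_)
  rw [CategoryTheory.Functor.map_id] at n
  rw [Category.id_comp, reassoc_of% n, k', Category.comp_id]

/-- The unbiased lax functor with given nullary and binary coherence 2-cells. -/
def lift : ULaxFunctor B C where
  obj := F.obj
  fun₁ := F.fun₁
  φ a b := { app := fun s => F.φ s, naturality := fun _ _ σ => F.φ_naturality σ }
  map_γ {a b} D := by
    rw [UBicat.cmp₂_eqToHom]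
    exact F.φ_γ D
  map_ι f := F.φ_single f

/-- The data of a lax functor, expressed by unbiased composition. -/
def ofLaxFunctor (F : @LaxFunctor B.Obj B.toBicategory C.Obj C.toBicategory) :
    BinaryLaxFunctor B C :=
  letI := B.toBicategory
  letI := C.toBicategory
  { obj := F.obj
    fun₁ := fun a b =>
      { obj := fun f => F.map f
        map := fun α => F.map₂ α
        map_id := fun f => F.map₂_id f
        map_comp := fun α β => F.map₂_comp α β }
    unit := fun a => F.mapId a
    mul := fun f g => F.mapComp f g
    mul_naturality := fun {a b c f f' g g'} α β => by
      -- Naturality is given in each variable separately; a pair of 2-cells is the composite of its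
      -- two whiskered halves.
      have h₁ := F.mapComp_naturality_left α g
      have h₂ := F.mapComp_naturality_right f' β
      have e₁ : C.cmp₂ (pairHom (F.map₂ α) (F.map₂ β)) =
          C.cmp₂ (pairHom (F.map₂ α) (𝟙 (F.map g))) ≫
            C.cmp₂ (pairHom (𝟙 (F.map f')) (F.map₂ β)) := by
        rw [UBicat.cmp₂_pair_comp, Category.id_comp, Category.comp_id]
      have e₂ : B.cmp₂ (pairHom α β) =
          B.cmp₂ (pairHom α (𝟙 g)) ≫ B.cmp₂ (pairHom (𝟙 f') β) := by
        rw [UBicat.cmp₂_pair_comp, Category.id_comp, Category.comp_id]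
      have e₃ : F.map₂ (B.cmp₂ (pairHom α β)) = F.map₂ (B.cmp₂ (pairHom α (𝟙 g))) ≫
          F.map₂ (B.cmp₂ (pairHom (𝟙 f') β)) :=
        (congrArg (fun x => F.map₂ x) e₂).trans (F.map₂_comp _ _)
      refine (congrArg (fun x => x ≫ _) e₁).trans
        (Eq.trans ?_ (congrArg (fun x => _ ≫ x) e₃).symm)
      refine (Category.assoc _ _ _).trans ((congrArg (fun x => _ ≫ x) h₂.symm).trans ?_)
      refine (Category.assoc _ _ _).symm.trans ((congrArg (fun x => x ≫ _) h₁.symm).trans ?_)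
      exact Category.assoc _ _ _
    mul_assoc := fun f g h => F.map₂_associator f g h
    unit_mul := fun f => (F.map₂_leftUnitor_hom f).symm
    mul_unit := fun f => (F.map₂_rightUnitor_hom f).symm }

theorem toLaxFunctor_lift_ofLaxFunctor
    (F : @LaxFunctor B.Obj B.toBicategory C.Obj C.toBicategory) :
    (ofLaxFunctor F).lift.toLaxFunctor = F := by
  let := B.toBicategory
  let := C.toBicategory
  exact laxFunctor_mk_congr (F := F.toPrelaxFunctor) (fun a => rfl)
    (fun f g => (ofLaxFunctor F).φ_pair f g)

end BinaryLaxFunctor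

theorem forgetV_full : (forgetV.{w, v, u}).Full :=
  ⟨fun F => ⟨(BinaryLaxFunctor.ofLaxFunctor F).lift,
    BinaryLaxFunctor.toLaxFunctor_lift_ofLaxFunctor F⟩⟩

theorem forgetV_faithful : (forgetV.{w, v, u}).Faithful :=
  ⟨fun h => ULaxFunctor.toLaxFunctor_injective h⟩

theorem isWeak_of_forgetV_map {B C : UBicat.{w, v, u}} (F : B ⟶ C)
    (h : Bicat.isWeak (forgetV.map F)) : UBicat.isWeak F := fun _ _ s =>
  ULaxFunctor.isIso_φ F (fun a => h.1 a) (fun a b c f g => h.2 a b c f g) s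

/-! ### Sections of full and faithful functors, and wide subcategories -/

section

variable {C : Type u} [Category.{v} C] {D : Type u'} [Category.{v'} D]

/-- A section, on objects, of a full and faithful functor extends to a functor. -/
noncomputable def sectionFunctor (V : C ⥤ D) [V.Full] [V.Faithful] (L : D → C)
    (h : ∀ X, V.obj (L X) = X) : D ⥤ C where
  obj X := L X
  map {X Y} f := V.preimage (eqToHom (h X) ≫ f ≫ eqToHom (h Y).symm)
  map_id X := V.map_injective (by simp)
  map_comp f g := V.map_injective (by simp)

theorem sectionFunctor_comp (V : C ⥤ D) [V.Full] [V.Faithful] (L : D → C)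
    (h : ∀ X, V.obj (L X) = X) : sectionFunctor V L h ⋙ V = 𝟭 D :=
  CategoryTheory.Functor.ext h (fun _ _ _ => V.map_preimage _)

/-- The section of a full and faithful functor is also a quasi-inverse on the other side. -/
noncomputable def compSectionFunctorIso (V : C ⥤ D) [V.Full] [V.Faithful] (L : D → C)
    (h : ∀ X, V.obj (L X) = X) : V ⋙ sectionFunctor V L h ≅ 𝟭 C :=
  NatIso.ofComponents (fun X => V.preimageIso (eqToIso (h (V.obj X))))
    (fun {X Y} f => by
      apply V.map_injective
      change V.map (V.preimage _ ≫ V.preimage (eqToHom (h (V.obj Y)))) =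
        V.map (V.preimage (eqToHom (h (V.obj X))) ≫ f)
      rw [V.map_comp, V.map_comp, V.map_preimage, V.map_preimage, V.map_preimage]
      simp)

theorem isEquivalence_of_surjective (V : C ⥤ D) [V.Full] [V.Faithful]
    (h : Function.Surjective V.obj) : V.IsEquivalence :=
  { essSurj := ⟨fun X => ⟨(h X).choose, ⟨eqToIso (h X).choose_spec⟩⟩⟩ }

variable {P : MorphismProperty C} {Q : MorphismProperty D} [P.IsMultiplicative]
  [Q.IsMultiplicative]

theorem wideRestrict_faithful (V : C ⥤ D) [V.Faithful]
    (h : ∀ {X Y : C} (f : X ⟶ Y), P f → Q (V.map f)) :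
    (wideRestrict (P := P) (Q := Q) V h).Faithful :=
  ⟨fun {_ _ f g} e => by
    ext
    exact V.map_injective (congrArg (fun x => x.hom) e)⟩

/-- A preimage under `V` lies in the wide subcategory only if `V` reflects the property; this is
`h'`. It is the hypothesis that fails for strict functors. -/
theorem wideRestrict_full (V : C ⥤ D) [V.Full]
    (h : ∀ {X Y : C} (f : X ⟶ Y), P f → Q (V.map f))
    (h' : ∀ {X Y : C} (f : X ⟶ Y), Q (V.map f) → P f) :
    (wideRestrict (P := P) (Q := Q) V h).Full :=
  ⟨fun {X Y} f => by
    obtain ⟨g, hg⟩ := V.map_surjective f.hom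
    refine ⟨⟨g, h' g (hg ▸ f.property)⟩, ?_⟩
    ext
    exact hg⟩

theorem wideRestrict_surjective (V : C ⥤ D) (hV : Function.Surjective V.obj)
    (h : ∀ {X Y : C} (f : X ⟶ Y), P f → Q (V.map f)) :
    Function.Surjective (wideRestrict (P := P) (Q := Q) V h).obj := fun X => by
  obtain ⟨Y, hY⟩ := hV X.obj
  exact ⟨⟨Y⟩, congrArg WideSubcategory.mk hY⟩

theorem eqToHom_mem {X Y : C} (h : X = Y) : P (eqToHom h) := by
  subst h
  exact P.id_mem X

theorem wideSubcategory_eqToHom_hom {X Y : WideSubcategory P} (h : X = Y) :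
    (eqToHom h).hom = eqToHom (congrArg (fun X => X.obj) h) := by
  subst h
  rfl

end

/-! ### Failure of fullness for strict functors -/

section

open CSeq

/-- Two uniquely isomorphic objects. -/
def TwoObjects : Type v := ULift.{v} Bool

instance : Category.{w} TwoObjects.{v} where
  Hom _ _ := PUnit.{w + 1}
  id _ := ⟨⟩
  comp _ _ := ⟨⟩

/-- The unbiased bicategory with one 0-cell and two uniquely isomorphic 1-cells in which the
composites of sequences of 1-cells are chosen by `k`. -/
@[reducible] def chosenCompositesUBicat
    (k : ∀ {a b : PUnit.{u + 1}}, CSeq (fun _ _ : PUnit.{u + 1} => TwoObjects.{v}) a b → Bool) :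
    UBicat.{w, v, u} where
  Obj := PUnit.{u + 1}
  Hom _ _ := TwoObjects.{v}
  homCat _ _ := inferInstance
  comp _ _ := { obj := fun s => ⟨k s⟩, map := fun _ => ⟨⟩ }
  coh :=
    { γ := fun _ _ => NatIso.ofComponents (fun _ => ⟨⟨⟩, ⟨⟩, rfl, rfl⟩) (fun _ => rfl)
      ι := fun _ _ => NatIso.ofComponents (fun _ => ⟨⟨⟩, ⟨⟩, rfl, rfl⟩) (fun _ => rfl)
      assoc := fun _ => rfl
      map_ι_γ := fun _ => rfl
      ι_γ := fun _ => rfl }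

/-- Whether a sequence has at least three terms. -/
def hasThreeTerms {a b : PUnit.{u + 1}} :
    CSeq (fun _ _ : PUnit.{u + 1} => TwoObjects.{v}) a b → Bool
  | cons _ (cons _ (cons _ _)) => true
  | _ => false

/-- The identity on 0-, 1- and 2-cells, between two choices of composites. -/
def changeOfComposites
    (k k' : ∀ {a b : PUnit.{u + 1}}, CSeq (fun _ _ : PUnit.{u + 1} => TwoObjects.{v}) a b → Bool) :
    chosenCompositesUBicat.{w, v, u} k ⟶ chosenCompositesUBicat.{w, v, u} k' :=
  show ULaxFunctor _ _ from
  { obj := fun a => a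
    fun₁ := fun _ _ => 𝟭 TwoObjects.{v}
    φ := fun _ _ => { app := fun _ => ⟨⟩ }
    map_γ := fun _ => rfl
    map_ι := fun _ => rfl }

theorem forgetVstr_not_full : ¬ (forgetVstr.{w, v, u}).Full := by
  intro hfull
  let G := changeOfComposites.{w, v, u} (fun _ => false) hasThreeTerms
  -- Both choices give `false` on empty and two-term sequences, so the nullary and binary coherence
  -- 2-cells are identities.
  have hG : Bicat.isStrict (forgetV.map G) :=
    ⟨fun a => ⟨rfl, rfl⟩, fun a b c f g => ⟨rfl, rfl⟩⟩
  obtain ⟨⟨G', hG'⟩, e⟩ := hfull.map_surjective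
    (X := ⟨chosenCompositesUBicat (fun _ => false)⟩) (Y := ⟨chosenCompositesUBicat hasThreeTerms⟩)
    ⟨forgetV.map G, hG⟩
  -- By faithfulness of `V`, a strict preimage could only be `G` itself.
  have e' : G' = G := forgetV_faithful.map_injective (congrArg (fun x => x.hom) e)
  subst e'
  let f : TwoObjects.{v} := ⟨false⟩
  -- At three terms the target chooses `true` and the source `false`: these 1-cells are isomorphic
  -- but not equal, so the coherence 2-cell is not an identity.
  obtain ⟨h, -⟩ := hG' ⟨⟩ ⟨⟩ (cons (b := ⟨⟩) f (pair (b := ⟨⟩) f f))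
  have h' : (ULift.up true : TwoObjects.{v}) = ULift.up false := h
  exact Bool.noConfusion (congrArg ULift.down h')

end

/-! ### The functor `L` and its weak restriction -/

theorem forgetV_surjective : Function.Surjective (forgetV.{w, v, u}).obj :=
  fun C => ⟨leftUBicat C, forgetV_obj_leftUBicat C⟩

instance : (forgetV.{w, v, u}).Full := forgetV_full

instance : (forgetV.{w, v, u}).Faithful := forgetV_faithful

theorem isWeak_forgetV_map {B C : UBicat.{w, v, u}} (F : B ⟶ C) (hF : UBicat.isWeak F) :
    Bicat.isWeak (forgetV.map F) :=
  ⟨fun a => hF a a (CSeq.nil a), fun a _ c f g => hF a c (CSeq.pair f g)⟩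

theorem isStrict_forgetV_map {B C : UBicat.{w, v, u}} (F : B ⟶ C) (hF : UBicat.isStrict F) :
    Bicat.isStrict (forgetV.map F) :=
  ⟨fun a => hF a a (CSeq.nil a), fun a _ c f g => hF a c (CSeq.pair f g)⟩

instance : (forgetVwk.{w, v, u}).Full :=
  wideRestrict_full forgetV isWeak_forgetV_map isWeak_of_forgetV_map

instance : (forgetVwk.{w, v, u}).Faithful :=
  wideRestrict_faithful forgetV isWeak_forgetV_map

instance : (forgetVstr.{w, v, u}).Faithful :=
  wideRestrict_faithful forgetV isStrict_forgetV_map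

theorem forgetVwk_surjective : Function.Surjective (forgetVwk.{w, v, u}).obj :=
  wideRestrict_surjective forgetV forgetV_surjective isWeak_forgetV_map

theorem forgetVstr_surjective : Function.Surjective (forgetVstr.{w, v, u}).obj :=
  wideRestrict_surjective forgetV forgetV_surjective isStrict_forgetV_map

/-- The functor which associates to the left. -/
noncomputable def leftFunctor : Bicat.{w, v, u} ⥤ UBicat.{w, v, u} :=
  sectionFunctor forgetV leftUBicat forgetV_obj_leftUBicat

/-- Applying `V` gives back `F` up to transports, which are weak; then `V` reflects weakness. -/
theorem isWeak_leftFunctor_map {C D : Bicat.{w, v, u}} (F : C ⟶ D) (hF : Bicat.isWeak F) :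
    UBicat.isWeak (leftFunctor.map F) := by
  apply isWeak_of_forgetV_map
  have h : forgetV.map (leftFunctor.map F) = eqToHom (forgetV_obj_leftUBicat C) ≫ F ≫
      eqToHom (forgetV_obj_leftUBicat D).symm := forgetV.map_preimage _
  rw [h]
  exact Bicat.isWeak.comp_mem _ _ (eqToHom_mem _)
    (Bicat.isWeak.comp_mem _ _ hF (eqToHom_mem _))

theorem forgetVwk_obj_leftUBicat (C : BicatWk.{w, v, u}) :
    forgetVwk.obj ⟨leftUBicat C.obj⟩ = C :=
  congrArg WideSubcategory.mk (forgetV_obj_leftUBicat C.obj)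

/-- The restriction of `L` commutes with the inclusions by definition, while the section of `V_wk`
has the required inverse properties. Identifying the two gives both at once; faithfulness of `V_wk`
reduces the comparison to the images of morphisms. -/
theorem sectionFunctor_forgetVwk :
    sectionFunctor forgetVwk.{w, v, u} (fun C => ⟨leftUBicat C.obj⟩) forgetVwk_obj_leftUBicat =
      wideRestrict leftFunctor isWeak_leftFunctor_map := by
  refine CategoryTheory.Functor.hext (fun C => rfl) (fun C D F => heq_of_eq ?_)
  apply forgetVwk.map_injective
  refine (forgetVwk.map_preimage _).trans ?_
  ext
  have h : forgetV.map (leftFunctor.map F.hom) = eqToHom (forgetV_obj_leftUBicat C.obj) ≫ F.hom ≫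
      eqToHom (forgetV_obj_leftUBicat D.obj).symm := forgetV.map_preimage _
  refine Eq.trans ?_ h.symm
  exact congrArg₂ (fun x y => x ≫ F.hom ≫ y) (wideSubcategory_eqToHom_hom _)
    (wideSubcategory_eqToHom_hom _)

/-- The forgetful functor `forgetV` from unbiased bicategories and unbiased lax functors to
bicategories and lax functors, and its restrictions to weak and to strict functors. -/
theorem theorem1p1 :
    ((forgetV.{w, v, u}).Full ∧ (forgetV.{w, v, u}).Faithful ∧
      Function.Surjective (forgetV.{w, v, u}).obj) ∧
    ((forgetVwk.{w, v, u}).Full ∧ (forgetVwk.{w, v, u}).Faithful ∧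
      Function.Surjective (forgetVwk.{w, v, u}).obj) ∧
    (forgetV.{w, v, u}).IsEquivalence ∧ (forgetVwk.{w, v, u}).IsEquivalence ∧
    ((forgetVstr.{w, v, u}).Faithful ∧ Function.Surjective (forgetVstr.{w, v, u}).obj ∧
      ¬ (forgetVstr.{w, v, u}).Full) ∧
    ∃ (L : Bicat.{w, v, u} ⥤ UBicat.{w, v, u}) (Lwk : BicatWk.{w, v, u} ⥤ UBicatWk.{w, v, u}),
      (∀ C : Bicat.{w, v, u}, IsLeftAssociated C (L.obj C)) ∧
      L ⋙ forgetV.{w, v, u} = 𝟭 Bicat.{w, v, u} ∧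
      Nonempty (forgetV.{w, v, u} ⋙ L ≅ 𝟭 UBicat.{w, v, u}) ∧
      Lwk ⋙ wideSubcategoryInclusion UBicat.isWeak.{w, v, u} =
        wideSubcategoryInclusion Bicat.isWeak.{w, v, u} ⋙ L ∧
      Lwk ⋙ forgetVwk.{w, v, u} = 𝟭 BicatWk.{w, v, u} ∧
      Nonempty (forgetVwk.{w, v, u} ⋙ Lwk ≅ 𝟭 UBicatWk.{w, v, u}) := by
  refine ⟨⟨inferInstance, inferInstance, forgetV_surjective⟩,
    ⟨inferInstance, inferInstance, forgetVwk_surjective⟩,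
    isEquivalence_of_surjective _ forgetV_surjective,
    isEquivalence_of_surjective _ forgetVwk_surjective,
    ⟨inferInstance, forgetVstr_surjective, forgetVstr_not_full⟩,
    leftFunctor, wideRestrict leftFunctor isWeak_leftFunctor_map, isLeftAssociated_leftUBicat,
    sectionFunctor_comp _ _ _, ⟨compSectionFunctorIso _ _ _⟩, rfl, ?_, ?_⟩
  · rw [← sectionFunctor_forgetVwk]
    exact sectionFunctor_comp _ _ _
  · rw [← sectionFunctor_forgetVwk]
    exact ⟨compSectionFunctorIso _ _ _⟩
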